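/- Let $n\ge 3$, let $\Omega\subset\mathbb{R}^n$ be a bounded simply connected open set with $C^2$ boundary and outward unit normal $\nu$, let $T>\operatorname{diam}(\Omega)$, and put $Q=(0,T)\times\Omega$, $\Sigma=(0,T)\times\partial\Omega$. Let $A_0,A_1,\dots,A_n\in C_c^\infty(Q)$ be real-valued, let $q\in L^\infty(Q)$ be complex-valued, write $\mathcal{A}=(A_0,\dots,A_n)$, and set $$\mathcal{L}_{\mathcal{A},q}u=(\partial_t+A_0)^2u-\sum_{j=1}^n(\partial_j+A_j)^2u+q\,u .$$ For $\omega\in\mathbb{S}^{n-1}$ let $\varphi(t,x)=t+x\cdot\omega$, $\Sigma_{+,\omega}=(0,T)\times\{x\in\partial\Omega:\nu(x)\cdot\omega\ge 0\}$ and $\Sigma_{-,\omega}=(0,T)\times\{x\in\partial\Omega:\nu(x)\cdot\omega\le 0\}$, and let $(f,g)_{L^2}=\int f\,\overline{g}$, where $\Sigma$ carries the measure $dS_x\,dt$ with $dS_x$ the surface measure on $\partial\Omega$. Then there are constants $C>0$ and $h_0>0$, depending only on $\Omega$, $T$, $\mathcal{A}$ and $q$, such that for every $\omega\in\mathbb{S}^{n-1}$,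 every $h\in(0,h_0)$ and every complex-valued $u\in C^2(\overline{Q})$ with $$u|_{\Sigma}=0,\qquad u|_{t=0}=\partial_tu|_{t=0}=0,$$ one has $$\begin{aligned} &h\left(e^{-\varphi/h}\,\partial_\nu\varphi\,\partial_\nu u,\;e^{-\varphi/h}\partial_\nu u\right)_{L^2(\Sigma_{+,\omega})}+h\left\|e^{-\varphi(T,\cdot)/h}\partial_tu(T,\cdot)\right\|_{L^2(\Omega)}^2\\ &\quad+\left\|e^{-\varphi/h}u\right\|_{L^2(Q)}^2+\left\|h\,e^{-\varphi/h}\partial_tu\right\|_{L^2(Q)}^2+\left\|h\,e^{-\varphi/h}\nabla_xu\right\|_{L^2(Q)}^2\\ &\le C\Big(\left\|h\,e^{-\varphi/h}\mathcal{L}_{\mathcal{A},q}u\right\|_{L^2(Q)}^2+\left\|e^{-\varphi(T,\cdot)/h}u(T,\cdot)\right\|_{L^2(\Omega)}^2+h\left\|e^{-\varphi(T,\cdot)/h}\nabla_xu(T,\cdot)\right\|_{L^2(\Omega)}^2\\ &\qquad\quad+h\left(e^{-\varphi/h}(-\partial_\nu\varphi)\,\partial_\nu u,\;e^{-\varphi/h}\partial_\nu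 u\right)_{L^2(\Sigma_{-,\omega})}\Big). \end{aligned}$$ -/

import Mathlib

open MeasureTheory Set Filter Topology
open scoped Gradient RealInnerProductSpace

noncomputable section

namespace WaveCarleman

variable {n : ℕ}

/-- The Euclidean space `ℝⁿ`. -/
abbrev Space (n : ℕ) : Type := EuclideanSpace ℝ (Fin n)

/-- Space-time `ℝ × ℝⁿ`, with points `(t, x)`. -/
abbrev SpaceTime (n : ℕ) : Type := ℝ × Space n

/-- `Ω` has `C²` boundary: near each boundary point, after choosing a unit vector `e` as the
vertical direction, `Ω` is the region strictly above the graph of a `C²` function on the hyperplane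
orthogonal to `e`. -/
def HasC2Boundary (Ω : Set (Space n)) : Prop :=
  ∀ p ∈ frontier Ω, ∃ (e : Space n) (γ : (ℝ ∙ e)ᗮ → ℝ) (r : ℝ),
    ‖e‖ = 1 ∧ ContDiff ℝ 2 γ ∧ 0 < r ∧
      ∀ x ∈ Metric.ball p r, x ∈ Ω ↔ γ ((ℝ ∙ e)ᗮ.orthogonalProjectionOnto x) < ⟪e, x⟫

/-- `v` is the outward unit normal to `Ω` at `p`: near `p` the set `Ω` is `{ρ < 0}` for a `C¹`
function `ρ` with `ρ p = 0` and `∇ρ p ≠ 0`, and `v = ∇ρ p / |∇ρ p|`. -/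
def IsOutwardUnitNormal (Ω : Set (Space n)) (p v : Space n) : Prop :=
  ∃ ρ : Space n → ℝ, ContDiffAt ℝ 1 ρ p ∧ ρ p = 0 ∧ ∇ ρ p ≠ 0 ∧
    (∀ᶠ x in 𝓝 p, x ∈ Ω ↔ ρ x < 0) ∧ v = ‖∇ ρ p‖⁻¹ • ∇ ρ p

/-- The outward unit normal is unique. -/
theorem IsOutwardUnitNormal.eq {Ω : Set (Space n)} {p v w : Space n}
    (hv : IsOutwardUnitNormal Ω p v) (hw : IsOutwardUnitNormal Ω p w) : v = w := by
  have key : ∀ (ρ : Space n → ℝ), ContDiffAt ℝ 1 ρ p → ρ p = 0 → ∀ d : Space n,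
      Tendsto (fun s : ℝ => s⁻¹ * ρ (p + s • d)) (𝓝[>] 0) (𝓝 ⟪∇ ρ p, d⟫) := by
    intro ρ hρ h0 d
    have h1 : HasFDerivAt ρ (fderiv ℝ ρ p) p :=
      (hρ.differentiableAt (by norm_num)).hasFDerivAt
    have h2 := (h1.hasLineDerivAt d).tendsto_slope_zero_right
    simpa [h0, gradient, InnerProductSpace.toDual_symm_apply] using h2
  obtain ⟨ρ, hρ, hρ0, hρg, hρΩ, rfl⟩ := hv
  obtain ⟨σ, hσ, hσ0, hσg, hσΩ, rfl⟩ := hw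
  set a := ∇ ρ p
  set b := ∇ σ p
  by_contra hne
  set v := ‖a‖⁻¹ • a with hv
  set w := ‖b‖⁻¹ • b with hw
  have ha : 0 < ‖a‖ := norm_pos_iff.2 hρg
  have hb : 0 < ‖b‖ := norm_pos_iff.2 hσg
  have hv1 : ‖v‖ = 1 := by rw [hv, norm_smul, norm_inv, norm_norm, inv_mul_cancel₀ ha.ne']
  have hw1 : ‖w‖ = 1 := by rw [hw, norm_smul, norm_inv, norm_norm, inv_mul_cancel₀ hb.ne']
  have hav : a = ‖a‖ • v := by rw [hv, smul_smul, mul_inv_cancel₀ ha.ne', one_smul]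
  have hbw : b = ‖b‖ • w := by rw [hw, smul_smul, mul_inv_cancel₀ hb.ne', one_smul]
  have hlt : ⟪v, w⟫ < 1 := (inner_lt_one_iff_real_of_norm_eq_one hv1 hw1).2 hne
  have hA : ⟪a, w - v⟫ < 0 := by
    rw [hav, real_inner_smul_left, inner_sub_right, real_inner_self_eq_norm_sq, hv1]
    nlinarith
  have hB : 0 < ⟪b, w - v⟫ := by
    rw [hbw, real_inner_smul_left, inner_sub_right, real_inner_self_eq_norm_sq, hw1,
      real_inner_comm]
    nlinarith
  have hlim : Tendsto (fun s : ℝ => p + s • (w - v)) (𝓝[>] 0) (𝓝 p) := by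
    have : Tendsto (fun s : ℝ => p + s • (w - v)) (𝓝 0) (𝓝 (p + (0 : ℝ) • (w - v))) :=
      (by fun_prop : Continuous fun s : ℝ => p + s • (w - v)).tendsto 0
    simpa using this.mono_left nhdsWithin_le_nhds
  have hev := ((key ρ hρ hρ0 (w - v)).eventually_lt_const hA).and
    (((key σ hσ hσ0 (w - v)).eventually_const_lt hB).and
      ((hlim.eventually hρΩ).and ((hlim.eventually hσΩ).and self_mem_nhdsWithin)))
  obtain ⟨s, h1, h2, h3, h4, hs⟩ := hev.exists
  have hs' : 0 < s⁻¹ := inv_pos.2 hs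
  have h5 : ρ (p + s • (w - v)) < 0 := by
    by_contra hc
    exact absurd h1 (not_lt.2 (mul_nonneg hs'.le (not_lt.1 hc)))
  have h6 : 0 < σ (p + s • (w - v)) := pos_of_mul_pos_right h2 hs'.le
  exact absurd (h4.1 (h3.2 h5)) (not_lt.2 h6.le)

/-- An open set with `C²` boundary has an outward unit normal at each boundary point. -/
theorem HasC2Boundary.exists_isOutwardUnitNormal {Ω : Set (Space n)} (hΩ : HasC2Boundary Ω)
    (hopen : IsOpen Ω) {p : Space n} (hp : p ∈ frontier Ω) :
    ∃ v, IsOutwardUnitNormal Ω p v := by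
  obtain ⟨e, γ, r, he, hγ, hr, hchart⟩ := hΩ p hp
  set ρ : Space n → ℝ := fun x => γ ((ℝ ∙ e)ᗮ.orthogonalProjectionOnto x) - ⟪e, x⟫ with hρdef
  have hρ : ContDiff ℝ 2 ρ := by
    refine (hγ.comp (ContinuousLinearMap.contDiff _)).sub ?_
    exact contDiff_const.inner ℝ contDiff_id
  have hev : ∀ᶠ x in 𝓝 p, x ∈ Ω ↔ ρ x < 0 := by
    filter_upwards [Metric.ball_mem_nhds p hr] with x hx
    rw [hchart x hx, hρdef, sub_neg]
  have hpΩ : p ∉ Ω := fun h => by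
    rw [hopen.frontier_eq] at hp
    exact hp.2 h
  have h0 : ρ p = 0 := by
    have h1 : 0 ≤ ρ p := not_lt.1 fun h => hpΩ (hev.self_of_nhds.2 h)
    refine le_antisymm (not_lt.1 fun h => ?_) h1
    have h2 : ∀ᶠ x in 𝓝 p, x ∉ Ω := by
      filter_upwards [hev, hρ.continuous.continuousAt.eventually_const_lt h] with x hx hx'
      rw [hx]
      exact not_lt.2 hx'.le
    obtain ⟨x, hx, hx'⟩ := (mem_closure_iff_frequently.1 hp.1).and_eventually h2 |>.exists
    exact hx' hx
  have hg : ∇ ρ p ≠ 0 := by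
    intro hg
    have hd : HasFDerivAt ρ (fderiv ℝ ρ p) p :=
      (hρ.contDiffAt.differentiableAt (by norm_num)).hasFDerivAt
    have hf : fderiv ℝ ρ p = 0 := by simpa [gradient] using hg
    have hl : HasDerivAt (fun s : ℝ => ρ (p + s • e)) (fderiv ℝ ρ p e) 0 := hd.hasLineDerivAt e
    have hproj : (ℝ ∙ e)ᗮ.orthogonalProjectionOnto e = 0 := by simp
    have hl' : HasDerivAt (fun s : ℝ => ρ (p + s • e)) (-1) 0 := by
      have : (fun s : ℝ => ρ (p + s • e)) = fun s => ρ p - s := by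
        funext s
        simp only [hρdef, map_add, map_smul, hproj, smul_zero, add_zero, inner_add_right,
          real_inner_smul_right, real_inner_self_eq_norm_sq, he]
        ring
      rw [this]
      simpa using (hasDerivAt_id (0 : ℝ)).const_sub (ρ p)
    have := hl.unique hl'
    rw [hf] at this
    norm_num at this
  exact ⟨_, ρ, hρ.contDiffAt.of_le (by norm_num), h0, hg, hev, rfl⟩

open Classical in
/-- The outward unit normal `ν(p)` (and `0` where there is none). -/
def outwardNormal (Ω : Set (Space n)) (p : Space n) : Space n :=
  if h : ∃ v, IsOutwardUnitNormal Ω p v then h.choose else 0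

/-- The space-time cylinder `Q = (0,T) × Ω`. -/
def stCylinder (T : ℝ) (Ω : Set (Space n)) : Set (SpaceTime n) := Ioo 0 T ×ˢ Ω

/-- The lateral boundary `Σ = (0,T) × ∂Ω`. -/
def lateral (T : ℝ) (Ω : Set (Space n)) : Set (SpaceTime n) := Ioo 0 T ×ˢ frontier Ω

/-- `Σ_{+,ω} = (0,T) × {x ∈ ∂Ω : ν(x) · ω ≥ 0}`. -/
def lateralPlus (T : ℝ) (Ω : Set (Space n)) (ω : Space n) : Set (SpaceTime n) :=
  Ioo 0 T ×ˢ {x ∈ frontier Ω | 0 ≤ ⟪outwardNormal Ω x, ω⟫}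

/-- `Σ_{-,ω} = (0,T) × {x ∈ ∂Ω : ν(x) · ω ≤ 0}`. -/
def lateralMinus (T : ℝ) (Ω : Set (Space n)) (ω : Space n) : Set (SpaceTime n) :=
  Ioo 0 T ×ˢ {x ∈ frontier Ω | ⟪outwardNormal Ω x, ω⟫ ≤ 0}

/-- The measure `dS_x dt` on `ℝ × ∂Ω`, where `dS_x` is the `(n-1)`-dimensional Hausdorff measure,
normalized so as to agree with Lebesgue measure on hyperplanes. -/
def lateralMeasure (Ω : Set (Space n)) : Measure (SpaceTime n) :=
  (volume : Measure ℝ).prod ((Measure.euclideanHausdorffMeasure (n - 1)).restrict (frontier Ω))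

section Derivatives

variable {F : Type*} [NormedAddCommGroup F] [NormedSpace ℝ F]

/-- The time derivative `∂_t f` of a function on `K`. In the interior of `K` this is the usual
derivative; at boundary points it is the derivative from within `K`. -/
def dt (K : Set (SpaceTime n)) (f : SpaceTime n → F) (z : SpaceTime n) : F :=
  fderivWithin ℝ f K z (1, 0)

/-- The spatial derivative `∂_j f` of a function on `K`. -/
def dx (K : Set (SpaceTime n)) (j : Fin n) (f : SpaceTime n → F) (z : SpaceTime n) : F :=
  fderivWithin ℝ f K z (0, EuclideanSpace.single j 1)

/-- `|∇_x f|²`. -/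
def gradSq (K : Set (SpaceTime n)) (f : SpaceTime n → F) (z : SpaceTime n) : ℝ :=
  ∑ j, ‖dx K j f z‖ ^ 2

/-- The normal derivative `∂_ν f = ∑ⱼ νⱼ ∂_j f` on the lateral boundary. -/
def dnu (K : Set (SpaceTime n)) (Ω : Set (Space n)) (f : SpaceTime n → F) (z : SpaceTime n) : F :=
  ∑ j, outwardNormal Ω z.2 j • dx K j f z

end Derivatives

/-- `(∂_t + a) f`. -/
def covDt (K : Set (SpaceTime n)) (a : SpaceTime n → ℝ) (f : SpaceTime n → ℂ) :
    SpaceTime n → ℂ :=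
  fun z => dt K f z + (a z : ℂ) * f z

/-- `(∂_j + a) f`. -/
def covDx (K : Set (SpaceTime n)) (j : Fin n) (a : SpaceTime n → ℝ) (f : SpaceTime n → ℂ) :
    SpaceTime n → ℂ :=
  fun z => dx K j f z + (a z : ℂ) * f z

/-- The operator `𝓛_{𝒜,q} u = (∂_t + A₀)² u - ∑ⱼ (∂_j + A_j)² u + q u`, `𝒜 = (A₀, A)`. -/
def waveOp (K : Set (SpaceTime n)) (A₀ : SpaceTime n → ℝ) (A : Fin n → SpaceTime n → ℝ)
    (q : SpaceTime n → ℂ) (u : SpaceTime n → ℂ) (z : SpaceTime n) : ℂ :=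
  covDt K A₀ (covDt K A₀ u) z - ∑ j, covDx K j (A j) (covDx K j (A j) u) z + q z * u z

/-- Membership in `C_c^∞(Q)`. -/
def IsTestFunction (Q : Set (SpaceTime n)) (f : SpaceTime n → ℝ) : Prop :=
  ContDiff ℝ (⊤ : ℕ∞) f ∧ HasCompactSupport f ∧ tsupport f ⊆ Q

/-- The linear weight `φ(t,x) = t + x · ω`. -/
def phase (ω : Space n) (z : SpaceTime n) : ℝ := z.1 + ⟪z.2, ω⟫

/-- The factor `e^{-φ/h}`. -/
def weight (ω : Space n) (h : ℝ) (z : SpaceTime n) : ℝ := Real.exp (-phase ω z / h)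

/-- The left-hand side of the estimate, with `K` the closure of `Q`:
`h (e^{-φ/h} ∂_νφ ∂_νu, e^{-φ/h} ∂_νu)_{L²(Σ_{+,ω})} + h ‖e^{-φ(T)/h} ∂_t u(T)‖²_{L²(Ω)}
  + ‖e^{-φ/h} u‖²_{L²(Q)} + ‖h e^{-φ/h} ∂_t u‖²_{L²(Q)} + ‖h e^{-φ/h} ∇_x u‖²_{L²(Q)}`. -/
def carlemanLHS (Ω : Set (Space n)) (T : ℝ) (ω : Space n) (h : ℝ) (u : SpaceTime n → ℂ) : ℝ :=
  let K := closure (stCylinder T Ω)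
  h * (∫ z in lateralPlus T Ω ω,
        dnu K Ω (phase ω) z * (weight ω h z * ‖dnu K Ω u z‖) ^ 2 ∂(lateralMeasure Ω))
    + h * (∫ x in Ω, (weight ω h (T, x) * ‖dt K u (T, x)‖) ^ 2)
    + (∫ z in stCylinder T Ω, (weight ω h z * ‖u z‖) ^ 2)
    + (∫ z in stCylinder T Ω, (h * weight ω h z * ‖dt K u z‖) ^ 2)
    + (∫ z in stCylinder T Ω, (h * weight ω h z) ^ 2 * gradSq K u z)

/-- The bracket on the right-hand side of the estimate, with `K` the closure of `Q`:
`‖h e^{-φ/h} 𝓛_{𝒜,q}u‖²_{L²(Q)} + ‖e^{-φ(T)/h} u(T)‖²_{L²(Ω)} + h ‖e^{-φ(T)/h} ∇_x u(T)‖²_{L²(Ω)}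
  + h (e^{-φ/h} (-∂_νφ) ∂_νu, e^{-φ/h} ∂_νu)_{L²(Σ_{-,ω})}`. -/
def carlemanRHS (Ω : Set (Space n)) (T : ℝ) (A₀ : SpaceTime n → ℝ) (A : Fin n → SpaceTime n → ℝ)
    (q : SpaceTime n → ℂ) (ω : Space n) (h : ℝ) (u : SpaceTime n → ℂ) : ℝ :=
  let K := closure (stCylinder T Ω)
  (∫ z in stCylinder T Ω, (h * weight ω h z * ‖waveOp K A₀ A q u z‖) ^ 2)
    + (∫ x in Ω, (weight ω h (T, x) * ‖u (T, x)‖) ^ 2)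
    + h * (∫ x in Ω, weight ω h (T, x) ^ 2 * gradSq K u (T, x))
    + h * (∫ z in lateralMinus T Ω ω,
        (-dnu K Ω (phase ω) z) * (weight ω h z * ‖dnu K Ω u z‖) ^ 2 ∂(lateralMeasure Ω))

end WaveCarleman

end

open WaveCarleman

/-! The linear phase is characteristic, `φ_t² = |∇φ|²`, so conjugating the d'Alembertian `□` by
`e^{-φ/h}` alone gives an energy identity with no bulk term. The weight is therefore convexified to
`E = exp(-φ/h + λt²/2)`. With `v = E u` and `a = 1 - λht` one gets `h E □u = F`, where `F = h□v + 2X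
+ βv` and `X = a ∂ₜv - ω·∇v` (`conjWave_convexWeight_mul`).

The multiplier is `X` itself. The product `(h□v + βv) X = (F - 2X) X` is a space-time divergence
plus `(λh²/2)(|∂ₜv|² + |∇v|²) - (βa)' v²/2`, and `-(βa)' ≥ λ` once `hλ(6T+1) ≤ 1`. On the other side
`(F - 2X) X ≤ F²/8`. Integration over the cylinder (`energy_inequality`) controls the bulk norm with
the large factor `λ`. Nothing comes from `t = 0`; the lateral boundary gives `(h/2)(ν·ω)|∂_νv|²`,
because the gradient is normal there; the time `T` gives the terms estimated in
`energyDensity_lower_bound`.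

Since `□` has real coefficients, the estimate passes from real to complex `u` through real and
imaginary parts (`carleman_box`). The terms with `𝒜` and `q` are of lower order and are absorbed by
taking `λ` large, independently of `h`, `ω` and `u` (`exists_carleman_waveOp`). With `λ` fixed,
`e^{-φ/h}` and `E` differ by a factor between `1` and `e^{λT²/2}`, so the convexification disappears
into the constant.

The divergence theorem is established for some boundary measure `σ` bounded above and below by
multiples of surface measure (`HasC2Boundary.exists_boundaryMeasure`). That is enough: once the
lateral term is split into the parts where `ν·ω` is positive and negative, only inequalities up to a
constant are needed. -/

namespace WaveCarleman

/-! ### Divergence theorem above the graph of a function. -/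

section Supergraph

/-- A bounded measurable function that vanishes outside a set of finite measure is integrable. -/
theorem integrable_of_bound_of_support {α : Type*} [MeasurableSpace α] {μ : Measure α}
    {f : α → ℝ} (hf : AEStronglyMeasurable f μ) {s : Set α} (hs : MeasurableSet s)
    (hμs : μ s < ⊤) (M : ℝ) (hM : ∀ᵐ x ∂μ, ‖f x‖ ≤ M) (h0 : ∀ᵐ x ∂μ, x ∉ s → f x = 0) :
    Integrable f μ := by
  have h1 : Integrable (s.indicator fun _ => M) μ :=
    (integrable_indicator_iff hs).2 (integrableOn_const hμs.ne)
  refine h1.mono' hf ?_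
  filter_upwards [hM, h0] with x hx hx0
  by_cases hxs : x ∈ s
  · simpa [hxs] using hx
  · simp [hxs, hx0 hxs]

variable {H : Type*} [NormedAddCommGroup H] [NormedSpace ℝ H] [FiniteDimensional ℝ H]
  [MeasurableSpace H] [BorelSpace H] {μ : Measure H} [μ.IsAddHaarMeasure]

/-- The integral of a directional derivative of a compactly supported function with bounded
derivative vanishes. -/
theorem integral_fderiv_eq_zero {f : H → ℝ} (hf : Differentiable ℝ f) (hc : HasCompactSupport f)
    {M : ℝ} (hM : ∀ y, ‖fderiv ℝ f y‖ ≤ M) (b : H) : ∫ y, fderiv ℝ f y b ∂μ = 0 := by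
  have hint : Integrable (fun y => fderiv ℝ f y b) μ := by
    refine integrable_of_bound_of_support
      (measurable_fderiv_apply_const ℝ f b).aestronglyMeasurable hc.isCompact.measurableSet
      hc.isCompact.measure_lt_top (M * ‖b‖) (ae_of_all _ fun y => ?_) (ae_of_all _ fun y hy => ?_)
    · exact (ContinuousLinearMap.le_opNorm _ _).trans (by gcongr; exact hM y)
    · rw [fderiv_of_notMem_tsupport ℝ hy]; rfl
  -- Integration by parts against the constant function `1`.
  have := integral_mul_fderiv_eq_neg_fderiv_mul_of_integrable (μ := μ) (f := fun _ : H => (1 : ℝ))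
    (g := f) (v := b) (by simp) (by simpa using hint)
    (by simpa using hf.continuous.integrable_of_hasCompactSupport hc)
    (fun x _ => by fun_prop) (fun x _ => hf x)
  simpa using this

/-- **Divergence theorem for a supergraph** in `H × ℝ`, for one directional derivative. -/
theorem integral_fderiv_supergraph {γ : H → ℝ} (hγ : ContDiff ℝ 1 γ) {G : H × ℝ → ℝ}
    (hc : HasCompactSupport G) (hcont : ContinuousOn G {z | γ z.1 ≤ z.2})
    (hd : ∀ z : H × ℝ, γ z.1 < z.2 → DifferentiableAt ℝ G z) {M : ℝ}
    (hM : ∀ z : H × ℝ, γ z.1 < z.2 → ‖fderiv ℝ G z‖ ≤ M) (b : H) (τ : ℝ) :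
    ∫ z in {z : H × ℝ | γ z.1 < z.2}, fderiv ℝ G z (b, τ) ∂(μ.prod volume)
      = ∫ y, G (y, γ y) * (fderiv ℝ γ y b - τ) ∂μ := by
  have hγd : Differentiable ℝ γ := hγ.differentiable (by norm_num)
  have hγc : Continuous γ := hγ.continuous
  have hγ'c : Continuous fun y => fderiv ℝ γ y b :=
    (hγ.continuous_fderiv (by norm_num)).clm_apply continuous_const
  -- This shear flattens the graph to `s = 0`. It acts by a translation on each vertical line, hence
  -- preserves the product measure.
  set S : H × ℝ → H × ℝ := fun p => (p.1, γ p.1 + p.2) with hS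
  have hSc : Continuous S := by fun_prop
  set Sinv : H × ℝ → H × ℝ := fun p => (p.1, p.2 - γ p.1) with hSinv
  have hSinvc : Continuous Sinv := by fun_prop
  have hSS : ∀ p, Sinv (S p) = p := fun p => by simp [hS, hSinv]
  have hSS' : ∀ p, S (Sinv p) = p := fun p => by simp [hS, hSinv]
  let eS : (H × ℝ) ≃ₜ (H × ℝ) := ⟨⟨S, Sinv, hSS, hSS'⟩, hSc, hSinvc⟩
  have hmp : MeasurePreserving S (μ.prod volume) (μ.prod (volume : Measure ℝ)) := by
    refine (MeasurePreserving.id μ).skew_product (g := fun y s => γ y + s) ?_ ?_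
    · exact (by fun_prop : Continuous fun p : H × ℝ => γ p.1 + p.2).measurable
    · exact ae_of_all _ fun y => (measurePreserving_add_left volume (γ y)).map_eq
  have hpre : S ⁻¹' {z : H × ℝ | γ z.1 < z.2} = univ ×ˢ Ioi 0 := by
    ext p; simp [hS]
  have hstep : ∫ z in {z : H × ℝ | γ z.1 < z.2}, fderiv ℝ G z (b, τ) ∂(μ.prod volume)
      = ∫ p, fderiv ℝ G (S p) (b, τ) ∂(μ.prod (volume.restrict (Ioi (0 : ℝ)))) := by
    rw [← hmp.setIntegral_preimage_emb eS.measurableEmbedding, hpre, ← Measure.prod_restrict,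
      Measure.restrict_univ]
  set ν : Measure ℝ := volume.restrict (Ioi (0 : ℝ)) with hν
  have hpos : ∀ᵐ p ∂(μ.prod ν), 0 < p.2 := by
    have : ∀ᵐ s ∂ν, (0 : ℝ) < s := ae_restrict_mem measurableSet_Ioi
    exact (Measure.quasiMeasurePreserving_snd (μ := μ) (ν := ν)).ae this
  have hmem : ∀ p : H × ℝ, 0 < p.2 → γ (S p).1 < (S p).2 := fun p hp => by simpa [hS] using hp
  -- the compact set carrying all integrands
  set Kc : Set (H × ℝ) := S ⁻¹' tsupport G with hKc
  have hKcomp : IsCompact Kc := eS.isCompact_preimage.2 hc.isCompact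
  have hKfin : (μ.prod ν) Kc < ⊤ := by
    refine lt_of_le_of_lt ?_ (hKcomp.measure_lt_top (μ := μ.prod (volume : Measure ℝ)))
    exact Measure.prod_mono le_rfl Measure.restrict_le_self Kc
  obtain ⟨B, hB⟩ : ∃ B, ∀ p ∈ Kc, ‖fderiv ℝ γ p.1 b‖ ≤ B :=
    hKcomp.exists_bound_of_continuousOn (hγ'c.comp continuous_fst).continuousOn
  have h0 : ∀ p, p ∉ Kc → fderiv ℝ G (S p) = 0 := fun p hp => fderiv_of_notMem_tsupport ℝ hp
  have hmeas : ∀ w : H × ℝ, Measurable fun p => fderiv ℝ G (S p) w := fun w =>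
    (measurable_fderiv_apply_const ℝ G w).comp hSc.measurable
  have hbd : ∀ w : H × ℝ, ∀ᵐ p ∂(μ.prod ν), ‖fderiv ℝ G (S p) w‖ ≤ M * ‖w‖ := fun w => by
    filter_upwards [hpos] with p hp
    exact (ContinuousLinearMap.le_opNorm _ _).trans (by gcongr; exact hM _ (hmem p hp))
  have hI : ∀ w : H × ℝ, Integrable (fun p => fderiv ℝ G (S p) w) (μ.prod ν) := fun w => by
    refine integrable_of_bound_of_support (hmeas w).aestronglyMeasurable hKcomp.measurableSet
      hKfin (M * ‖w‖) (hbd w) (ae_of_all _ fun p hp => by rw [h0 p hp]; rfl)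
  have hIγ : Integrable (fun p => fderiv ℝ γ p.1 b * fderiv ℝ G (S p) (0, 1)) (μ.prod ν) := by
    refine integrable_of_bound_of_support
      (((hγ'c.comp continuous_fst).measurable.mul (hmeas _)).aestronglyMeasurable)
      hKcomp.measurableSet hKfin (|B| * (M * ‖((0 : H), (1 : ℝ))‖)) ?_
      (ae_of_all _ fun p hp => by rw [h0 p hp]; simp)
    filter_upwards [hbd (0, 1)] with p hp
    rw [norm_mul]
    by_cases hpK : p ∈ Kc
    · exact mul_le_mul ((hB p hpK).trans (le_abs_self B)) hp (norm_nonneg _) (abs_nonneg _)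
    · rw [h0 p hpK]
      simpa using mul_nonneg (abs_nonneg B) ((norm_nonneg _).trans hp)
  -- The direction is split into a vector tangent to the translated graph and a vertical remainder;
  -- the coefficient of the remainder becomes the boundary factor.
  have hdecomp : ∀ p : H × ℝ, fderiv ℝ G (S p) (b, τ)
      = fderiv ℝ G (S p) (b, fderiv ℝ γ p.1 b)
        + (τ - fderiv ℝ γ p.1 b) * fderiv ℝ G (S p) (0, 1) := fun p => by
    have : ((b, τ) : H × ℝ) = (b, fderiv ℝ γ p.1 b) + (τ - fderiv ℝ γ p.1 b) • (0, 1) := by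
      ext <;> simp
    conv_lhs => rw [this]
    rw [map_add, map_smul, smul_eq_mul]
  have hf1 : ∀ p : H × ℝ, fderiv ℝ G (S p) (b, fderiv ℝ γ p.1 b)
      = fderiv ℝ G (S p) (b, 0) + fderiv ℝ γ p.1 b * fderiv ℝ G (S p) (0, 1) := fun p => by
    have : ((b, fderiv ℝ γ p.1 b) : H × ℝ) = (b, 0) + (fderiv ℝ γ p.1 b) • (0, 1) := by
      ext <;> simp
    conv_lhs => rw [this]
    rw [map_add, map_smul, smul_eq_mul]
  have hI1 : Integrable (fun p => fderiv ℝ G (S p) (b, fderiv ℝ γ p.1 b)) (μ.prod ν) := by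
    simp_rw [hf1]; exact (hI _).add hIγ
  have hI2 : Integrable (fun p => (τ - fderiv ℝ γ p.1 b) * fderiv ℝ G (S p) (0, 1))
      (μ.prod ν) := by
    simp_rw [sub_mul]; exact ((hI _).const_mul τ).sub hIγ
  rw [hstep]
  simp_rw [hdecomp]
  rw [integral_add hI1 hI2, integral_prod_symm _ hI1, integral_prod _ hI2]
  -- At fixed height `s` the tangential part is the derivative along `b` of `y ↦ G (y, γ y + s)`,
  -- which has compact support.
  have hz1 : ∀ᵐ s ∂ν, ∫ y, fderiv ℝ G (S (y, s)) (b, fderiv ℝ γ y b) ∂μ = 0 := by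
    filter_upwards [ae_restrict_mem measurableSet_Ioi] with s hs
    have hs' : ∀ y, γ (S (y, s)).1 < (S (y, s)).2 := fun y => hmem (y, s) hs
    have hSd : ∀ y, HasFDerivAt (fun y => S (y, s))
        ((ContinuousLinearMap.id ℝ H).prod (fderiv ℝ γ y)) y := fun y =>
      (hasFDerivAt_id y).prodMk ((hγd y).hasFDerivAt.add_const s)
    have hfd : ∀ y, HasFDerivAt (fun y => G (S (y, s)))
        ((fderiv ℝ G (S (y, s))).comp ((ContinuousLinearMap.id ℝ H).prod (fderiv ℝ γ y))) y :=
      fun y => (hd _ (hs' y)).hasFDerivAt.comp y (hSd y)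
    have hcs : HasCompactSupport fun y => G (S (y, s)) := by
      refine HasCompactSupport.intro (hKcomp.image continuous_fst) fun y hy => ?_
      by_contra hne
      exact hy ⟨(y, s), subset_tsupport _ hne, rfl⟩
    have h0' : ∀ y, y ∉ Prod.fst '' Kc → fderiv ℝ G (S (y, s)) = 0 := fun y hy =>
      h0 _ fun hK => hy ⟨(y, s), hK, rfl⟩
    obtain ⟨B', hB'⟩ : ∃ B', ∀ y ∈ Prod.fst '' Kc, ‖fderiv ℝ γ y‖ ≤ B' :=
      (hKcomp.image continuous_fst).exists_bound_of_continuousOn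
        (hγ.continuous_fderiv (by norm_num)).continuousOn
    have := integral_fderiv_eq_zero (μ := μ) (f := fun y => G (S (y, s)))
      (fun y => (hfd y).differentiableAt) hcs (M := |M| * max 1 |B'|) (fun y => ?_) b
    · rw [← this]
      refine integral_congr_ae (ae_of_all _ fun y => ?_)
      simp only [(hfd y).fderiv]
      rfl
    · rw [(hfd y).fderiv]
      by_cases hy : y ∈ Prod.fst '' Kc
      · refine (ContinuousLinearMap.opNorm_comp_le _ _).trans ?_
        refine mul_le_mul ((hM _ (hs' y)).trans (le_abs_self M)) ?_ (norm_nonneg _) (abs_nonneg _)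
        refine ContinuousLinearMap.opNorm_le_bound _ (by positivity) fun w => ?_
        simp only [ContinuousLinearMap.prod_apply, ContinuousLinearMap.id_apply, Prod.norm_def]
        refine max_le ?_ ?_
        · exact le_mul_of_one_le_left (norm_nonneg w) (le_max_left _ _)
        · refine (ContinuousLinearMap.le_opNorm _ _).trans ?_
          gcongr
          exact (hB' y hy).trans ((le_abs_self _).trans (le_max_right _ _))
      · rw [h0' y hy]
        simp only [ContinuousLinearMap.zero_comp, norm_zero]
        positivity
  rw [integral_congr_ae hz1]
  simp only [integral_zero, zero_add]
  have hI2' : ∀ᵐ y ∂μ, Integrable (fun s => fderiv ℝ G (S (y, s)) (0, 1)) ν :=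
    (hI (0, 1)).prod_right_ae
  refine integral_congr_ae ?_
  filter_upwards [hI2'] with y hy
  rw [integral_const_mul]
  -- The vertical part is integrated from the graph to infinity. `G` is differentiable only strictly
  -- above the graph, so one-sided continuity is used at the endpoint.
  have hft := integral_Ioi_of_hasDerivAt_of_tendsto (a := (0 : ℝ)) (m := 0)
    (f := fun s => G (S (y, s))) (f' := fun s => fderiv ℝ G (S (y, s)) (0, 1)) ?_ ?_ hy ?_
  · have hν' : ∫ s, fderiv ℝ G (S (y, s)) (0, 1) ∂ν = 0 - G (S (y, 0)) := hft
    rw [hν']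
    simp only [hS, add_zero]
    ring
  · have h1 : ContinuousWithinAt G {z | γ z.1 ≤ z.2} (S (y, 0)) :=
      hcont _ (by simp [hS])
    refine h1.comp (f := fun s => S (y, s)) ?_ fun s hs => ?_
    · exact (by fun_prop : Continuous fun s : ℝ => S (y, s)).continuousWithinAt
    · simpa [hS] using hs
  · intro s hs
    have h1 : HasDerivAt (fun s : ℝ => S (y, s)) ((0 : H), (1 : ℝ)) s :=
      (hasDerivAt_const s y).prodMk ((hasDerivAt_id s).const_add (γ y))
    exact (hd _ (hmem (y, s) hs)).hasFDerivAt.comp_hasDerivAt s h1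
  · refine tendsto_const_nhds.congr' ?_
    obtain ⟨R, hR⟩ := (hKcomp.image continuous_snd).isBounded.subset_closedBall 0
    filter_upwards [eventually_gt_atTop R] with s hs
    by_contra hne
    have hK : (y, s) ∈ Kc := subset_tsupport G (Ne.symm hne)
    have := hR ⟨(y, s), hK, rfl⟩
    rw [mem_closedBall_zero_iff, Real.norm_eq_abs] at this
    linarith [le_abs_self s]

end Supergraph

/-! ### Geometry of graph charts of the boundary. -/

variable {n : ℕ}

/-- In the ball of radius `r` around `p`, the set `Ω` is the region above the graph of the `C²`
function `γ` over the hyperplane orthogonal to the unit vector `e`. -/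
structure IsGraphChart (Ω : Set (Space n)) (p e : Space n) (γ : (ℝ ∙ e)ᗮ → ℝ) (r : ℝ) : Prop where
  norm_eq : ‖e‖ = 1
  contDiff : ContDiff ℝ 2 γ
  pos : 0 < r
  mem_iff : ∀ x ∈ Metric.ball p r, x ∈ Ω ↔ γ ((ℝ ∙ e)ᗮ.orthogonalProjectionOnto x) < ⟪e, x⟫

/-- The parametrization `y ↦ y + γ(y) e` of the graph of `γ`. -/
noncomputable def graphMap (e : Space n) (γ : (ℝ ∙ e)ᗮ → ℝ) (y : (ℝ ∙ e)ᗮ) : Space n :=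
  (y : Space n) + γ y • e

/-- The (not normalized) downward normal `∇γ(y) - e` to the graph of `γ`. -/
noncomputable def graphNormal (e : Space n) (γ : (ℝ ∙ e)ᗮ → ℝ) (y : (ℝ ∙ e)ᗮ) : Space n :=
  ((∇ γ y : (ℝ ∙ e)ᗮ) : Space n) - e

/-- The splitting of `ℝⁿ` into the hyperplane orthogonal to `e` and the line spanned by `e`. -/
noncomputable def splitting (e : Space n) (he : ‖e‖ = 1) : ((ℝ ∙ e)ᗮ × ℝ) ≃L[ℝ] Space n :=
  ContinuousLinearEquiv.equivOfInverse
    ((ℝ ∙ e)ᗮ.subtypeL.coprod ((ContinuousLinearMap.id ℝ ℝ).smulRight e))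
    ((ℝ ∙ e)ᗮ.orthogonalProjectionOnto.prod (innerSL ℝ e))
    (fun z => by
      have h1 : ⟪e, (z.1 : Space n)⟫ = 0 := Submodule.mem_orthogonal_singleton_iff_inner_right.1 z.1.2
      ext1
      · simp
      · simp [inner_add_right, real_inner_smul_right, h1, he])
    (fun x => by
      have h := Submodule.starProjection_add_starProjection_orthogonal (K := (ℝ ∙ e)) x
      rw [Submodule.starProjection_singleton] at h
      simp only [he, RCLike.ofReal_real_eq_id, id_eq, one_pow, div_one] at h
      rw [add_comm] at h
      simpa using h)

theorem splitting_apply (e : Space n) (he : ‖e‖ = 1) (z : (ℝ ∙ e)ᗮ × ℝ) :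
    splitting e he z = (z.1 : Space n) + z.2 • e := by
  simp [splitting]

theorem splitting_symm_apply (e : Space n) (he : ‖e‖ = 1) (x : Space n) :
    (splitting e he).symm x = ((ℝ ∙ e)ᗮ.orthogonalProjectionOnto x, ⟪e, x⟫) := by
  simp [splitting]

theorem inner_coe_orthogonal (e : Space n) (y : (ℝ ∙ e)ᗮ) : ⟪e, (y : Space n)⟫ = 0 :=
  Submodule.mem_orthogonal_singleton_iff_inner_right.1 y.2

theorem proj_graphMap (e : Space n) (γ : (ℝ ∙ e)ᗮ → ℝ) (y : (ℝ ∙ e)ᗮ) :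
    (ℝ ∙ e)ᗮ.orthogonalProjectionOnto (graphMap e γ y) = y := by
  simp [graphMap]

theorem inner_graphMap {e : Space n} (he : ‖e‖ = 1) (γ : (ℝ ∙ e)ᗮ → ℝ) (y : (ℝ ∙ e)ᗮ) :
    ⟪e, graphMap e γ y⟫ = γ y := by
  simp [graphMap, inner_add_right, real_inner_smul_right, inner_coe_orthogonal, he]

theorem graphMap_proj {e : Space n} (he : ‖e‖ = 1) (γ : (ℝ ∙ e)ᗮ → ℝ) {x : Space n}
    (hx : γ ((ℝ ∙ e)ᗮ.orthogonalProjectionOnto x) = ⟪e, x⟫) :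
    graphMap e γ ((ℝ ∙ e)ᗮ.orthogonalProjectionOnto x) = x := by
  have h := (splitting e he).apply_symm_apply x
  rw [splitting_symm_apply, splitting_apply] at h
  rw [graphMap, hx]
  exact h

/-- Every vector has the form `b + τ e`, so this determines the normal. The right-hand side is the
boundary factor of `integral_fderiv_supergraph`. -/
theorem inner_graphNormal {e : Space n} (he : ‖e‖ = 1) (γ : (ℝ ∙ e)ᗮ → ℝ)
    (y b : (ℝ ∙ e)ᗮ) (τ : ℝ) :
    ⟪graphNormal e γ y, (b : Space n) + τ • e⟫ = fderiv ℝ γ y b - τ := by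
  have h1 : ⟪((∇ γ y : (ℝ ∙ e)ᗮ) : Space n), (b : Space n)⟫ = fderiv ℝ γ y b := by
    rw [← Submodule.coe_inner, gradient, InnerProductSpace.toDual_symm_apply]
  have h2 : ⟪((∇ γ y : (ℝ ∙ e)ᗮ) : Space n), e⟫ = 0 := by
    rw [real_inner_comm]; exact inner_coe_orthogonal e _
  rw [graphNormal, inner_sub_left, inner_add_right, inner_add_right, real_inner_smul_right,
    real_inner_smul_right, h1, h2, inner_coe_orthogonal, real_inner_self_eq_norm_sq, he]
  ring

/-- The component along `e` is `-1`. Hence the normalization is safe and `‖graphNormal‖`, used later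
as a density, is bounded below. -/
theorem one_le_norm_graphNormal {e : Space n} (he : ‖e‖ = 1) (γ : (ℝ ∙ e)ᗮ → ℝ)
    (y : (ℝ ∙ e)ᗮ) : 1 ≤ ‖graphNormal e γ y‖ := by
  have h := inner_graphNormal he γ y 0 1
  have h' := abs_real_inner_le_norm (graphNormal e γ y) (((0 : (ℝ ∙ e)ᗮ) : Space n) + (1 : ℝ) • e)
  rw [h] at h'
  simpa [he] using h'

theorem continuous_graphMap {e : Space n} {γ : (ℝ ∙ e)ᗮ → ℝ} (hγ : Continuous γ) :
    Continuous (graphMap e γ) := by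
  unfold graphMap; fun_prop

theorem continuous_graphNormal {e : Space n} {γ : (ℝ ∙ e)ᗮ → ℝ} (hγ : ContDiff ℝ 2 γ) :
    Continuous (graphNormal e γ) := by
  have h : Continuous fun y => ∇ γ y :=
    (InnerProductSpace.toDual ℝ (ℝ ∙ e)ᗮ).symm.continuous.comp
      (hγ.continuous_fderiv (by norm_num))
  unfold graphNormal
  fun_prop

namespace IsGraphChart

variable {Ω : Set (Space n)} {p e : Space n} {γ : (ℝ ∙ e)ᗮ → ℝ} {r : ℝ}

/-- A point strictly above the graph lies in the open set `Ω`, and a point strictly below has a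
neighbourhood disjoint from `Ω`. -/
theorem eq_of_mem_frontier (hc : IsGraphChart Ω p e γ r) (ho : IsOpen Ω) {x : Space n}
    (hx : x ∈ Metric.ball p r) (hxf : x ∈ frontier Ω) :
    γ ((ℝ ∙ e)ᗮ.orthogonalProjectionOnto x) = ⟪e, x⟫ := by
  rw [ho.frontier_eq] at hxf
  have h1 := not_lt.1 fun h => hxf.2 ((hc.mem_iff x hx).2 h)
  refine le_antisymm (not_lt.1 fun h => ?_) h1
  have hcont : Continuous fun x : Space n => γ ((ℝ ∙ e)ᗮ.orthogonalProjectionOnto x) - ⟪e, x⟫ := by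
    have := hc.contDiff.continuous
    fun_prop
  have h2 : ∀ᶠ z in 𝓝 x, z ∉ Ω := by
    filter_upwards [Metric.isOpen_ball.mem_nhds hx,
      hcont.continuousAt.eventually_const_lt (sub_pos.2 h)] with z hz hz'
    rw [hc.mem_iff z hz]
    linarith
  obtain ⟨z, hz, hz'⟩ := (mem_closure_iff_frequently.1 hxf.1).and_eventually h2 |>.exists
  exact hz' hz

/-- Moving by `s e` with small `s > 0` enters `Ω`. -/
theorem mem_closure (hc : IsGraphChart Ω p e γ r) {x : Space n}
    (hx : x ∈ Metric.ball p r) (hle : γ ((ℝ ∙ e)ᗮ.orthogonalProjectionOnto x) ≤ ⟪e, x⟫) :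
    x ∈ closure Ω := by
  have hlim : Tendsto (fun s : ℝ => x + s • e) (𝓝[>] 0) (𝓝 x) := by
    have : Tendsto (fun s : ℝ => x + s • e) (𝓝 0) (𝓝 (x + (0 : ℝ) • e)) :=
      (by fun_prop : Continuous fun s : ℝ => x + s • e).tendsto 0
    simpa using this.mono_left nhdsWithin_le_nhds
  refine mem_closure_of_tendsto hlim ?_
  filter_upwards [hlim.eventually (Metric.isOpen_ball.mem_nhds hx), self_mem_nhdsWithin]
    with s hs hs0
  rw [hc.mem_iff _ hs]
  have : (ℝ ∙ e)ᗮ.orthogonalProjectionOnto e = 0 := by simp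
  rw [map_add, map_smul, this, smul_zero, add_zero, inner_add_right, real_inner_smul_right,
    real_inner_self_eq_norm_sq, hc.norm_eq]
  have : (0 : ℝ) < s := hs0
  linarith

theorem mem_frontier_iff (hc : IsGraphChart Ω p e γ r) (ho : IsOpen Ω) {x : Space n}
    (hx : x ∈ Metric.ball p r) :
    x ∈ frontier Ω ↔ γ ((ℝ ∙ e)ᗮ.orthogonalProjectionOnto x) = ⟪e, x⟫ := by
  refine ⟨hc.eq_of_mem_frontier ho hx, fun h => ?_⟩
  rw [ho.frontier_eq]
  exact ⟨hc.mem_closure hx h.le, fun hΩ => absurd ((hc.mem_iff x hx).1 hΩ) (by rw [h]; exact lt_irrefl _)⟩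

theorem graphMap_mem_frontier (hc : IsGraphChart Ω p e γ r) (ho : IsOpen Ω) {y : (ℝ ∙ e)ᗮ}
    (hy : graphMap e γ y ∈ Metric.ball p r) : graphMap e γ y ∈ frontier Ω := by
  rw [hc.mem_frontier_iff ho hy, proj_graphMap, inner_graphMap hc.norm_eq]

/-- In a graph chart the outward unit normal is the normalized normal of the graph. -/
theorem outwardNormal_eq (hc : IsGraphChart Ω p e γ r) (ho : IsOpen Ω) {x : Space n}
    (hx : x ∈ Metric.ball p r) (hxf : x ∈ frontier Ω) :
    outwardNormal Ω x = ‖graphNormal e γ ((ℝ ∙ e)ᗮ.orthogonalProjectionOnto x)‖⁻¹ •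
      graphNormal e γ ((ℝ ∙ e)ᗮ.orthogonalProjectionOnto x) := by
  set N := graphNormal e γ ((ℝ ∙ e)ᗮ.orthogonalProjectionOnto x) with hN
  set ρ : Space n → ℝ := fun x => γ ((ℝ ∙ e)ᗮ.orthogonalProjectionOnto x) - ⟪e, x⟫ with hρdef
  have hρ : ContDiff ℝ 2 ρ := by
    refine (hc.contDiff.comp (ContinuousLinearMap.contDiff _)).sub ?_
    exact contDiff_const.inner ℝ contDiff_id
  have hγd : DifferentiableAt ℝ γ ((ℝ ∙ e)ᗮ.orthogonalProjectionOnto x) :=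
    (hc.contDiff.differentiable (by norm_num)) _
  have hfd : HasFDerivAt ρ ((fderiv ℝ γ ((ℝ ∙ e)ᗮ.orthogonalProjectionOnto x)).comp
      (ℝ ∙ e)ᗮ.orthogonalProjectionOnto - innerSL ℝ e) x := by
    refine HasFDerivAt.sub ?_ (innerSL ℝ e).hasFDerivAt
    exact hγd.hasFDerivAt.comp x (ContinuousLinearMap.hasFDerivAt _)
  have hgrad : ∇ ρ x = N := by
    refine ext_inner_right ℝ fun a => ?_
    rw [gradient, InnerProductSpace.toDual_symm_apply, hfd.fderiv]
    have h := (splitting e hc.norm_eq).apply_symm_apply a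
    rw [splitting_symm_apply, splitting_apply] at h
    conv_rhs => rw [← h]
    rw [hN, inner_graphNormal hc.norm_eq]
    simp
  have hN0 : N ≠ 0 := fun h => by
    have := one_le_norm_graphNormal hc.norm_eq γ ((ℝ ∙ e)ᗮ.orthogonalProjectionOnto x)
    rw [← hN, h, norm_zero] at this
    linarith
  have hnorm : IsOutwardUnitNormal Ω x (‖N‖⁻¹ • N) := by
    refine ⟨ρ, hρ.contDiffAt.of_le (by norm_num), ?_, by rwa [hgrad], ?_, by rw [hgrad]⟩
    · simp only [hρdef, hc.eq_of_mem_frontier ho hx hxf, sub_self]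
    · filter_upwards [Metric.isOpen_ball.mem_nhds hx] with z hz
      rw [hc.mem_iff z hz, hρdef, sub_neg]
  have hex : ∃ v, IsOutwardUnitNormal Ω x v := ⟨_, hnorm⟩
  rw [outwardNormal, dif_pos hex]
  -- Uniqueness of the outward normal makes the choice in `outwardNormal` irrelevant.
  exact hex.choose_spec.eq hnorm

end IsGraphChart

theorem HasC2Boundary.exists_chart {Ω : Set (Space n)} (hΩ : HasC2Boundary Ω) {p : Space n}
    (hp : p ∈ frontier Ω) : ∃ e γ r, IsGraphChart Ω p e γ r := by
  obtain ⟨e, γ, r, he, hγ, hr, h⟩ := hΩ p hp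
  exact ⟨e, γ, r, he, hγ, hr, h⟩

/-- In a chart the normal agrees on the boundary with a continuous function of `x`. This provides
integrability on the lateral boundary and measurability of its two parts. -/
theorem HasC2Boundary.continuousOn_outwardNormal {Ω : Set (Space n)} (hΩ : HasC2Boundary Ω)
    (ho : IsOpen Ω) : ContinuousOn (outwardNormal Ω) (frontier Ω) := by
  intro p hp
  obtain ⟨e, γ, r, hc⟩ := hΩ.exists_chart hp
  have hcont : Continuous fun x : Space n =>
      ‖graphNormal e γ ((ℝ ∙ e)ᗮ.orthogonalProjectionOnto x)‖⁻¹ •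
      graphNormal e γ ((ℝ ∙ e)ᗮ.orthogonalProjectionOnto x) := by
    have h1 : Continuous fun x : Space n =>
        graphNormal e γ ((ℝ ∙ e)ᗮ.orthogonalProjectionOnto x) :=
      (continuous_graphNormal hc.contDiff).comp (ContinuousLinearMap.continuous _)
    refine (h1.norm.inv₀ fun x => ?_).smul h1
    have := one_le_norm_graphNormal hc.norm_eq γ ((ℝ ∙ e)ᗮ.orthogonalProjectionOnto x)
    positivity
  refine hcont.continuousWithinAt.congr_of_eventuallyEq ?_
    (hc.outwardNormal_eq ho (Metric.mem_ball_self hc.pos) hp)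
  filter_upwards [self_mem_nhdsWithin,
    mem_nhdsWithin_of_mem_nhds (Metric.ball_mem_nhds p hc.pos)] with x hx hxb
  exact hc.outwardNormal_eq ho hxb hx

theorem HasC2Boundary.norm_outwardNormal {Ω : Set (Space n)} (hΩ : HasC2Boundary Ω)
    (ho : IsOpen Ω) {p : Space n} (hp : p ∈ frontier Ω) : ‖outwardNormal Ω p‖ = 1 := by
  obtain ⟨e, γ, r, hc⟩ := hΩ.exists_chart hp
  rw [hc.outwardNormal_eq ho (Metric.mem_ball_self hc.pos) hp, norm_smul, norm_inv, norm_norm]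
  have := one_le_norm_graphNormal hc.norm_eq γ ((ℝ ∙ e)ᗮ.orthogonalProjectionOnto p)
  exact inv_mul_cancel₀ (by positivity)

/-- The closure of an open set with `C²` boundary is a set of unique differentiability. -/
theorem HasC2Boundary.uniqueDiffOn_closure {Ω : Set (Space n)} (hΩ : HasC2Boundary Ω)
    (ho : IsOpen Ω) : UniqueDiffOn ℝ (closure Ω) := by
  intro x hx
  by_cases hxΩ : x ∈ Ω
  · exact (ho.uniqueDiffWithinAt hxΩ).mono subset_closure
  have hxf : x ∈ frontier Ω := by rw [ho.frontier_eq]; exact ⟨hx, hxΩ⟩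
  obtain ⟨e, γ, r, hc⟩ := hΩ.exists_chart hxf
  set π := (ℝ ∙ e)ᗮ.orthogonalProjectionOnto with hπ
  have hγx := hc.eq_of_mem_frontier ho (Metric.mem_ball_self hc.pos) hxf
  obtain ⟨k, t, ht, hLip⟩ := (hc.contDiff.contDiffAt (x := π x)).of_le
    (show (1 : WithTop ℕ∞) ≤ 2 by norm_num) |>.exists_lipschitzOnWith
  have htx : π ⁻¹' t ∈ 𝓝 x := π.continuous.continuousAt.preimage_mem_nhds ht
  obtain ⟨δ, hδ, hδt⟩ := Metric.mem_nhds_iff.1 (inter_mem htx (Metric.ball_mem_nhds x hc.pos))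
  -- Interior cone condition: with `k` a local Lipschitz constant of `γ`, the truncated cone `f < 0`
  -- with apex `x` is open, convex and contained in `Ω`, and `x` lies in its closure.
  set f : Space n → ℝ := fun z => k * ‖π z - π x‖ - ⟪e, z - x⟫ with hf
  set C : Set (Space n) := {z | z ∈ Metric.ball x δ ∧ f z < 0} with hC
  have hπe : π e = 0 := by simp [hπ]
  have hfc : ConvexOn ℝ univ f := by
    refine ConvexOn.sub ?_ ?_
    · have h1 : ConvexOn ℝ univ fun w : (ℝ ∙ e)ᗮ => ‖w‖ := convexOn_univ_norm
      have h2 : ConvexOn ℝ univ fun z : Space n => ‖π (z - x)‖ := by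
        have h3 := (h1.comp_linearMap (π : Space n →ₗ[ℝ] (ℝ ∙ e)ᗮ)).translate_right (-x)
        simpa [Function.comp_def, sub_eq_neg_add] using h3
      have h4 := h2.smul k.2
      simpa [map_sub] using h4
    · refine ⟨convex_univ, fun z _ w _ a b _ _ hab => le_of_eq ?_⟩
      simp only [inner_sub_right, inner_add_right, real_inner_smul_right, smul_eq_mul]
      linear_combination (-⟪e, x⟫) * hab
  have hconv : Convex ℝ C := by
    have h := hfc.convex_lt 0
    simp only [mem_univ, true_and] at h
    exact (convex_ball x δ).inter h
  have hfcont : Continuous f := by fun_prop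
  have hopen : IsOpen C := Metric.isOpen_ball.inter (isOpen_lt hfcont continuous_const)
  have hxC : x ∈ closure C := by
    have hlim : Tendsto (fun s : ℝ => x + s • e) (𝓝[>] 0) (𝓝 x) := by
      have : Tendsto (fun s : ℝ => x + s • e) (𝓝 0) (𝓝 (x + (0 : ℝ) • e)) :=
        (by fun_prop : Continuous fun s : ℝ => x + s • e).tendsto 0
      simpa using this.mono_left nhdsWithin_le_nhds
    refine mem_closure_of_tendsto hlim ?_
    filter_upwards [hlim.eventually (Metric.ball_mem_nhds x hδ), self_mem_nhdsWithin]
      with s hs hs0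
    refine ⟨hs, ?_⟩
    have : (0 : ℝ) < s := hs0
    simp only [hf, map_add, map_smul, hπe, smul_zero, add_zero, sub_self, norm_zero, mul_zero,
      add_sub_cancel_left, real_inner_smul_right, real_inner_self_eq_norm_sq, hc.norm_eq]
    linarith
  have hCΩ : C ⊆ Ω := by
    intro z hz
    obtain ⟨hzt, hzb⟩ := hδt hz.1
    rw [hc.mem_iff z hzb]
    have hxt : π x ∈ t := (hδt (Metric.mem_ball_self hδ)).1
    have h1 := hLip.dist_le_mul (π z) hzt (π x) hxt
    rw [Real.dist_eq, dist_eq_norm] at h1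
    have h2 : f z < 0 := hz.2
    simp only [hf, inner_sub_right] at h2
    have h3 := le_abs_self (γ (π z) - γ (π x))
    linarith
  have hne : (interior C).Nonempty := by
    rw [hopen.interior_eq]
    exact closure_nonempty_iff.1 ⟨x, hxC⟩
  exact (uniqueDiffWithinAt_convex hconv hne hxC).mono (hCΩ.trans subset_closure)

/-! ### Divergence theorem on `Ω` for a measure comparable with surface measure. -/

/-- Uniqueness of Haar measure. The value of `c` is never needed: it is absorbed into the boundary
measure. -/
theorem exists_volume_eq_smul_map_splitting (e : Space n) (he : ‖e‖ = 1) :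
    ∃ c : NNReal, 0 < c ∧ (volume : Measure (Space n)) =
      c • Measure.map (splitting e he) ((volume : Measure (ℝ ∙ e)ᗮ).prod volume) := by
  have : (Measure.map (splitting e he)
      ((volume : Measure (ℝ ∙ e)ᗮ).prod (volume : Measure ℝ))).IsAddHaarMeasure :=
    (splitting e he).isAddHaarMeasure_map _
  exact ⟨_, Measure.addHaarScalarFactor_pos_of_isAddHaarMeasure _ _,
    Measure.isAddLeftInvariant_eq_smul _ _⟩

/-- **Divergence theorem in a graph chart**, up to a constant factor independent of the function. -/
theorem IsGraphChart.exists_integral_fderiv {Ω : Set (Space n)} {p e : Space n}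
    {γ : (ℝ ∙ e)ᗮ → ℝ} {r : ℝ} (hc : IsGraphChart Ω p e γ r) (hΩ : HasC2Boundary Ω)
    (ho : IsOpen Ω) (hb : Bornology.IsBounded Ω) :
    ∃ c : NNReal, 0 < c ∧ ∀ k : Space n → ℝ, ContDiffOn ℝ 1 k (closure Ω) →
      tsupport k ⊆ Metric.ball p r → ∀ a : Space n,
        ∫ x in Ω, fderiv ℝ k x a =
          c * ∫ y : (ℝ ∙ e)ᗮ, k (graphMap e γ y) * ⟪graphNormal e γ y, a⟫ := by
  obtain ⟨c, hc0, hcvol⟩ := exists_volume_eq_smul_map_splitting e hc.norm_eq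
  refine ⟨c, hc0, fun k hk hsupp a => ?_⟩
  set S := splitting e hc.norm_eq with hS
  set π := (ℝ ∙ e)ᗮ.orthogonalProjectionOnto with hπ
  have hSsymm : ∀ z, π (S z) = z.1 ∧ ⟪e, S z⟫ = z.2 := fun z => by
    have := S.symm_apply_apply z
    rw [hS, splitting_symm_apply] at this
    exact ⟨congrArg Prod.fst this, congrArg Prod.snd this⟩
  set V : Set (Space n) := {x | γ (π x) < ⟪e, x⟫} with hV
  have hγc := hc.contDiff.continuous
  have hkdiff : ∀ x ∈ Ω, DifferentiableAt ℝ k x := fun x hx =>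
    (hk.differentiableOn (by norm_num) x (subset_closure hx)).differentiableAt
      (mem_of_superset (ho.mem_nhds hx) subset_closure)
  have hcompact : HasCompactSupport k :=
    Metric.isCompact_of_isClosed_isBounded (isClosed_tsupport k) (Metric.isBounded_ball.subset hsupp)
  have hcomp : IsCompact (closure Ω) := hb.isCompact_closure
  obtain ⟨M, hM⟩ : ∃ M, ∀ x ∈ closure Ω, ‖fderivWithin ℝ k (closure Ω) x‖ ≤ M :=
    hcomp.exists_bound_of_continuousOn
      (hk.continuousOn_fderivWithin (hΩ.uniqueDiffOn_closure ho) (by norm_num))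
  have hM' : ∀ x ∈ Ω, ‖fderiv ℝ k x‖ ≤ M := fun x hx => by
    rw [← fderivWithin_of_mem_nhds (mem_of_superset (ho.mem_nhds hx) subset_closure)]
    exact hM x (subset_closure hx)
  have hVΩ : ∀ x ∈ V, x ∈ tsupport k → x ∈ Ω := fun x hx hxk =>
    (hc.mem_iff x (hsupp hxk)).2 hx
  -- pass from `Ω` to the full supergraph
  have hΩV : ∫ x in Ω, fderiv ℝ k x a = ∫ x in V, fderiv ℝ k x a := by
    have hVo : IsOpen V := isOpen_lt (by fun_prop) (by fun_prop)
    rw [← integral_indicator ho.measurableSet, ← integral_indicator hVo.measurableSet]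
    congr 1
    ext x
    by_cases hx : x ∈ tsupport k
    · have hiff : x ∈ Ω ↔ x ∈ V := hc.mem_iff x (hsupp hx)
      by_cases hxΩ : x ∈ Ω
      · rw [indicator_of_mem hxΩ, indicator_of_mem (hiff.1 hxΩ)]
      · rw [indicator_of_notMem hxΩ, indicator_of_notMem (fun h => hxΩ (hiff.2 h))]
    · have h0 : fderiv ℝ k x a = 0 := by rw [fderiv_of_notMem_tsupport ℝ hx]; rfl
      simp only [indicator, h0, ite_self]
  have hpre : S ⁻¹' V = {z : (ℝ ∙ e)ᗮ × ℝ | γ z.1 < z.2} := by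
    ext z
    simp only [hV, mem_preimage, mem_ofPred_eq, (hSsymm z).1, (hSsymm z).2]
  have hSemb : MeasurableEmbedding S := S.toHomeomorph.measurableEmbedding
  obtain ⟨b, τ, hab⟩ : ∃ (b : (ℝ ∙ e)ᗮ) (τ : ℝ), S (b, τ) = a :=
    ⟨(S.symm a).1, (S.symm a).2, S.apply_symm_apply a⟩
  set G : (ℝ ∙ e)ᗮ × ℝ → ℝ := k ∘ S with hG
  have hGf : ∀ z, fderiv ℝ G z = (fderiv ℝ k (S z)).comp (S : ((ℝ ∙ e)ᗮ × ℝ) →L[ℝ] Space n) :=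
    fun z => S.comp_right_fderiv
  -- Regularity of `k` is known only on `closure Ω`. On the support of `k` the closed supergraph
  -- agrees locally with `closure Ω`; off the support `k` vanishes nearby.
  have hloc : ∀ x, γ (π x) ≤ ⟪e, x⟫ → ContinuousWithinAt k {x | γ (π x) ≤ ⟪e, x⟫} x := by
    intro x hx
    by_cases hxk : x ∈ tsupport k
    · have hxb := hsupp hxk
      refine (hk.continuousOn x (hc.mem_closure hxb hx)).mono_of_mem_nhdsWithin ?_
      filter_upwards [self_mem_nhdsWithin,
        mem_nhdsWithin_of_mem_nhds (Metric.isOpen_ball.mem_nhds hxb)] with z hz hzb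
      exact hc.mem_closure hzb hz
    · have h0 : k =ᶠ[𝓝 x] fun _ => 0 := notMem_tsupport_iff_eventuallyEq.1 hxk
      exact (continuousAt_const.congr h0.symm).continuousWithinAt
  have hmain := integral_fderiv_supergraph (μ := (volume : Measure (ℝ ∙ e)ᗮ))
    (hc.contDiff.of_le (by norm_num)) (G := G)
    (hcompact.comp_homeomorph S.toHomeomorph) ?_ ?_ (M := |M| * ‖(S : ((ℝ ∙ e)ᗮ × ℝ) →L[ℝ] Space n)‖)
    ?_ b τ
  · rw [hΩV]
    conv_lhs => rw [hcvol]
    rw [Measure.restrict_smul, integral_smul_nnreal_measure, hSemb.setIntegral_map, hpre]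
    have h1 : ∀ z, fderiv ℝ k (S z) a = fderiv ℝ G z (b, τ) := fun z => by
      rw [hGf, ← hab]; rfl
    simp_rw [h1]
    rw [hmain, NNReal.smul_def, smul_eq_mul]
    congr 1
    refine integral_congr_ae (ae_of_all _ fun y => ?_)
    have h2 : S (y, γ y) = graphMap e γ y := by rw [hS, splitting_apply]; rfl
    simp only [hG, Function.comp_apply, h2]
    rw [← hab, hS, splitting_apply, inner_graphNormal hc.norm_eq]
  · intro z hz
    have hz' : γ (π (S z)) ≤ ⟪e, S z⟫ := by rw [(hSsymm z).1, (hSsymm z).2]; exact hz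
    refine (hloc (S z) hz').comp S.continuous.continuousWithinAt fun w hw => ?_
    simp only [mem_ofPred_eq, (hSsymm w).1, (hSsymm w).2]
    exact hw
  · intro z hz
    have hz' : S z ∈ V := by
      simp only [hV, mem_ofPred_eq, (hSsymm z).1, (hSsymm z).2]; exact hz
    have hkd : DifferentiableAt ℝ k (S z) := by
      by_cases hzk : S z ∈ tsupport k
      · exact hkdiff _ (hVΩ _ hz' hzk)
      · exact (differentiableAt_const 0).congr_of_eventuallyEq
          (notMem_tsupport_iff_eventuallyEq.1 hzk)
    exact hkd.comp z S.differentiableAt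
  · intro z hz
    have hz' : S z ∈ V := by
      simp only [hV, mem_ofPred_eq, (hSsymm z).1, (hSsymm z).2]; exact hz
    rw [hGf]
    refine (ContinuousLinearMap.opNorm_comp_le _ _).trans ?_
    gcongr
    by_cases hzk : S z ∈ tsupport k
    · exact (hM' _ (hVΩ _ hz' hzk)).trans (le_abs_self M)
    · rw [fderiv_of_notMem_tsupport ℝ hzk, norm_zero]
      exact abs_nonneg M

/-- The surface measure on `∂Ω`. -/
noncomputable def surfaceMeasure (Ω : Set (Space n)) : Measure (Space n) :=
  (Measure.euclideanHausdorffMeasure (n - 1)).restrict (frontier Ω)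

/-- The normalizing factor depends only on `d`, so it is the same on both sides of the Lipschitz
bound for Hausdorff measure. -/
theorem euclideanHausdorffMeasure_image_le {X Y : Type*} [MetricSpace X] [MeasurableSpace X]
    [BorelSpace X] [MetricSpace Y] [MeasurableSpace Y] [BorelSpace Y] {f : X → Y} {k : NNReal}
    {s : Set X} (hf : LipschitzOnWith k f s) (d : ℕ) :
    (Measure.euclideanHausdorffMeasure d : Measure Y) (f '' s)
      ≤ ((k ^ d : NNReal) : ENNReal) * (Measure.euclideanHausdorffMeasure d : Measure X) s := by
  simp only [Measure.euclideanHausdorffMeasure_def, Measure.smul_apply]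
  have h := hf.hausdorffMeasure_image_le (d := (d : ℝ)) (by positivity)
  simp only [ENNReal.smul_def, smul_eq_mul]
  rw [mul_left_comm]
  gcongr
  simpa using h

theorem finrank_orthogonal_singleton {e : Space n} (he : ‖e‖ = 1) :
    Module.finrank ℝ (ℝ ∙ e)ᗮ = n - 1 := by
  have he0 : e ≠ 0 := fun h => by simp [h] at he
  have h := Submodule.finrank_add_finrank_orthogonal (ℝ ∙ e)
  rw [finrank_span_singleton he0, finrank_euclideanSpace_fin] at h
  omega

/-- Near a boundary point there is a finite measure, comparable with the surface measure, for which
the divergence theorem holds. -/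
theorem IsGraphChart.exists_measure {Ω : Set (Space n)} {p e : Space n}
    {γ : (ℝ ∙ e)ᗮ → ℝ} {r : ℝ} (hc : IsGraphChart Ω p e γ r) (hΩ : HasC2Boundary Ω)
    (ho : IsOpen Ω) (hb : Bornology.IsBounded Ω) :
    ∃ (m : Measure (Space n)) (C : NNReal), IsFiniteMeasure m ∧ m ≤ C • surfaceMeasure Ω ∧
      (surfaceMeasure Ω).restrict (Metric.ball p r) ≤ C • m ∧
      ∀ k : Space n → ℝ, ContDiffOn ℝ 1 k (closure Ω) → tsupport k ⊆ Metric.ball p r →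
        ∀ a : Space n, ∫ x in Ω, fderiv ℝ k x a = ∫ x, k x * ⟪outwardNormal Ω x, a⟫ ∂m := by
  obtain ⟨c, hc0, hdiv⟩ := hc.exists_integral_fderiv hΩ ho hb
  have he := hc.norm_eq
  set π := (ℝ ∙ e)ᗮ.orthogonalProjectionOnto with hπ
  set Φ := graphMap e γ with hΦ
  set N := graphNormal e γ with hN
  have hΦc : Continuous Φ := continuous_graphMap hc.contDiff.continuous
  have hNc : Continuous N := continuous_graphNormal hc.contDiff
  set D : Set (ℝ ∙ e)ᗮ := Φ ⁻¹' Metric.ball p r with hD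
  have hDo : IsOpen D := Metric.isOpen_ball.preimage hΦc
  have hπlip : LipschitzWith 1 π := Submodule.lipschitzWith_orthogonalProjectionOnto _
  have hπΦ : ∀ y, π (Φ y) = y := proj_graphMap e γ
  have hDball : D ⊆ Metric.ball (π p) r := fun y hy => by
    have h := hπlip.dist_le_mul (Φ y) p
    rw [hπΦ] at h
    simp only [NNReal.coe_one, one_mul] at h
    exact lt_of_le_of_lt h hy
  have hvol : (volume : Measure (ℝ ∙ e)ᗮ) = Measure.euclideanHausdorffMeasure (n - 1) := by
    rw [← finrank_orthogonal_singleton he]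
    exact (InnerProductSpace.euclideanHausdorffMeasure_eq_volume).symm
  have hcb : IsCompact (Metric.closedBall (π p) r) := isCompact_closedBall _ _
  obtain ⟨B, hB⟩ := hcb.exists_bound_of_continuousOn hNc.continuousOn
  obtain ⟨B', hB'⟩ := hcb.exists_bound_of_continuousOn
    (hc.contDiff.continuous_fderiv (by norm_num)).continuousOn
  have hγlip : LipschitzOnWith B'.toNNReal γ (Metric.ball (π p) r) := by
    refine (convex_ball (π p) r).lipschitzOnWith_of_nnnorm_fderiv_le
      (fun y _ => hc.contDiff.differentiable (by norm_num) y) fun y hy => ?_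
    rw [← NNReal.coe_le_coe, coe_nnnorm]
    exact (hB' y (Metric.ball_subset_closedBall hy)).trans (Real.le_coe_toNNReal B')
  have hΦlip : LipschitzOnWith (1 + B'.toNNReal) Φ D := by
    refine LipschitzOnWith.of_dist_le_mul fun y hy z hz => ?_
    have h1 := hγlip.dist_le_mul y (hDball hy) z (hDball hz)
    have h2 : Φ y - Φ z = ((y - z : (ℝ ∙ e)ᗮ) : Space n) + (γ y - γ z) • e := by
      simp only [hΦ, graphMap, Submodule.coe_sub, sub_smul]; abel
    rw [dist_eq_norm, h2]
    refine (norm_add_le _ _).trans ?_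
    have h3 : ‖((y - z : (ℝ ∙ e)ᗮ) : Space n)‖ = dist y z := by rw [dist_eq_norm]; rfl
    rw [norm_smul, he, mul_one, h3, ← dist_eq_norm]
    push_cast
    linarith
  -- Lebesgue measure of the hyperplane carried to the graph. Since `π` is 1-Lipschitz, `κ` is at
  -- most surface measure; since `Φ` is Lipschitz on `D`, the reverse holds up to a factor. These
  -- two bounds make the area formula unnecessary.
  set κ : Measure (Space n) := (volume.restrict D).map Φ with hκ
  have hκapp : ∀ s, MeasurableSet s → κ s = volume (Φ ⁻¹' (s ∩ Metric.ball p r)) := fun s hs => by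
    rw [hκ, Measure.map_apply hΦc.measurable hs, Measure.restrict_apply (hΦc.measurable hs)]
    rfl
  have himage : ∀ s, Φ '' (Φ ⁻¹' (s ∩ Metric.ball p r)) = s ∩ Metric.ball p r ∩ frontier Ω := by
    intro s
    ext x
    constructor
    · rintro ⟨y, hy, rfl⟩
      exact ⟨hy, hc.graphMap_mem_frontier ho hy.2⟩
    · rintro ⟨hx, hxf⟩
      have h := graphMap_proj he γ (hc.eq_of_mem_frontier ho hx.2 hxf)
      exact ⟨π x, by rw [mem_preimage, hΦ, h]; exact hx, h⟩
  have hκle : κ ≤ surfaceMeasure Ω := by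
    refine Measure.le_iff.2 fun s hs => ?_
    rw [hκapp s hs, surfaceMeasure, Measure.restrict_apply hs, hvol]
    set A := Φ ⁻¹' (s ∩ Metric.ball p r) with hA
    have h1 : π '' (Φ '' A) = A := by
      rw [image_image]; simp [hπΦ]
    calc (Measure.euclideanHausdorffMeasure (n - 1) : Measure (ℝ ∙ e)ᗮ) A
        = (Measure.euclideanHausdorffMeasure (n - 1) : Measure (ℝ ∙ e)ᗮ) (π '' (Φ '' A)) := by
          rw [h1]
      _ ≤ ((1 ^ (n - 1) : NNReal) : ENNReal) *
          (Measure.euclideanHausdorffMeasure (n - 1) : Measure (Space n)) (Φ '' A) :=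
          euclideanHausdorffMeasure_image_le hπlip.lipschitzOnWith _
      _ ≤ _ := by
          rw [one_pow, ENNReal.coe_one, one_mul, hA, himage]
          gcongr
          exact inter_subset_left
  have hleκ : (surfaceMeasure Ω).restrict (Metric.ball p r)
      ≤ ((1 + B'.toNNReal) ^ (n - 1) : NNReal) • κ := by
    refine Measure.le_iff.2 fun s hs => ?_
    rw [surfaceMeasure, Measure.restrict_apply hs,
      Measure.restrict_apply (hs.inter measurableSet_ball), ← himage, Measure.smul_apply,
      hκapp s hs, hvol, ENNReal.smul_def, smul_eq_mul]
    exact euclideanHausdorffMeasure_image_le (hΦlip.mono fun y hy => hy.2) _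
  have hκfin : IsFiniteMeasure κ := by
    refine ⟨?_⟩
    rw [hκapp _ MeasurableSet.univ, univ_inter]
    exact lt_of_le_of_lt (measure_mono hDball) measure_ball_lt_top
  set w : Space n → NNReal := fun x => ‖N (π x)‖₊ with hw
  have hwm : Measurable w := (hNc.comp π.continuous).nnnorm.measurable
  have hκae : ∀ᵐ x ∂κ, w x ≤ B.toNNReal := by
    rw [hκ, ae_map_iff hΦc.aemeasurable (measurableSet_le hwm measurable_const)]
    filter_upwards [ae_restrict_mem hDo.measurableSet] with y hy
    rw [hw, ← NNReal.coe_le_coe]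
    simp only [hπΦ, coe_nnnorm]
    exact (hB y (Metric.ball_subset_closedBall (hDball hy))).trans (Real.le_coe_toNNReal B)
  -- The density `‖N‖` turns `⟪ν, a⟫` into the unnormalized `⟪N, a⟫`. It lies between `1` and `B`,
  -- so comparability survives.
  set κw := κ.withDensity fun x => (w x : ENNReal) with hκw
  have hκw_le : κw ≤ B.toNNReal • κ := by
    have h1 : κw ≤ κ.withDensity fun _ => (B.toNNReal : ENNReal) := by
      refine withDensity_mono ?_
      filter_upwards [hκae] with x hx
      exact_mod_cast hx
    rw [withDensity_const] at h1
    exact h1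
  have hκ_le : κ ≤ κw := by
    calc κ = κ.withDensity 1 := withDensity_one.symm
      _ ≤ κw := withDensity_mono <| ae_of_all _ fun x => by
        have := one_le_norm_graphNormal he γ (π x)
        simp only [Pi.one_apply, hw]
        exact_mod_cast this
  have hκwfin : IsFiniteMeasure κw := isFiniteMeasure_of_le (B.toNNReal • κ) hκw_le
  set K : NNReal := (1 + B'.toNNReal) ^ (n - 1) with hK
  have hsm : ∀ {a b : NNReal} (μ : Measure (Space n)), a ≤ b → a • μ ≤ b • μ := by
    intro a b μ hab
    refine Measure.le_iff.2 fun s _ => ?_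
    simp only [Measure.smul_apply, ENNReal.smul_def, smul_eq_mul]
    gcongr
  have hsm' : ∀ {μ ν : Measure (Space n)} (a : NNReal), μ ≤ ν → a • μ ≤ a • ν := by
    intro μ ν a hab
    refine Measure.le_iff.2 fun s _ => ?_
    simp only [Measure.smul_apply, ENNReal.smul_def, smul_eq_mul]
    gcongr
  refine ⟨c • κw, max (c * B.toNNReal) (K * c⁻¹), inferInstance, ?_, ?_, ?_⟩
  · calc c • κw ≤ c • (B.toNNReal • surfaceMeasure Ω) :=
          hsm' c (hκw_le.trans (hsm' _ hκle))
      _ = (c * B.toNNReal) • surfaceMeasure Ω := by rw [smul_smul]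
      _ ≤ _ := hsm _ (le_max_left _ _)
  · calc (surfaceMeasure Ω).restrict (Metric.ball p r) ≤ K • κw := hleκ.trans (hsm' _ hκ_le)
      _ = (K * c⁻¹) • (c • κw) := by rw [smul_smul, mul_assoc, inv_mul_cancel₀ hc0.ne', mul_one]
      _ ≤ _ := hsm _ (le_max_right _ _)
  · intro k hk hsupp a
    -- `k` is controlled only on `closure Ω`, so the change of variables rests on `Φ` being a
    -- measurable embedding and not on measurability of `k`.
    have hΦemb : MeasurableEmbedding Φ :=
      (show Topology.IsClosedEmbedding Φ from
        Topology.IsClosedEmbedding.of_continuous_injective_isClosedMap hΦc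
          (fun y z h => by rw [← hπΦ y, h, hπΦ])
          (fun s hs => by
            have : Φ '' s = π ⁻¹' s ∩ {x | Φ (π x) = x} := by
              ext x
              constructor
              · rintro ⟨y, hy, rfl⟩
                exact ⟨by simpa [hπΦ] using hy, by simp [hπΦ]⟩
              · rintro ⟨hx, hx'⟩
                exact ⟨π x, hx, hx'⟩
            rw [this]
            exact (hs.preimage π.continuous).inter
              (isClosed_eq (hΦc.comp π.continuous) continuous_id))).measurableEmbedding
    rw [hdiv k hk hsupp a, integral_smul_nnreal_measure, NNReal.smul_def, smul_eq_mul, hκw,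
      integral_withDensity_eq_integral_smul hwm, hκ, hΦemb.integral_map]
    congr 1
    rw [← setIntegral_eq_integral_of_forall_compl_eq_zero (s := D)]
    · refine setIntegral_congr_fun hDo.measurableSet fun y hy => ?_
      have h1 := hc.outwardNormal_eq ho hy (hc.graphMap_mem_frontier ho hy)
      have h2 : 1 ≤ ‖N y‖ := one_le_norm_graphNormal he γ y
      have h3 : outwardNormal Ω (Φ y) = ‖N y‖⁻¹ • N y := by
        rw [h1, proj_graphMap]
      simp only [hw, hπΦ, NNReal.smul_def, coe_nnnorm, smul_eq_mul, h3, real_inner_smul_left]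
      field_simp
    · intro y hy
      have : k (Φ y) = 0 := by
        by_contra h
        exact hy (hsupp (subset_tsupport k h))
      rw [this, zero_mul]

/-- Inside `Ω` the derivative agrees with the derivative within `closure Ω`, which is continuous on
a compact set. -/
theorem integrableOn_fderiv_of_contDiffOn_closure {Ω : Set (Space n)} (hΩ : HasC2Boundary Ω)
    (ho : IsOpen Ω) (hb : Bornology.IsBounded Ω) {k : Space n → ℝ}
    (hk : ContDiffOn ℝ 1 k (closure Ω)) (a : Space n) :
    IntegrableOn (fun x => fderiv ℝ k x a) Ω := by
  have hcomp : IsCompact (closure Ω) := hb.isCompact_closure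
  have h1 : ContinuousOn (fun x => fderivWithin ℝ k (closure Ω) x a) (closure Ω) :=
    (hk.continuousOn_fderivWithin (hΩ.uniqueDiffOn_closure ho) (by norm_num)).clm_apply
      continuousOn_const
  refine ((h1.integrableOn_compact hcomp).mono_set subset_closure).congr_fun
    (fun x hx => ?_) ho.measurableSet
  simp only
  rw [fderivWithin_of_mem_nhds (mem_of_superset (ho.mem_nhds hx) subset_closure)]

/-- The integral of a directional derivative of a function with support inside `Ω` vanishes. -/
theorem integral_fderiv_eq_zero_of_tsupport_subset {Ω : Set (Space n)} (hΩ : HasC2Boundary Ω)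
    (ho : IsOpen Ω) (hb : Bornology.IsBounded Ω) {k : Space n → ℝ}
    (hk : ContDiffOn ℝ 1 k (closure Ω)) (hsupp : tsupport k ⊆ Ω) (a : Space n) :
    ∫ x in Ω, fderiv ℝ k x a = 0 := by
  have hcomp : IsCompact (closure Ω) := hb.isCompact_closure
  obtain ⟨M, hM⟩ : ∃ M, ∀ x ∈ closure Ω, ‖fderivWithin ℝ k (closure Ω) x‖ ≤ M :=
    hcomp.exists_bound_of_continuousOn
      (hk.continuousOn_fderivWithin (hΩ.uniqueDiffOn_closure ho) (by norm_num))
  rw [setIntegral_eq_integral_of_forall_compl_eq_zero fun x hx => ?_]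
  · refine integral_fderiv_eq_zero (M := |M|) (fun x => ?_) ?_ (fun x => ?_) a
    · by_cases hx : x ∈ tsupport k
      · exact (hk.differentiableOn (by norm_num) x (subset_closure (hsupp hx))).differentiableAt
          (mem_of_superset (ho.mem_nhds (hsupp hx)) subset_closure)
      · exact (differentiableAt_const 0).congr_of_eventuallyEq
          (notMem_tsupport_iff_eventuallyEq.1 hx)
    · exact Metric.isCompact_of_isClosed_isBounded (isClosed_tsupport k) (hb.subset hsupp)
    · by_cases hx : x ∈ tsupport k
      · rw [← fderivWithin_of_mem_nhds (mem_of_superset (ho.mem_nhds (hsupp hx)) subset_closure)]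
        exact (hM x (subset_closure (hsupp hx))).trans (le_abs_self M)
      · rw [fderiv_of_notMem_tsupport ℝ hx, norm_zero]
        exact abs_nonneg M
  · rw [fderiv_of_notMem_tsupport ℝ fun h => hx (hsupp h)]
    rfl

/-- **Divergence theorem** on a bounded open set with `C²` boundary, for a boundary measure that is
comparable with the surface measure. -/
theorem HasC2Boundary.exists_boundaryMeasure {Ω : Set (Space n)} (hΩ : HasC2Boundary Ω)
    (ho : IsOpen Ω) (hb : Bornology.IsBounded Ω) :
    ∃ (σ : Measure (Space n)) (C : NNReal), IsFiniteMeasure σ ∧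
      σ ≤ C • surfaceMeasure Ω ∧ surfaceMeasure Ω ≤ C • σ ∧
      ∀ k : Space n → ℝ, ContDiffOn ℝ 1 k (closure Ω) → ∀ a : Space n,
        ∫ x in Ω, fderiv ℝ k x a = ∫ x, k x * ⟪outwardNormal Ω x, a⟫ ∂σ := by
  have hcomp : IsCompact (closure Ω) := hb.isCompact_closure
  have hfcomp : IsCompact (frontier Ω) := hcomp.of_isClosed_subset isClosed_frontier
    frontier_subset_closure
  choose! e γ r hchart using fun p (hp : p ∈ frontier Ω) => hΩ.exists_chart hp
  choose! m Cm hmfin hmle hlem hdiv using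
    fun p (hp : p ∈ frontier Ω) => (hchart p hp).exists_measure hΩ ho hb
  obtain ⟨t, ht, hcover⟩ := hfcomp.elim_nhds_subcover (fun p => Metric.ball p (r p))
    fun p hp => Metric.ball_mem_nhds p (hchart p hp).pos
  -- The index `none` stands for the interior piece `Ω`, the others for the chart balls.
  set U : Option t → Set (Space n) := fun i =>
    i.elim Ω fun p => Metric.ball (p : Space n) (r p) with hU
  have hUo : ∀ i, IsOpen (U i) := by
    rintro (_ | p)
    · exact ho
    · exact Metric.isOpen_ball
  have hUc : closure Ω ⊆ ⋃ i, U i := by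
    intro x hx
    by_cases hxΩ : x ∈ Ω
    · exact mem_iUnion.2 ⟨none, hxΩ⟩
    · have hxf : x ∈ frontier Ω := by rw [ho.frontier_eq]; exact ⟨hx, hxΩ⟩
      obtain ⟨p, hp, hxp⟩ := mem_iUnion₂.1 (hcover hxf)
      exact mem_iUnion.2 ⟨some ⟨p, hp⟩, hxp⟩
  obtain ⟨f, hf⟩ := SmoothPartitionOfUnity.exists_isSubordinate
    (modelWithCornersSelf ℝ (Space n)) isClosed_closure U hUo hUc
  have hfs : ∀ i, ContDiff ℝ 1 (f i) := fun i =>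
    ((f i).contMDiff.contDiff).of_le (by exact_mod_cast le_top)
  have hfsum : ∀ x ∈ closure Ω, ∑ i, f i x = 1 := fun x hx => by
    rw [← finsum_eq_sum_of_fintype]; exact f.sum_eq_one hx
  have hfsupp : ∀ i, tsupport (f i) ⊆ U i := hf
  set χ : t → Space n → NNReal := fun p x => (f (some p) x).toNNReal with hχ
  have hχm : ∀ p, Measurable (χ p) := fun p =>
    ((hfs (some p)).continuous.measurable).real_toNNReal
  have hχ1 : ∀ p x, χ p x ≤ 1 := fun p x => by
    rw [hχ, Real.toNNReal_le_one]; exact f.le_one _ _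
  have hχcoe : ∀ p x, (χ p x : ℝ) = f (some p) x := fun p x =>
    Real.coe_toNNReal _ (f.nonneg _ _)
  have hχsum : ∀ x ∈ frontier Ω, ∑ p, χ p x = 1 := fun x hx => by
    have h1 := hfsum x (frontier_subset_closure hx)
    rw [Fintype.sum_option] at h1
    have h0 : f none x = 0 := by
      by_contra h
      rw [ho.frontier_eq] at hx
      exact hx.2 (hfsupp none (subset_tsupport _ h))
    rw [h0, zero_add] at h1
    rw [← NNReal.coe_inj]
    push_cast
    simp_rw [hχcoe]
    exact h1
  -- The local measures are glued by the partition of unity. The upper bound for the sum uses `χ ≤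
  -- 1`; the lower bound uses `∑ χ = 1` on the boundary, where the interior cutoff vanishes.
  set σi : t → Measure (Space n) := fun p =>
    (m p).withDensity fun x => (χ p x : ENNReal) with hσi
  have hσile : ∀ p, σi p ≤ m p := fun p => by
    calc σi p ≤ (m p).withDensity 1 := withDensity_mono <| ae_of_all _ fun x => by
          simp only [Pi.one_apply]; exact_mod_cast hχ1 p x
      _ = m p := withDensity_one
  have hmfin' : ∀ p : t, IsFiniteMeasure (m p) := fun p => hmfin p (ht p p.2)
  have hσifin : ∀ p, IsFiniteMeasure (σi p) := fun p => isFiniteMeasure_of_le (m p) (hσile p)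
  have hmsupp : ∀ p : t, ∀ᵐ x ∂(m p), x ∈ frontier Ω := fun p => by
    have h1 : ∀ᵐ x ∂(Cm p • surfaceMeasure Ω), x ∈ frontier Ω := by
      refine Measure.ae_smul_measure ?_ _
      exact ae_restrict_mem isClosed_frontier.measurableSet
    exact ae_mono (hmle p (ht p p.2)) h1
  set Ctot : NNReal := ∑ p : t, Cm p with hCtot
  have hCle : ∀ p : t, Cm p ≤ Ctot := fun p =>
    Finset.single_le_sum (f := fun p : t => Cm p) (fun _ _ => zero_le) (Finset.mem_univ p)
  refine ⟨∑ p, σi p, Ctot, inferInstance, ?_, ?_, ?_⟩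
  · refine Measure.le_iff.2 fun s _ => ?_
    simp only [Measure.finsetSum_apply, Measure.smul_apply, ENNReal.smul_def, smul_eq_mul]
    rw [hCtot, ENNReal.ofNNReal_finsetSum, Finset.sum_mul]
    refine Finset.sum_le_sum fun p _ => ?_
    have := (hσile p).trans (hmle p (ht p p.2)) s
    rwa [Measure.smul_apply, ENNReal.smul_def, smul_eq_mul] at this
  · refine Measure.le_iff.2 fun s hs => ?_
    have h1 : surfaceMeasure Ω s = ∫⁻ x in s, ∑ p, (χ p x : ENNReal) ∂(surfaceMeasure Ω) := by
      have h2 : ∀ᵐ x ∂((surfaceMeasure Ω).restrict s), ∑ p, (χ p x : ENNReal) = 1 := by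
        refine ae_mono Measure.restrict_le_self ?_
        filter_upwards [ae_restrict_mem isClosed_frontier.measurableSet] with x hx
        exact_mod_cast hχsum x hx
      rw [lintegral_congr_ae h2, lintegral_one, Measure.restrict_apply_univ]
    rw [h1, lintegral_finsetSum _ fun p _ => (hχm p).coe_nnreal_ennreal]
    simp only [Measure.finsetSum_apply, Measure.smul_apply, ENNReal.smul_def, smul_eq_mul]
    rw [Finset.mul_sum]
    refine Finset.sum_le_sum fun p _ => ?_
    have h3 : ∫⁻ x in s, (χ p x : ENNReal) ∂(surfaceMeasure Ω)
        = ∫⁻ x in s, (χ p x : ENNReal)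
          ∂((surfaceMeasure Ω).restrict (Metric.ball (p : Space n) (r p))) := by
      rw [Measure.restrict_restrict hs, inter_comm, ← Measure.restrict_restrict measurableSet_ball]
      rw [← lintegral_indicator measurableSet_ball]
      refine lintegral_congr fun x => ?_
      by_cases hx : x ∈ Metric.ball (p : Space n) (r p)
      · rw [indicator_of_mem hx]
      rw [indicator_of_notMem hx]
      have h0 : f (some p) x = 0 := by
        by_contra h
        exact hx (hfsupp (some p) (subset_tsupport _ h))
      simp [hχ, h0]
    rw [h3, hσi, withDensity_apply _ hs]
    calc _ ≤ ∫⁻ x in s, (χ p x : ENNReal) ∂((Cm p) • m p) :=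
          lintegral_mono' (Measure.restrict_mono subset_rfl (hlem p (ht p p.2))) le_rfl
      _ = (Cm p : ENNReal) * ∫⁻ x in s, (χ p x : ENNReal) ∂(m p) := by
          rw [Measure.restrict_smul, lintegral_smul_measure, ENNReal.smul_def, smul_eq_mul]
      _ ≤ _ := by gcongr; exact hCle p
  · intro k hk a
    have hki : ∀ i, ContDiffOn ℝ 1 (fun x => f i x * k x) (closure Ω) := fun i =>
      (hfs i).contDiffOn.mul hk
    have hki_supp : ∀ i, tsupport (fun x => f i x * k x) ⊆ U i := fun i =>
      tsupport_mul_subset_left.trans (hfsupp i)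
    have hdiff : ∀ i, ∀ x ∈ Ω, DifferentiableAt ℝ (fun x => f i x * k x) x := fun i x hx =>
      ((hki i).differentiableOn (by norm_num) x (subset_closure hx)).differentiableAt
        (mem_of_superset (ho.mem_nhds hx) subset_closure)
    have hsplit : ∫ x in Ω, fderiv ℝ k x a
        = ∑ i, ∫ x in Ω, fderiv ℝ (fun x => f i x * k x) x a := by
      rw [← integral_finsetSum _ fun i _ =>
        integrableOn_fderiv_of_contDiffOn_closure hΩ ho hb (hki i) a]
      refine setIntegral_congr_fun ho.measurableSet fun x hx => ?_
      have h1 : k =ᶠ[𝓝 x] fun x => ∑ i, f i x * k x := by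
        filter_upwards [ho.mem_nhds hx] with z hz
        rw [← Finset.sum_mul, hfsum z (subset_closure hz), one_mul]
      rw [h1.fderiv_eq, fderiv_fun_sum fun i _ => hdiff i x hx, _root_.sum_apply]
    have hcontf : ContinuousOn (fun x => k x * ⟪outwardNormal Ω x, a⟫) (frontier Ω) :=
      (hk.continuousOn.mono frontier_subset_closure).mul
        ((hΩ.continuousOn_outwardNormal ho).inner continuousOn_const)
    have hint : ∀ p : t, Integrable (fun x => k x * ⟪outwardNormal Ω x, a⟫) (σi p) := fun p => by
      have h1 : (σi p).restrict (frontier Ω) = σi p := by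
        refine Measure.restrict_eq_self_of_ae_mem ?_
        exact ae_mono (hσile p) (hmsupp p)
      rw [← h1]
      exact hcontf.integrableOn_compact hfcomp
    rw [hsplit, Fintype.sum_option,
      integral_fderiv_eq_zero_of_tsupport_subset hΩ ho hb (hki none) (hki_supp none) a, zero_add,
      integral_finsetSum_measure fun p _ => hint p]
    refine Finset.sum_congr rfl fun p _ => ?_
    rw [hdiv p (ht p p.2) _ (hki (some p)) (hki_supp (some p)) a, hσi,
      integral_withDensity_eq_integral_smul (hχm p)]
    refine integral_congr_ae (ae_of_all _ fun x => ?_)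
    simp only [NNReal.smul_def, smul_eq_mul, hχcoe]
    ring

/-! ### Integration and boundary values on the space-time cylinder. -/

variable {Ω : Set (Space n)} {T : ℝ}

theorem closure_stCylinder (hT : 0 < T) (Ω : Set (Space n)) :
    closure (stCylinder T Ω) = Icc 0 T ×ˢ closure Ω := by
  rw [stCylinder, closure_prod_eq, closure_Ioo hT.ne]

theorem isOpen_stCylinder (ho : IsOpen Ω) : IsOpen (stCylinder T Ω) := isOpen_Ioo.prod ho

theorem closure_stCylinder_mem_nhds (ho : IsOpen Ω) {z : SpaceTime n} (hz : z ∈ stCylinder T Ω) :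
    closure (stCylinder T Ω) ∈ 𝓝 z :=
  mem_of_superset ((isOpen_stCylinder ho).mem_nhds hz) subset_closure

theorem isCompact_closure_stCylinder (hT : 0 < T) (hb : Bornology.IsBounded Ω) :
    IsCompact (closure (stCylinder T Ω)) := by
  rw [closure_stCylinder hT]
  exact isCompact_Icc.prod hb.isCompact_closure

/-- This makes the within-derivatives `dt` and `dx` well determined up to the boundary, edges
included. -/
theorem HasC2Boundary.uniqueDiffOn_closure_stCylinder (hΩ : HasC2Boundary Ω) (ho : IsOpen Ω)
    (hT : 0 < T) : UniqueDiffOn ℝ (closure (stCylinder T Ω)) := by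
  rw [closure_stCylinder hT]
  exact (uniqueDiffOn_Icc hT).prod (hΩ.uniqueDiffOn_closure ho)

theorem volume_restrict_stCylinder (T : ℝ) (Ω : Set (Space n)) :
    (volume : Measure (SpaceTime n)).restrict (stCylinder T Ω)
      = (volume.restrict (Ioo 0 T)).prod (volume.restrict Ω) := by
  rw [stCylinder, Measure.volume_eq_prod, Measure.prod_restrict]

theorem integrableOn_stCylinder (hT : 0 < T) (hb : Bornology.IsBounded Ω) {f : SpaceTime n → ℝ}
    (hf : ContinuousOn f (closure (stCylinder T Ω))) : IntegrableOn f (stCylinder T Ω) :=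
  (hf.integrableOn_compact (isCompact_closure_stCylinder hT hb)).mono_set subset_closure

theorem continuousOn_fderivWithin_apply {F : Type*} [NormedAddCommGroup F] [NormedSpace ℝ F]
    {K : Set (SpaceTime n)} (hK : UniqueDiffOn ℝ K) {J : SpaceTime n → F}
    (hJ : ContDiffOn ℝ 1 J K) (d : SpaceTime n) :
    ContinuousOn (fun z => fderivWithin ℝ J K z d) K :=
  (hJ.continuousOn_fderivWithin hK (by norm_num)).clm_apply continuousOn_const

/-- Integration of a time derivative over the cylinder. -/
theorem integral_dt_stCylinder (hΩ : HasC2Boundary Ω) (ho : IsOpen Ω)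
    (hb : Bornology.IsBounded Ω) (hT : 0 < T) {J : SpaceTime n → ℝ}
    (hJ : ContDiffOn ℝ 1 J (closure (stCylinder T Ω))) :
    ∫ z in stCylinder T Ω, dt (closure (stCylinder T Ω)) J z
      = ∫ x in Ω, (J (T, x) - J (0, x)) := by
  have hK := hΩ.uniqueDiffOn_closure_stCylinder ho hT
  have hcont := continuousOn_fderivWithin_apply hK hJ (1, 0)
  have hint : Integrable (dt (closure (stCylinder T Ω)) J)
      ((volume.restrict (Ioo 0 T)).prod (volume.restrict Ω)) := by
    rw [← volume_restrict_stCylinder]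
    exact integrableOn_stCylinder hT hb hcont
  rw [volume_restrict_stCylinder, integral_prod_symm _ hint]
  refine setIntegral_congr_fun ho.measurableSet fun x hx => ?_
  have hmaps : ∀ t ∈ Icc 0 T, (t, x) ∈ closure (stCylinder T Ω) := fun t ht => by
    rw [closure_stCylinder hT]; exact ⟨ht, subset_closure hx⟩
  have hline : Continuous fun t : ℝ => ((t, x) : SpaceTime n) := by fun_prop
  rw [← integral_Ioc_eq_integral_Ioo, ← intervalIntegral.integral_of_le hT.le]
  refine intervalIntegral.integral_eq_sub_of_hasDerivAt_of_le
    (f := fun t => J (t, x)) hT.le ?_ (fun t ht => ?_) ?_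
  · exact hJ.continuousOn.comp hline.continuousOn hmaps
  · have hz : ((t, x) : SpaceTime n) ∈ stCylinder T Ω := ⟨ht, hx⟩
    have h1 : HasFDerivAt J (fderivWithin ℝ J (closure (stCylinder T Ω)) (t, x)) (t, x) :=
      (hJ.differentiableOn (by norm_num) _ (subset_closure hz)).hasFDerivWithinAt.hasFDerivAt
        (closure_stCylinder_mem_nhds ho hz)
    have h2 : HasDerivAt (fun t : ℝ => ((t, x) : SpaceTime n)) (1, 0) t :=
      (hasDerivAt_id t).prodMk (hasDerivAt_const t x)
    exact h1.comp_hasDerivAt t h2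
  · refine ContinuousOn.intervalIntegrable ?_
    rw [uIcc_of_le hT.le]
    exact hcont.comp hline.continuousOn hmaps

/-- Functions continuous on `[0,T] × ∂Ω` are integrable with respect to `dt dσ` for finite measures
`σ` on `∂Ω`. -/
theorem integrable_lateral (hb : Bornology.IsBounded Ω) {σ : Measure (Space n)}
    [IsFiniteMeasure σ] (hσ : ∀ᵐ x ∂σ, x ∈ frontier Ω) {f : SpaceTime n → ℝ}
    (hf : ContinuousOn f (Icc 0 T ×ˢ frontier Ω)) :
    Integrable f ((volume.restrict (Ioo 0 T)).prod σ) := by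
  have hfcomp : IsCompact (frontier Ω) := hb.isCompact_closure.of_isClosed_subset
    isClosed_frontier frontier_subset_closure
  have h1 : σ.restrict (frontier Ω) = σ := Measure.restrict_eq_self_of_ae_mem hσ
  have h2 : IntegrableOn f (Icc 0 T ×ˢ frontier Ω) ((volume : Measure ℝ).prod σ) :=
    hf.integrableOn_compact (isCompact_Icc.prod hfcomp)
  have h3 := h2.mono_set (prod_mono_left (t := frontier Ω) (Ioo_subset_Icc_self (a := (0 : ℝ)) (b := T)))
  rwa [IntegrableOn, ← Measure.prod_restrict, h1] at h3

/-- Integration of a spatial derivative over the cylinder. -/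
theorem integral_dx_stCylinder (hΩ : HasC2Boundary Ω) (ho : IsOpen Ω)
    (hb : Bornology.IsBounded Ω) (hT : 0 < T) {σ : Measure (Space n)} [IsFiniteMeasure σ]
    (hσ : ∀ᵐ x ∂σ, x ∈ frontier Ω)
    (hdiv : ∀ k : Space n → ℝ, ContDiffOn ℝ 1 k (closure Ω) → ∀ a : Space n,
        ∫ x in Ω, fderiv ℝ k x a = ∫ x, k x * ⟪outwardNormal Ω x, a⟫ ∂σ)
    {J : SpaceTime n → ℝ} (hJ : ContDiffOn ℝ 1 J (closure (stCylinder T Ω))) (j : Fin n) :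
    ∫ z in stCylinder T Ω, dx (closure (stCylinder T Ω)) j J z
      = ∫ z, J z * outwardNormal Ω z.2 j ∂((volume.restrict (Ioo 0 T)).prod σ) := by
  have hK := hΩ.uniqueDiffOn_closure_stCylinder ho hT
  have hcont := continuousOn_fderivWithin_apply hK hJ (0, EuclideanSpace.single j 1)
  have hint : Integrable (dx (closure (stCylinder T Ω)) j J)
      ((volume.restrict (Ioo 0 T)).prod (volume.restrict Ω)) := by
    rw [← volume_restrict_stCylinder]
    exact integrableOn_stCylinder hT hb hcont
  have hnu : ContinuousOn (fun z : SpaceTime n => outwardNormal Ω z.2 j) (Icc 0 T ×ˢ frontier Ω) := by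
    have h1 : ContinuousOn (fun z : SpaceTime n => outwardNormal Ω z.2) (Icc 0 T ×ˢ frontier Ω) :=
      (hΩ.continuousOn_outwardNormal ho).comp continuous_snd.continuousOn fun z hz => hz.2
    exact (EuclideanSpace.proj (𝕜 := ℝ) j).continuous.comp_continuousOn h1
  have hbd : Integrable (fun z => J z * outwardNormal Ω z.2 j)
      ((volume.restrict (Ioo 0 T)).prod σ) := by
    refine integrable_lateral hb hσ (ContinuousOn.mul (hJ.continuousOn.mono ?_) hnu)
    rw [closure_stCylinder hT]
    exact prod_mono_right frontier_subset_closure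
  rw [volume_restrict_stCylinder, integral_prod _ hint, integral_prod _ hbd]
  refine setIntegral_congr_fun measurableSet_Ioo fun t ht => ?_
  have hmaps : MapsTo (fun x : Space n => ((t, x) : SpaceTime n)) (closure Ω)
      (closure (stCylinder T Ω)) := fun x hx => by
    rw [closure_stCylinder hT]; exact ⟨Ioo_subset_Icc_self ht, hx⟩
  have hk : ContDiffOn ℝ 1 (fun x => J (t, x)) (closure Ω) :=
    hJ.comp (contDiff_prodMk_right t).contDiffOn hmaps
  have h := hdiv _ hk (EuclideanSpace.single j 1)
  simp only [EuclideanSpace.inner_single_right, one_mul, conj_trivial] at h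
  rw [← h]
  refine setIntegral_congr_fun ho.measurableSet fun x hx => ?_
  have hz : ((t, x) : SpaceTime n) ∈ stCylinder T Ω := ⟨ht, hx⟩
  have h1 : HasFDerivAt J (fderivWithin ℝ J (closure (stCylinder T Ω)) (t, x)) (t, x) :=
    (hJ.differentiableOn (by norm_num) _ (subset_closure hz)).hasFDerivWithinAt.hasFDerivAt
      (closure_stCylinder_mem_nhds ho hz)
  have h2 := h1.comp x (hasFDerivAt_prodMk_right t x)
  simp only [dx]
  have h3 : fderiv ℝ (fun x => J (t, x)) x = _ := h2.fderiv
  rw [h3]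
  rfl

/-- On the lateral boundary, the time derivative of a function that vanishes there is zero. -/
theorem dt_eq_zero_of_lateral (hT : 0 < T) {w : SpaceTime n → ℝ}
    (hw : ContDiffOn ℝ 1 w (closure (stCylinder T Ω))) (h0 : ∀ z ∈ lateral T Ω, w z = 0)
    {z : SpaceTime n} (hz : z ∈ lateral T Ω) : dt (closure (stCylinder T Ω)) w z = 0 := by
  obtain ⟨t, x⟩ := z
  have hmem : ∀ s ∈ Ioo 0 T, ((s, x) : SpaceTime n) ∈ closure (stCylinder T Ω) := fun s hs => by
    rw [closure_stCylinder hT]; exact ⟨Ioo_subset_Icc_self hs, frontier_subset_closure hz.2⟩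
  have h1 := (hw.differentiableOn (by norm_num) (t, x) (hmem t hz.1)).hasFDerivWithinAt
  have h2 : HasDerivWithinAt (fun s : ℝ => ((s, x) : SpaceTime n)) (1, 0) (Ioo 0 T) t :=
    ((hasDerivAt_id t).prodMk (hasDerivAt_const t x)).hasDerivWithinAt
  have h3 := (h1.comp_hasDerivWithinAt t h2 hmem).hasDerivAt (isOpen_Ioo.mem_nhds hz.1)
  have h4 : HasDerivAt (w ∘ fun s : ℝ => ((s, x) : SpaceTime n)) 0 t := by
    refine (hasDerivAt_const t (0 : ℝ)).congr_of_eventuallyEq ?_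
    filter_upwards [isOpen_Ioo.mem_nhds hz.1] with s hs
    exact h0 (s, x) ⟨hs, hz.2⟩
  exact h3.unique h4

/-- At `t = 0`, the spatial derivatives of a function that vanishes there are zero. -/
theorem dx_eq_zero_of_initial (ho : IsOpen Ω) (hT : 0 < T) {w : SpaceTime n → ℝ}
    (hw : ContDiffOn ℝ 1 w (closure (stCylinder T Ω))) (h0 : ∀ x ∈ Ω, w (0, x) = 0)
    {x : Space n} (hx : x ∈ Ω) (j : Fin n) : dx (closure (stCylinder T Ω)) j w (0, x) = 0 := by
  have hmem : ∀ y ∈ Ω, ((0, y) : SpaceTime n) ∈ closure (stCylinder T Ω) := fun y hy => by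
    rw [closure_stCylinder hT]; exact ⟨left_mem_Icc.2 hT.le, subset_closure hy⟩
  have h1 := (hw.differentiableOn (by norm_num) (0, x) (hmem x hx)).hasFDerivWithinAt
  have h2 := (h1.comp x (hasFDerivAt_prodMk_right (𝕜 := ℝ) (0 : ℝ) x).hasFDerivWithinAt
    hmem).hasFDerivAt (ho.mem_nhds hx)
  have h4 : HasFDerivAt (w ∘ fun y : Space n => (((0 : ℝ), y) : SpaceTime n)) (0 : Space n →L[ℝ] ℝ) x := by
    refine (hasFDerivAt_const (0 : ℝ) x).congr_of_eventuallyEq ?_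
    filter_upwards [ho.mem_nhds hx] with y hy
    exact h0 y hy
  have h5 := DFunLike.congr_fun (h2.unique h4) (EuclideanSpace.single j 1)
  exact h5

/-- On the lateral boundary, the spatial gradient of a function that vanishes there is normal. -/
theorem dx_eq_of_lateral (hΩ : HasC2Boundary Ω) (ho : IsOpen Ω) (hT : 0 < T)
    {w : SpaceTime n → ℝ} (hw : ContDiffOn ℝ 1 w (closure (stCylinder T Ω)))
    (h0 : ∀ z ∈ lateral T Ω, w z = 0) {z : SpaceTime n} (hz : z ∈ lateral T Ω) (j : Fin n) :
    dx (closure (stCylinder T Ω)) j w z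
      = outwardNormal Ω z.2 j * dnu (closure (stCylinder T Ω)) Ω w z := by
  obtain ⟨t, x⟩ := z
  obtain ⟨e, γ, r, hc⟩ := hΩ.exists_chart hz.2
  set K := closure (stCylinder T Ω) with hK
  set π := (ℝ ∙ e)ᗮ.orthogonalProjectionOnto with hπ
  set Φ := graphMap e γ with hΦ
  have hxb : x ∈ Metric.ball x r := Metric.mem_ball_self hc.pos
  have hΦx : Φ (π x) = x := graphMap_proj hc.norm_eq γ (hc.eq_of_mem_frontier ho hxb hz.2)
  have hΦc : Continuous Φ := continuous_graphMap hc.contDiff.continuous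
  set D := Φ ⁻¹' Metric.ball x r with hD
  have hDo : IsOpen D := Metric.isOpen_ball.preimage hΦc
  have hxD : π x ∈ D := by rw [hD, mem_preimage, hΦx]; exact hxb
  have hmem : MapsTo (fun y => ((t, Φ y) : SpaceTime n)) D K := fun y hy => by
    rw [hK, closure_stCylinder hT]
    exact ⟨Ioo_subset_Icc_self hz.1, frontier_subset_closure (hc.graphMap_mem_frontier ho hy)⟩
  have hzK : ((t, x) : SpaceTime n) ∈ K := by
    rw [hK, closure_stCylinder hT]
    exact ⟨Ioo_subset_Icc_self hz.1, frontier_subset_closure hz.2⟩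
  have h1 : HasFDerivWithinAt w (fderivWithin ℝ w K (t, x)) K (t, Φ (π x)) := by
    rw [hΦx]
    exact (hw.differentiableOn (by norm_num) (t, x) hzK).hasFDerivWithinAt
  have hγd : HasFDerivAt γ (fderiv ℝ γ (π x)) (π x) :=
    (hc.contDiff.differentiable (by norm_num) (π x)).hasFDerivAt
  have hΦd : HasFDerivAt Φ ((ℝ ∙ e)ᗮ.subtypeL + (fderiv ℝ γ (π x)).smulRight e) (π x) :=
    ((ℝ ∙ e)ᗮ.subtypeL.hasFDerivAt).add (hγd.smul_const e)
  have h2 := (h1.comp (π x) (((hasFDerivAt_const t (π x)).prodMk hΦd).hasFDerivWithinAt (s := D))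
    hmem).hasFDerivAt (hDo.mem_nhds hxD)
  have h3 : HasFDerivAt (w ∘ fun y => ((t, Φ y) : SpaceTime n)) (0 : (ℝ ∙ e)ᗮ →L[ℝ] ℝ) (π x) := by
    refine (hasFDerivAt_const (0 : ℝ) (π x)).congr_of_eventuallyEq ?_
    filter_upwards [hDo.mem_nhds hxD] with y hy
    exact h0 (t, Φ y) ⟨hz.1, hc.graphMap_mem_frontier ho hy⟩
  have h4 := h2.unique h3
  set w' : Space n →L[ℝ] ℝ :=
    (fderivWithin ℝ w K (t, x)).comp (ContinuousLinearMap.inr ℝ ℝ (Space n)) with hw'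
  -- `w` vanishes along the graph, so its derivative kills the tangent vectors `b + (∂_bγ) e`. By
  -- `inner_graphNormal` every vector orthogonal to `ν` is of this form.
  have htan : ∀ b : (ℝ ∙ e)ᗮ, w' ((b : Space n) + (fderiv ℝ γ (π x) b) • e) = 0 := fun b => by
    have := DFunLike.congr_fun h4 b
    simpa [hw'] using this
  set ν := outwardNormal Ω x with hν
  have hν1 : ‖ν‖ = 1 := hΩ.norm_outwardNormal ho hz.2
  have hνN : ν = ‖graphNormal e γ (π x)‖⁻¹ • graphNormal e γ (π x) :=
    hc.outwardNormal_eq ho hxb hz.2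
  have hNpos := one_le_norm_graphNormal hc.norm_eq γ (π x)
  have horth : ∀ a : Space n, ⟪ν, a⟫ = 0 → w' a = 0 := fun a ha => by
    have hs := (splitting e hc.norm_eq).apply_symm_apply a
    rw [splitting_symm_apply, splitting_apply] at hs
    have hNa : ⟪graphNormal e γ (π x), a⟫ = 0 := by
      rw [hνN, real_inner_smul_left] at ha
      exact (mul_eq_zero.1 ha).resolve_left (by positivity)
    rw [← hs, inner_graphNormal hc.norm_eq, sub_eq_zero] at hNa
    rw [← hs]
    simp only at hNa ⊢
    rw [← hNa]
    exact htan _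
  have hall : ∀ a : Space n, w' a = ⟪ν, a⟫ * w' ν := fun a => by
    have h5 : w' (a - ⟪ν, a⟫ • ν) = 0 := horth _ (by
      rw [inner_sub_right, real_inner_smul_right, real_inner_self_eq_norm_sq, hν1]; ring)
    rw [map_sub, map_smul, smul_eq_mul, sub_eq_zero] at h5
    exact h5
  have hdx : ∀ i, dx K i w (t, x) = w' (EuclideanSpace.single i 1) := fun i => rfl
  have hdnu : dnu K Ω w (t, x) = w' ν := by
    have hsum : ν = ∑ i, ν i • (EuclideanSpace.single i (1 : ℝ) : Space n) := by
      have := (EuclideanSpace.basisFun (Fin n) ℝ).sum_repr ν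
      simpa using this.symm
    conv_rhs => rw [hsum]
    simp only [dnu, hdx, map_sum, map_smul]
    rfl
  rw [hdx, hdnu, hall]
  simp [EuclideanSpace.inner_single_right, hν]

/-! ### Energy current, its divergence, and the energy inequality. -/

section Calculus

variable {F : Type*} [NormedAddCommGroup F] [NormedSpace ℝ F] {K : Set (SpaceTime n)}

theorem contDiffOn_fderivWithin_apply (hK : UniqueDiffOn ℝ K) {f : SpaceTime n → F}
    (hf : ContDiffOn ℝ 2 f K) (d : SpaceTime n) :
    ContDiffOn ℝ 1 (fun z => fderivWithin ℝ f K z d) K :=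
  (hf.fderivWithin hK (by norm_num)).clm_apply contDiffOn_const

theorem contDiffOn_dt (hK : UniqueDiffOn ℝ K) {f : SpaceTime n → F} (hf : ContDiffOn ℝ 2 f K) :
    ContDiffOn ℝ 1 (dt K f) K :=
  contDiffOn_fderivWithin_apply hK hf _

theorem contDiffOn_dx (hK : UniqueDiffOn ℝ K) {f : SpaceTime n → F} (hf : ContDiffOn ℝ 2 f K)
    (j : Fin n) : ContDiffOn ℝ 1 (dx K j f) K :=
  contDiffOn_fderivWithin_apply hK hf _

/-- Symmetry of the second derivative; the cancellations in the divergence of the energy current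
depend on it. -/
theorem fderivWithin_fderivWithin_comm (hK : UniqueDiffOn ℝ K) {f : SpaceTime n → F}
    (hf : ContDiffOn ℝ 2 f K) {z : SpaceTime n} (hz : K ∈ 𝓝 z) (d d' : SpaceTime n) :
    fderivWithin ℝ (fun y => fderivWithin ℝ f K y d) K z d'
      = fderivWithin ℝ (fun y => fderivWithin ℝ f K y d') K z d := by
  have hzK : z ∈ K := mem_of_mem_nhds hz
  have hdiff : DifferentiableWithinAt ℝ (fderivWithin ℝ f K) K z :=
    (hf.fderivWithin hK (m := 1) (by norm_num)).differentiableOn (by norm_num) z hzK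
  have h1 : ∀ d d' : SpaceTime n, fderivWithin ℝ (fun y => fderivWithin ℝ f K y d) K z d'
      = fderivWithin ℝ (fderivWithin ℝ f K) K z d' d := fun d d' => by
    rw [fderivWithin_clm_apply (hK z hzK) hdiff (differentiableWithinAt_const d)]
    simp
  rw [h1, h1]
  exact (hf z hzK).isSymmSndFDerivWithinAt (by simp) hK
    (subset_closure (mem_interior_iff_mem_nhds.2 hz)) hzK d' d

/-- The derivative of a function along a line through an interior point. -/
theorem hasDerivAt_line {f : SpaceTime n → F} (hf : ContDiffOn ℝ 1 f K) {z : SpaceTime n}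
    (hz : K ∈ 𝓝 z) (d : SpaceTime n) :
    HasDerivAt (fun s : ℝ => f (z + s • d)) (fderivWithin ℝ f K z d) 0 := by
  have h1 : HasFDerivAt f (fderivWithin ℝ f K z) z :=
    (hf.differentiableOn (by norm_num) z (mem_of_mem_nhds hz)).hasFDerivWithinAt.hasFDerivAt hz
  exact h1.hasLineDerivAt d

end Calculus

/-- Product rule along a line `z + s d`: `A`, `B`, `V`, `P`, `X k` stand for the restrictions of
`a`, `β`, `v`, `∂ₜv`, `∂ₖv`. -/
theorem hasDerivAt_energyDensity {ω : Space n} {h : ℝ} {A B V P : ℝ → ℝ} {X : Fin n → ℝ → ℝ}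
    {A' B' V' P' : ℝ} {X' : Fin n → ℝ} {s : ℝ} (hA : HasDerivAt A A' s) (hB : HasDerivAt B B' s)
    (hV : HasDerivAt V V' s) (hP : HasDerivAt P P' s) (hX : ∀ k, HasDerivAt (X k) (X' k) s) :
    HasDerivAt (fun s => h * (A s / 2 * (P s ^ 2 + ∑ k, X k s ^ 2) - P s * ∑ k, ω k * X k s)
        + B s * A s * V s ^ 2 / 2)
      (h * (A' / 2 * (P s ^ 2 + ∑ k, X k s ^ 2) + A s * (P s * P' + ∑ k, X k s * X' k)
          - P' * ∑ k, ω k * X k s - P s * ∑ k, ω k * X' k)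
        + (B' * A s + B s * A') * V s ^ 2 / 2 + B s * A s * (V s * V')) s := by
  have hS2 : HasDerivAt (fun s => ∑ k, X k s ^ 2) (2 * ∑ k, X k s * X' k) s := by
    have := HasDerivAt.fun_sum (u := Finset.univ) fun k _ => (hX k).pow 2
    refine HasDerivAt.congr_deriv this ?_
    rw [Finset.mul_sum]
    exact Finset.sum_congr rfl fun k _ => by simp; ring
  have hSw : HasDerivAt (fun s => ∑ k, ω k * X k s) (∑ k, ω k * X' k) s :=
    HasDerivAt.fun_sum (u := Finset.univ) fun k _ => (hX k).const_mul (ω k)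
  have := ((((hA.div_const 2).mul ((hP.pow 2).add hS2)).sub (hP.mul hSw)).const_mul h).add
    (((hB.mul hA).mul (hV.pow 2)).div_const 2)
  refine HasDerivAt.congr_deriv this ?_
  simp
  ring

/-- The flux is differentiated only in space, and `a`, `β` depend on `t` alone; hence the zero
derivatives of `A` and `B`. -/
theorem hasDerivAt_energyFlux {ω : Space n} {h : ℝ} {A B V P : ℝ → ℝ} {X : Fin n → ℝ → ℝ}
    {V' P' : ℝ} {X' : Fin n → ℝ} {s : ℝ} (hA : HasDerivAt A 0 s) (hB : HasDerivAt B 0 s)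
    (hV : HasDerivAt V V' s) (hP : HasDerivAt P P' s) (hX : ∀ k, HasDerivAt (X k) (X' k) s)
    (j : Fin n) :
    HasDerivAt (fun s => h * (-(A s * (P s * X j s)) + (∑ k, ω k * X k s) * X j s
          + ω j / 2 * (P s ^ 2 - ∑ k, X k s ^ 2)) - B s * ω j * V s ^ 2 / 2)
      (h * (-(A s * (P' * X j s + P s * X' j)) + (∑ k, ω k * X' k) * X j s
          + (∑ k, ω k * X k s) * X' j + ω j * (P s * P' - ∑ k, X k s * X' k))
        - B s * ω j * (V s * V')) s := by
  have hS2 : HasDerivAt (fun s => ∑ k, X k s ^ 2) (2 * ∑ k, X k s * X' k) s := by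
    have := HasDerivAt.fun_sum (u := Finset.univ) fun k _ => (hX k).pow 2
    refine HasDerivAt.congr_deriv this ?_
    rw [Finset.mul_sum]
    exact Finset.sum_congr rfl fun k _ => by simp; ring
  have hSw : HasDerivAt (fun s => ∑ k, ω k * X k s) (∑ k, ω k * X' k) s :=
    HasDerivAt.fun_sum (u := Finset.univ) fun k _ => (hX k).const_mul (ω k)
  have := ((((hA.mul (hP.mul (hX j))).neg.add (hSw.mul (hX j))).add
    (((hP.pow 2).sub hS2).const_mul (ω j / 2))).const_mul h).sub
    (((hB.mul_const (ω j)).mul (hV.pow 2)).div_const 2)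
  refine HasDerivAt.congr_deriv this ?_
  simp
  ring

/-- The algebra behind the energy identity: the divergence of the energy current in terms of the
wave operator. -/
theorem divergence_energy_algebra (ω : Space n) (h a a' β β' v vt vtt : ℝ) (X m : Fin n → ℝ)
    (H : Fin n → Fin n → ℝ) (hH : ∀ j k, H j k = H k j) :
    (h * (a' / 2 * (vt ^ 2 + ∑ k, X k ^ 2) + a * (vt * vtt + ∑ k, X k * m k)
          - vtt * ∑ k, ω k * X k - vt * ∑ k, ω k * m k)
        + (β' * a + β * a') * v ^ 2 / 2 + β * a * (v * vt))
      + ∑ j, (h * (-(a * (m j * X j + vt * H j j)) + (∑ k, ω k * H j k) * X j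
          + (∑ k, ω k * X k) * H j j + ω j * (vt * m j - ∑ k, X k * H j k))
        - β * ω j * (v * X j))
      = h * (vtt - ∑ j, H j j) * (a * vt - ∑ k, ω k * X k)
        + h * a' / 2 * (vt ^ 2 + ∑ k, X k ^ 2) + (β' * a + β * a') * v ^ 2 / 2
        + β * v * (a * vt - ∑ k, ω k * X k) := by
  -- Both sides are `ω·∇(|∇v|²/2)`, by symmetry of the Hessian. This makes the second-order terms
  -- quadratic in space collapse to `-Δv (a ∂ₜv - ω·∇v)`.
  have h1 : ∑ j, (∑ k, ω k * H j k) * X j = ∑ j, ω j * ∑ k, X k * H j k := by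
    simp_rw [Finset.sum_mul, Finset.mul_sum]
    rw [Finset.sum_comm]
    refine Finset.sum_congr rfl fun j _ => Finset.sum_congr rfl fun k _ => ?_
    rw [hH k j]; ring
  have h2 : ∑ j, (h * (-(a * (m j * X j + vt * H j j)) + (∑ k, ω k * H j k) * X j
          + (∑ k, ω k * X k) * H j j + ω j * (vt * m j - ∑ k, X k * H j k))
        - β * ω j * (v * X j))
      = h * (-(a * (∑ j, X j * m j + vt * ∑ j, H j j)) + ∑ j, (∑ k, ω k * H j k) * X j
          + (∑ k, ω k * X k) * ∑ j, H j j + vt * ∑ j, ω j * m j - ∑ j, ω j * ∑ k, X k * H j k)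
        - β * v * ∑ j, ω j * X j := by
    simp only [Finset.mul_sum, ← Finset.sum_add_distrib, ← Finset.sum_sub_distrib,
      ← Finset.sum_neg_distrib]
    refine Finset.sum_congr rfl fun j _ => ?_
    simp only [← Finset.mul_sum]
    ring
  rw [h2, h1]
  ring

/-- The coefficient `a(t) = 1 - lam h t`. -/
def coeffA (lam h t : ℝ) : ℝ := 1 - lam * h * t

/-- The coefficient `β(t) = -2 lam t + h lam² t² - h lam`. -/
def coeffB (lam h t : ℝ) : ℝ := -2 * lam * t + h * lam ^ 2 * t ^ 2 - h * lam

/-- The time component of the energy current. -/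
noncomputable def energyDensity (K : Set (SpaceTime n)) (ω : Space n) (lam h : ℝ)
    (v : SpaceTime n → ℝ) (z : SpaceTime n) : ℝ :=
  h * (coeffA lam h z.1 / 2 * (dt K v z ^ 2 + ∑ k, dx K k v z ^ 2)
      - dt K v z * ∑ k, ω k * dx K k v z)
    + coeffB lam h z.1 * coeffA lam h z.1 * v z ^ 2 / 2

/-- The spatial components of the energy current. -/
noncomputable def energyFlux (K : Set (SpaceTime n)) (ω : Space n) (lam h : ℝ)
    (v : SpaceTime n → ℝ) (j : Fin n) (z : SpaceTime n) : ℝ :=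
  h * (-(coeffA lam h z.1 * (dt K v z * dx K j v z)) + (∑ k, ω k * dx K k v z) * dx K j v z
      + ω j / 2 * (dt K v z ^ 2 - ∑ k, dx K k v z ^ 2))
    - coeffB lam h z.1 * ω j * v z ^ 2 / 2

/-- The conjugated wave operator `h □v + 2 (a ∂ₜ - ω·∇) v + β v`. -/
noncomputable def conjWave (K : Set (SpaceTime n)) (ω : Space n) (lam h : ℝ)
    (v : SpaceTime n → ℝ) (z : SpaceTime n) : ℝ :=
  h * (dt K (dt K v) z - ∑ j, dx K j (dx K j v) z)
    + 2 * (coeffA lam h z.1 * dt K v z - ∑ k, ω k * dx K k v z) + coeffB lam h z.1 * v z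

theorem contDiff_coeffA (lam h : ℝ) : ContDiff ℝ 1 fun z : SpaceTime n => coeffA lam h z.1 := by
  unfold coeffA; fun_prop

theorem contDiff_coeffB (lam h : ℝ) : ContDiff ℝ 1 fun z : SpaceTime n => coeffB lam h z.1 := by
  unfold coeffB; fun_prop

theorem contDiffOn_energyDensity {K : Set (SpaceTime n)} (hK : UniqueDiffOn ℝ K)
    {v : SpaceTime n → ℝ} (hv : ContDiffOn ℝ 2 v K) (ω : Space n) (lam h : ℝ) :
    ContDiffOn ℝ 1 (energyDensity K ω lam h v) K := by
  have h1 := contDiffOn_dt hK hv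
  have h2 := contDiffOn_dx hK hv
  have h3 : ContDiffOn ℝ 1 v K := hv.of_le (by norm_num)
  have h4 := (contDiff_coeffA (n := n) lam h).contDiffOn (s := K)
  have h5 := (contDiff_coeffB (n := n) lam h).contDiffOn (s := K)
  have h6 : ContDiffOn ℝ 1 (fun z => ∑ k, dx K k v z ^ 2) K :=
    ContDiffOn.sum fun k _ => (h2 k).pow 2
  have h7 : ContDiffOn ℝ 1 (fun z => ∑ k, ω k * dx K k v z) K :=
    ContDiffOn.sum fun k _ => contDiffOn_const.mul (h2 k)
  exact (contDiffOn_const.mul (((h4.div_const 2).mul ((h1.pow 2).add h6)).sub (h1.mul h7))).add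
    (((h5.mul h4).mul (h3.pow 2)).div_const 2)

theorem contDiffOn_energyFlux {K : Set (SpaceTime n)} (hK : UniqueDiffOn ℝ K)
    {v : SpaceTime n → ℝ} (hv : ContDiffOn ℝ 2 v K) (ω : Space n) (lam h : ℝ)
    (j : Fin n) : ContDiffOn ℝ 1 (energyFlux K ω lam h v j) K := by
  have h1 := contDiffOn_dt hK hv
  have h2 := contDiffOn_dx hK hv
  have h3 : ContDiffOn ℝ 1 v K := hv.of_le (by norm_num)
  have h4 := (contDiff_coeffA (n := n) lam h).contDiffOn (s := K)
  have h5 := (contDiff_coeffB (n := n) lam h).contDiffOn (s := K)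
  have h6 : ContDiffOn ℝ 1 (fun z => ∑ k, dx K k v z ^ 2) K :=
    ContDiffOn.sum fun k _ => (h2 k).pow 2
  have h7 : ContDiffOn ℝ 1 (fun z => ∑ k, ω k * dx K k v z) K :=
    ContDiffOn.sum fun k _ => contDiffOn_const.mul (h2 k)
  exact (contDiffOn_const.mul (((h4.mul (h1.mul (h2 j))).neg.add (h7.mul (h2 j))).add
    (contDiffOn_const.mul ((h1.pow 2).sub h6)))).sub
    (((h5.mul contDiffOn_const).mul (h3.pow 2)).div_const 2)

theorem continuousOn_conjWave {K : Set (SpaceTime n)} (hK : UniqueDiffOn ℝ K)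
    {v : SpaceTime n → ℝ} (hv : ContDiffOn ℝ 2 v K) (ω : Space n) (lam h : ℝ) :
    ContinuousOn (conjWave K ω lam h v) K := by
  have h1 := contDiffOn_dt hK hv
  have h2 := contDiffOn_dx hK hv
  have h4 := (contDiff_coeffA (n := n) lam h).continuous.continuousOn (s := K)
  have h5 := (contDiff_coeffB (n := n) lam h).continuous.continuousOn (s := K)
  have h6 : ContinuousOn (fun z => ∑ k, ω k * dx K k v z) K :=
    continuousOn_finsetSum _ fun k _ => continuousOn_const.mul (h2 k).continuousOn
  have h7 : ContinuousOn (fun z => ∑ k, dx K k (dx K k v) z) K :=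
    continuousOn_finsetSum _ fun k _ => continuousOn_fderivWithin_apply hK (h2 k) _
  have h8 : ContinuousOn (dt K (dt K v)) K := continuousOn_fderivWithin_apply hK h1 _
  exact ((continuousOn_const.mul (h8.sub h7)).add
    (continuousOn_const.mul ((h4.mul h1.continuousOn).sub h6))).add (h5.mul hv.continuousOn)

/-- The divergence of the energy current. -/
theorem divergence_energy {K : Set (SpaceTime n)} (hK : UniqueDiffOn ℝ K)
    {v : SpaceTime n → ℝ} (hv : ContDiffOn ℝ 2 v K) (ω : Space n) (lam h : ℝ)
    {z : SpaceTime n} (hz : K ∈ 𝓝 z) :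
    dt K (energyDensity K ω lam h v) z + ∑ j, dx K j (energyFlux K ω lam h v j) z
      = (conjWave K ω lam h v z - 2 * (coeffA lam h z.1 * dt K v z - ∑ k, ω k * dx K k v z))
          * (coeffA lam h z.1 * dt K v z - ∑ k, ω k * dx K k v z)
        - lam * h ^ 2 / 2 * (dt K v z ^ 2 + ∑ k, dx K k v z ^ 2)
        + ((-2 * lam + 2 * h * lam ^ 2 * z.1) * coeffA lam h z.1
          + coeffB lam h z.1 * (-(lam * h))) * v z ^ 2 / 2 := by
  have h1 := contDiffOn_dt hK hv
  have h2 := contDiffOn_dx hK hv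
  have h3 : ContDiffOn ℝ 1 v K := hv.of_le (by norm_num)
  have hA : ∀ d : SpaceTime n,
      HasDerivAt (fun s : ℝ => coeffA lam h (z + s • d).1) (-(lam * h) * d.1) 0 := fun d => by
    have h6 : HasDerivAt (fun s : ℝ => z.1 + s * d.1) d.1 0 := by
      simpa using ((hasDerivAt_id (0 : ℝ)).mul_const d.1).const_add z.1
    have h7 := (h6.const_mul (lam * h)).const_sub 1
    refine HasDerivAt.congr_deriv h7 ?_
    ring
  have hB : ∀ d : SpaceTime n, HasDerivAt (fun s : ℝ => coeffB lam h (z + s • d).1)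
      ((-2 * lam + 2 * h * lam ^ 2 * z.1) * d.1) 0 := fun d => by
    have h6 : HasDerivAt (fun s : ℝ => z.1 + s * d.1) d.1 0 := by
      simpa using ((hasDerivAt_id (0 : ℝ)).mul_const d.1).const_add z.1
    have h7 := ((h6.const_mul (-2 * lam)).add ((h6.pow 2).const_mul (h * lam ^ 2))).sub_const
      (h * lam)
    refine HasDerivAt.congr_deriv h7 ?_
    simp
    ring
  have hdens := (hasDerivAt_line (contDiffOn_energyDensity hK hv ω lam h) hz (1, 0)).unique
    (hasDerivAt_energyDensity (ω := ω) (h := h) (hA (1, 0)) (hB (1, 0))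
      (hasDerivAt_line h3 hz (1, 0)) (hasDerivAt_line h1 hz (1, 0))
      fun k => hasDerivAt_line (h2 k) hz (1, 0))
  have hflux : ∀ j, _ := fun j =>
    (hasDerivAt_line (contDiffOn_energyFlux hK hv ω lam h j) hz
      (0, EuclideanSpace.single j 1)).unique
    (hasDerivAt_energyFlux (ω := ω) (h := h)
      (by simpa using hA (0, EuclideanSpace.single j 1))
      (by simpa using hB (0, EuclideanSpace.single j 1))
      (hasDerivAt_line h3 hz (0, EuclideanSpace.single j 1))
      (hasDerivAt_line h1 hz (0, EuclideanSpace.single j 1))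
      (fun k => hasDerivAt_line (h2 k) hz (0, EuclideanSpace.single j 1)) j)
  -- `∂ₖ∂ₜv` is rewritten as `∂ₜ∂ₖv`, so that density and flux share the quantity `m` of
  -- `divergence_energy_algebra`.
  have hmix : ∀ k, fderivWithin ℝ (dt K v) K z (0, EuclideanSpace.single k 1)
      = fderivWithin ℝ (dx K k v) K z (1, 0) := fun k =>
    fderivWithin_fderivWithin_comm hK hv hz _ _
  simp only [zero_smul, add_zero, mul_one] at hdens
  simp only [zero_smul, add_zero, hmix] at hflux
  have halg := divergence_energy_algebra ω h (coeffA lam h z.1) (-(lam * h)) (coeffB lam h z.1)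
    (-2 * lam + 2 * h * lam ^ 2 * z.1) (v z) (dt K v z) (dt K (dt K v) z)
    (fun k => dx K k v z) (fun k => fderivWithin ℝ (dx K k v) K z (1, 0))
    (fun j k => dx K j (dx K k v) z) (fun j k => fderivWithin_fderivWithin_comm hK hv hz _ _)
  have e1 : dt K (energyDensity K ω lam h v) z = _ := hdens
  have e2 : ∀ j, dx K j (energyFlux K ω lam h v j) z = _ := hflux
  rw [e1]
  simp_rw [e2]
  refine Eq.trans halg ?_
  simp only [conjWave]
  ring

theorem ae_mem_lateral {σ : Measure (Space n)} [SFinite σ] (hσ : ∀ᵐ x ∂σ, x ∈ frontier Ω) :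
    ∀ᵐ z ∂((volume.restrict (Ioo 0 T)).prod σ), z ∈ lateral T Ω := by
  have h1 : ∀ᵐ t ∂((volume : Measure ℝ).restrict (Ioo 0 T)), t ∈ Ioo 0 T :=
    ae_restrict_mem measurableSet_Ioo
  filter_upwards [(Measure.quasiMeasurePreserving_fst (ν := σ)).ae h1,
    (Measure.quasiMeasurePreserving_snd (μ := volume.restrict (Ioo 0 T))).ae hσ] with z h2 h3
  exact ⟨h2, h3⟩

theorem inner_eq_sum (x y : Space n) : ⟪x, y⟫ = ∑ k, y k * x k := by
  simp [PiLp.inner_apply]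

/-- The normal component of the energy flux on the lateral boundary. -/
theorem sum_energyFlux_mul_normal (hΩ : HasC2Boundary Ω) (ho : IsOpen Ω) (hT : 0 < T)
    {v : SpaceTime n → ℝ} (hv : ContDiffOn ℝ 2 v (closure (stCylinder T Ω)))
    (h0 : ∀ z ∈ lateral T Ω, v z = 0) (ω : Space n) (lam h : ℝ) {z : SpaceTime n}
    (hz : z ∈ lateral T Ω) :
    ∑ j, energyFlux (closure (stCylinder T Ω)) ω lam h v j z * outwardNormal Ω z.2 j
      = h / 2 * (⟪outwardNormal Ω z.2, ω⟫ * dnu (closure (stCylinder T Ω)) Ω v z ^ 2) := by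
  have hv1 : ContDiffOn ℝ 1 v (closure (stCylinder T Ω)) := hv.of_le (by norm_num)
  have hx := dx_eq_of_lateral hΩ ho hT hv1 h0 hz
  have hν1 := hΩ.norm_outwardNormal ho hz.2
  set ν := outwardNormal Ω z.2 with hν
  set D := dnu (closure (stCylinder T Ω)) Ω v z with hD
  have hsq : ∑ k, ν k * ν k = 1 := by
    rw [← inner_eq_sum, real_inner_self_eq_norm_sq, hν1, one_pow]
  simp only [energyFlux, h0 z hz, dt_eq_zero_of_lateral hT hv1 h0 hz, hx]
  have e1 : ∑ k, ω k * (ν k * D) = ⟪ν, ω⟫ * D := by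
    rw [inner_eq_sum, Finset.sum_mul]
    exact Finset.sum_congr rfl fun k _ => by ring
  have e2 : ∑ k, (ν k * D) ^ 2 = D ^ 2 := by
    have : ∑ k, (ν k * D) ^ 2 = (∑ k, ν k * ν k) * D ^ 2 := by
      rw [Finset.sum_mul]
      exact Finset.sum_congr rfl fun k _ => by ring
    rw [this, hsq, one_mul]
  rw [e1, e2]
  -- The first part sums to `h (ν·ω) D²`; the term with `|∇v|²` takes away half of it.
  have e3 : ∀ j, (h * (-(coeffA lam h z.1 * (0 * (ν j * D))) + ⟪ν, ω⟫ * D * (ν j * D)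
        + ω j / 2 * (0 ^ 2 - D ^ 2)) - coeffB lam h z.1 * ω j * 0 ^ 2 / 2) * ν j
      = h * ⟪ν, ω⟫ * D ^ 2 * (ν j * ν j) - h / 2 * D ^ 2 * (ω j * ν j) := fun j => by ring
  rw [Finset.sum_congr rfl fun j _ => e3 j, Finset.sum_sub_distrib, ← Finset.mul_sum,
    ← Finset.mul_sum, hsq, ← inner_eq_sum]
  ring

/-- The energy inequality for the conjugated wave operator. -/
theorem energy_inequality (hΩ : HasC2Boundary Ω) (ho : IsOpen Ω)
    (hb : Bornology.IsBounded Ω) (hT : 0 < T) {σ : Measure (Space n)} [IsFiniteMeasure σ]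
    (hσ : ∀ᵐ x ∂σ, x ∈ frontier Ω)
    (hdiv : ∀ k : Space n → ℝ, ContDiffOn ℝ 1 k (closure Ω) → ∀ a : Space n,
        ∫ x in Ω, fderiv ℝ k x a = ∫ x, k x * ⟪outwardNormal Ω x, a⟫ ∂σ)
    (ω : Space n) {lam h : ℝ} (hlam : 0 < lam) (hh : 0 < h) (hh1 : h ≤ 1)
    (hlamh : h * lam * (6 * T + 1) ≤ 1) {v : SpaceTime n → ℝ}
    (hv : ContDiffOn ℝ 2 v (closure (stCylinder T Ω))) (h0 : ∀ z ∈ lateral T Ω, v z = 0)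
    (hi : ∀ x ∈ Ω, v (0, x) = 0) (hit : ∀ x ∈ Ω, dt (closure (stCylinder T Ω)) v (0, x) = 0) :
    (∫ x in Ω, energyDensity (closure (stCylinder T Ω)) ω lam h v (T, x))
      + h / 2 * (∫ z, ⟪outwardNormal Ω z.2, ω⟫ * dnu (closure (stCylinder T Ω)) Ω v z ^ 2
          ∂((volume.restrict (Ioo 0 T)).prod σ))
      + lam / 2 * (∫ z in stCylinder T Ω, (h ^ 2 * (dt (closure (stCylinder T Ω)) v z ^ 2
          + ∑ k, dx (closure (stCylinder T Ω)) k v z ^ 2) + v z ^ 2))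
      ≤ 1 / 8 * ∫ z in stCylinder T Ω, conjWave (closure (stCylinder T Ω)) ω lam h v z ^ 2 := by
  set K := closure (stCylinder T Ω) with hKdef
  have hK : UniqueDiffOn ℝ K := hΩ.uniqueDiffOn_closure_stCylinder ho hT
  have hv1 : ContDiffOn ℝ 1 v K := hv.of_le (by norm_num)
  have hJ0 := contDiffOn_energyDensity hK hv ω lam h
  have hJ := contDiffOn_energyFlux hK hv ω lam h
  have hdtc := (contDiffOn_dt hK hv).continuousOn
  have hdxc := fun j => (contDiffOn_dx hK hv j).continuousOn
  have hint0 : IntegrableOn (dt K (energyDensity K ω lam h v)) (stCylinder T Ω) :=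
    integrableOn_stCylinder hT hb (continuousOn_fderivWithin_apply hK hJ0 _)
  have hintj : ∀ j, IntegrableOn (dx K j (energyFlux K ω lam h v j)) (stCylinder T Ω) := fun j =>
    integrableOn_stCylinder hT hb (continuousOn_fderivWithin_apply hK (hJ j) _)
  have hnu : ∀ j, ContinuousOn (fun z : SpaceTime n => outwardNormal Ω z.2 j)
      (Icc 0 T ×ˢ frontier Ω) := fun j => by
    have h1 : ContinuousOn (fun z : SpaceTime n => outwardNormal Ω z.2) (Icc 0 T ×ˢ frontier Ω) :=
      (hΩ.continuousOn_outwardNormal ho).comp continuous_snd.continuousOn fun z hz => hz.2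
    exact (EuclideanSpace.proj (𝕜 := ℝ) j).continuous.comp_continuousOn h1
  have hsub : Icc 0 T ×ˢ frontier Ω ⊆ K := by
    rw [hKdef, closure_stCylinder hT]
    exact prod_mono_right frontier_subset_closure
  have htime : ∫ z in stCylinder T Ω, dt K (energyDensity K ω lam h v) z
      = ∫ x in Ω, energyDensity K ω lam h v (T, x) := by
    rw [integral_dt_stCylinder hΩ ho hb hT hJ0]
    refine setIntegral_congr_fun ho.measurableSet fun x hx => ?_
    have : energyDensity K ω lam h v (0, x) = 0 := by
      have hx0 : ∀ j, dx K j v (0, x) = 0 := dx_eq_zero_of_initial ho hT hv1 hi hx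
      simp only [energyDensity, hi x hx, hit x hx, hx0]
      simp
    simp only [this, sub_zero]
  have hlatint : ∀ j, Integrable (fun z => energyFlux K ω lam h v j z * outwardNormal Ω z.2 j)
      ((volume.restrict (Ioo 0 T)).prod σ) := fun j =>
    integrable_lateral hb hσ (((hJ j).continuousOn.mono hsub).mul (hnu j))
  have hspace : ∫ z in stCylinder T Ω, ∑ j, dx K j (energyFlux K ω lam h v j) z
      = h / 2 * (∫ z, ⟪outwardNormal Ω z.2, ω⟫ * dnu K Ω v z ^ 2
          ∂((volume.restrict (Ioo 0 T)).prod σ)) := by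
    rw [integral_finsetSum _ fun j _ => hintj j,
      Finset.sum_congr rfl fun j _ => integral_dx_stCylinder hΩ ho hb hT hσ hdiv (hJ j) j,
      ← integral_finsetSum _ fun j _ => hlatint j, ← integral_const_mul]
    refine integral_congr_ae ?_
    filter_upwards [ae_mem_lateral (T := T) hσ] with z hz
    exact sum_energyFlux_mul_normal hΩ ho hT hv h0 ω lam h hz
  have hFint : IntegrableOn (fun z => conjWave K ω lam h v z ^ 2) (stCylinder T Ω) :=
    integrableOn_stCylinder hT hb ((continuousOn_conjWave hK hv ω lam h).pow 2)
  have hBint : IntegrableOn (fun z => h ^ 2 * (dt K v z ^ 2 + ∑ k, dx K k v z ^ 2) + v z ^ 2)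
      (stCylinder T Ω) :=
    integrableOn_stCylinder hT hb ((continuousOn_const.mul ((hdtc.pow 2).add
      (continuousOn_finsetSum _ fun k _ => (hdxc k).pow 2))).add (hv.continuousOn.pow 2))
  have hsumint : IntegrableOn (fun z => ∑ j, dx K j (energyFlux K ω lam h v j) z)
      (stCylinder T Ω) := integrable_finsetSum _ fun j _ => hintj j
  have hpt : ∀ z ∈ stCylinder T Ω,
      dt K (energyDensity K ω lam h v) z + ∑ j, dx K j (energyFlux K ω lam h v j) z
      ≤ 1 / 8 * conjWave K ω lam h v z ^ 2
        - lam / 2 * (h ^ 2 * (dt K v z ^ 2 + ∑ k, dx K k v z ^ 2) + v z ^ 2) := by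
    intro z hz
    rw [divergence_energy hK hv ω lam h (closure_stCylinder_mem_nhds ho hz)]
    set F := conjWave K ω lam h v z
    set X := coeffA lam h z.1 * dt K v z - ∑ k, ω k * dx K k v z
    -- The quadratic `(F - 2X) X` is largest at `X = F/4`.
    have h1 : (F - 2 * X) * X ≤ 1 / 8 * F ^ 2 := by nlinarith [sq_nonneg (F - 4 * X)]
    -- The left side is `(βa)'`. Its expansion contains `λ · hλ(6t + h)`, and the smallness
    -- condition with `6T + 1` keeps this below half of the main term `2λ`.
    have h2 : (-2 * lam + 2 * h * lam ^ 2 * z.1) * coeffA lam h z.1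
        + coeffB lam h z.1 * (-(lam * h)) ≤ -lam := by
      obtain ⟨ht0, htT⟩ := hz.1
      have e1 : (-2 * lam + 2 * h * lam ^ 2 * z.1) * coeffA lam h z.1
        + coeffB lam h z.1 * (-(lam * h))
        = -2 * lam + lam * (h * lam * (6 * z.1 + h)) - 3 * h ^ 2 * lam ^ 3 * z.1 ^ 2 := by
        simp only [coeffA, coeffB]; ring
      have e2 : h * lam * (6 * z.1 + h) ≤ h * lam * (6 * T + 1) := by gcongr
      have e3 : lam * (h * lam * (6 * z.1 + h)) ≤ lam * 1 := by
        gcongr; exact e2.trans hlamh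
      have e4 : 0 ≤ 3 * h ^ 2 * lam ^ 3 * z.1 ^ 2 := by positivity
      rw [e1]; linarith
    have h3 := mul_le_mul_of_nonneg_right h2 (sq_nonneg (v z))
    linarith
  have hmono : ∫ z in stCylinder T Ω, (dt K (energyDensity K ω lam h v) z
      + ∑ j, dx K j (energyFlux K ω lam h v j) z)
      ≤ ∫ z in stCylinder T Ω, (1 / 8 * conjWave K ω lam h v z ^ 2
        - lam / 2 * (h ^ 2 * (dt K v z ^ 2 + ∑ k, dx K k v z ^ 2) + v z ^ 2)) :=
    setIntegral_mono_on (hint0.add hsumint)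
      ((hFint.const_mul (1 / 8)).sub (hBint.const_mul (lam / 2)))
      (isOpen_stCylinder ho).measurableSet hpt
  rw [integral_sub (hFint.const_mul (1 / 8)) (hBint.const_mul (lam / 2)), integral_const_mul,
    integral_const_mul, integral_add hint0 hsumint, htime, hspace] at hmono
  linarith

/-! ### Conjugation by the convexified weight. -/

/-- The convexified weight `exp(-φ/h + lam t²/2)`. -/
noncomputable def convexWeight (ω : Space n) (lam h : ℝ) (z : SpaceTime n) : ℝ :=
  Real.exp (-phase ω z / h + lam * z.1 ^ 2 / 2)

/-- The d'Alembertian `∂ₜ²f - Δf`. -/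
noncomputable def box {F : Type*} [NormedAddCommGroup F] [NormedSpace ℝ F]
    (K : Set (SpaceTime n)) (f : SpaceTime n → F) (z : SpaceTime n) : F :=
  dt K (dt K f) z - ∑ j, dx K j (dx K j f) z

theorem contDiff_convexWeight (ω : Space n) (lam h : ℝ) {k : ℕ∞} :
    ContDiff ℝ k (convexWeight ω lam h : SpaceTime n → ℝ) := by
  unfold convexWeight phase
  refine Real.contDiff_exp.comp ?_
  refine ContDiff.add (ContDiff.div_const (ContDiff.neg ?_) h) (by fun_prop)
  exact contDiff_fst.add (contDiff_snd.inner ℝ contDiff_const)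

theorem fderiv_convexWeight (ω : Space n) (lam h : ℝ) (z d : SpaceTime n) :
    fderiv ℝ (convexWeight ω lam h) z d
      = convexWeight ω lam h z * (-(d.1 + ⟪d.2, ω⟫) / h + lam * z.1 * d.1) := by
  have hd : DifferentiableAt ℝ (convexWeight ω lam h) z :=
    (contDiff_convexWeight ω lam h (k := 1)).differentiable (by norm_num) z
  refine (hd.hasFDerivAt.hasLineDerivAt d).unique ?_
  have h6 : HasDerivAt (fun s : ℝ => z.1 + s * d.1) d.1 0 := by
    simpa using ((hasDerivAt_id (0 : ℝ)).mul_const d.1).const_add z.1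
  have h7 : HasDerivAt (fun s : ℝ => ⟪z.2 + s • d.2, ω⟫) ⟪d.2, ω⟫ 0 := by
    have e : (fun s : ℝ => ⟪z.2 + s • d.2, ω⟫) = fun s => ⟪z.2, ω⟫ + s * ⟪d.2, ω⟫ := by
      ext s; rw [inner_add_left, real_inner_smul_left]
    rw [e]
    simpa using ((hasDerivAt_id (0 : ℝ)).mul_const ⟪d.2, ω⟫).const_add ⟪z.2, ω⟫
  have h8 := (((h6.add h7).neg.div_const h).add (((h6.pow 2).const_mul lam).div_const 2)).exp
  refine HasDerivAt.congr_deriv h8 ?_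
  simp [convexWeight, phase]
  ring_nf

section Conjugation

variable {K : Set (SpaceTime n)}

theorem fderivWithin_convexWeight_mul (hK : UniqueDiffOn ℝ K) {f : SpaceTime n → ℝ}
    (hf : ContDiffOn ℝ 1 f K) (ω : Space n) (lam h : ℝ) {z : SpaceTime n} (hz : z ∈ K)
    (d : SpaceTime n) :
    fderivWithin ℝ (fun y => convexWeight ω lam h y * f y) K z d
      = convexWeight ω lam h z * (fderivWithin ℝ f K z d
        + (-(d.1 + ⟪d.2, ω⟫) / h + lam * z.1 * d.1) * f z) := by
  have h1 : DifferentiableAt ℝ (convexWeight ω lam h) z :=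
    (contDiff_convexWeight ω lam h (k := 1)).differentiable (by norm_num) z
  rw [fderivWithin_fun_mul (hK z hz) h1.differentiableWithinAt
    (hf.differentiableOn (by norm_num) z hz), h1.fderivWithin (hK z hz)]
  simp only [_root_.add_apply, _root_.smul_apply, smul_eq_mul,
    fderiv_convexWeight]
  ring

theorem dt_convexWeight_mul (hK : UniqueDiffOn ℝ K) {f : SpaceTime n → ℝ}
    (hf : ContDiffOn ℝ 1 f K) (ω : Space n) (lam : ℝ) {h : ℝ} (hh : h ≠ 0) {z : SpaceTime n}
    (hz : z ∈ K) :
    dt K (fun y => convexWeight ω lam h y * f y) z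
      = convexWeight ω lam h z * (dt K f z - coeffA lam h z.1 / h * f z) := by
  rw [dt, fderivWithin_convexWeight_mul hK hf ω lam h hz]
  simp only [inner_zero_left, add_zero, mul_one, coeffA, dt]
  field_simp
  ring

theorem dx_convexWeight_mul (hK : UniqueDiffOn ℝ K) {f : SpaceTime n → ℝ}
    (hf : ContDiffOn ℝ 1 f K) (ω : Space n) (lam h : ℝ) {z : SpaceTime n} (hz : z ∈ K)
    (j : Fin n) :
    dx K j (fun y => convexWeight ω lam h y * f y) z
      = convexWeight ω lam h z * (dx K j f z - ω j / h * f z) := by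
  rw [dx, fderivWithin_convexWeight_mul hK hf ω lam h hz]
  simp only [EuclideanSpace.inner_single_left, map_one, one_mul, zero_add, mul_zero, add_zero, dx]
  ring

/-- The conjugated wave operator is the d'Alembertian conjugated by the convexified weight. -/
theorem conjWave_convexWeight_mul (hK : UniqueDiffOn ℝ K) {u : SpaceTime n → ℝ}
    (hu : ContDiffOn ℝ 2 u K) {ω : Space n} (hω : ‖ω‖ = 1) (lam : ℝ) {h : ℝ} (hh : h ≠ 0)
    {z : SpaceTime n} (hz : K ∈ 𝓝 z) :
    conjWave K ω lam h (fun y => convexWeight ω lam h y * u y) z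
      = h * convexWeight ω lam h z * box K u z := by
  have hzK : z ∈ K := mem_of_mem_nhds hz
  have hu1 : ContDiffOn ℝ 1 u K := hu.of_le (by norm_num)
  have hut := contDiffOn_dt hK hu
  have hux := contDiffOn_dx hK hu
  have hA := (contDiff_coeffA (n := n) lam h).contDiffOn (s := K)
  have hft : ContDiffOn ℝ 1 (fun y => dt K u y - coeffA lam h y.1 / h * u y) K :=
    hut.sub ((hA.div_const h).mul hu1)
  have hfx : ∀ j, ContDiffOn ℝ 1 (fun y => dx K j u y - ω j / h * u y) K := fun j =>
    (hux j).sub (contDiffOn_const.mul hu1)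
  -- The product rule is applied twice. The inner identity holds on all of `K`, so it may be
  -- differentiated within `K`.
  have e1 : dt K (dt K fun y => convexWeight ω lam h y * u y) z
      = dt K (fun y => convexWeight ω lam h y * (dt K u y - coeffA lam h y.1 / h * u y)) z := by
    rw [dt, dt, fderivWithin_congr (fun y hy => dt_convexWeight_mul hK hu1 ω lam hh hy)
      (dt_convexWeight_mul hK hu1 ω lam hh hzK)]
  have e2 : ∀ j, dx K j (dx K j fun y => convexWeight ω lam h y * u y) z
      = dx K j (fun y => convexWeight ω lam h y * (dx K j u y - ω j / h * u y)) z := fun j => by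
    rw [dx, dx, fderivWithin_congr (fun y hy => dx_convexWeight_mul hK hu1 ω lam h hy j)
      (dx_convexWeight_mul hK hu1 ω lam h hzK j)]
  have e3 : dt K (fun y => dt K u y - coeffA lam h y.1 / h * u y) z
      = dt K (dt K u) z - (-lam * u z + coeffA lam h z.1 / h * dt K u z) := by
    refine (hasDerivAt_line hft hz (1, 0)).unique ?_
    have h6 : HasDerivAt (fun s : ℝ => z.1 + s * 1) 1 0 := by
      simpa using ((hasDerivAt_id (0 : ℝ)).mul_const (1 : ℝ)).const_add z.1
    have h7 : HasDerivAt (fun s : ℝ => coeffA lam h (z + s • ((1, 0) : SpaceTime n)).1 / h)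
        (-lam) 0 := by
      refine HasDerivAt.congr_deriv (((h6.const_mul (lam * h)).const_sub 1).div_const h) ?_
      field_simp
    refine HasDerivAt.congr_deriv ((hasDerivAt_line hut hz (1, 0)).sub
      (h7.mul (hasDerivAt_line hu1 hz (1, 0)))) ?_
    simp only [zero_smul, add_zero, dt]
  have e4 : ∀ j, dx K j (fun y => dx K j u y - ω j / h * u y) z
      = dx K j (dx K j u) z - ω j / h * dx K j u z := fun j =>
    (hasDerivAt_line (hfx j) hz _).unique
      ((hasDerivAt_line (hux j) hz _).sub ((hasDerivAt_line hu1 hz _).const_mul (ω j / h)))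
  -- `|ω| = 1` reduces the zeroth-order terms of order `1/h²` to `(a² - 1)/h²`, which is only of
  -- order `1/h`; after multiplication by `h` it is part of `β`.
  have hωsq : ∑ j, ω j * ω j = 1 := by
    rw [← inner_eq_sum, real_inner_self_eq_norm_sq, hω, one_pow]
  set E := convexWeight ω lam h z with hE
  have e5 : ∑ j, dx K j (dx K j fun y => convexWeight ω lam h y * u y) z
      = E * (∑ j, dx K j (dx K j u) z - 2 / h * ∑ j, ω j * dx K j u z + 1 / h ^ 2 * u z) := by
    have : ∀ j, dx K j (dx K j fun y => convexWeight ω lam h y * u y) z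
        = E * dx K j (dx K j u) z - E * (2 / h) * (ω j * dx K j u z)
          + E * (1 / h ^ 2) * u z * (ω j * ω j) := fun j => by
      rw [e2, dx_convexWeight_mul hK (hfx j) ω lam h hzK, e4]
      ring
    rw [Finset.sum_congr rfl fun j _ => this j, Finset.sum_add_distrib, Finset.sum_sub_distrib,
      ← Finset.mul_sum, ← Finset.mul_sum, ← Finset.mul_sum, hωsq]
    ring
  have e6 : ∑ k, ω k * dx K k (fun y => convexWeight ω lam h y * u y) z
      = E * (∑ k, ω k * dx K k u z - 1 / h * u z) := by
    have : ∀ k, ω k * dx K k (fun y => convexWeight ω lam h y * u y) z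
        = E * (ω k * dx K k u z) - E * (1 / h) * u z * (ω k * ω k) := fun k => by
      rw [dx_convexWeight_mul hK hu1 ω lam h hzK]
      ring
    rw [Finset.sum_congr rfl fun j _ => this j, Finset.sum_sub_distrib,
      ← Finset.mul_sum, ← Finset.mul_sum, hωsq]
    ring
  rw [conjWave, e5, e6, e1, dt_convexWeight_mul hK hft ω lam hh hzK, e3,
    dt_convexWeight_mul hK hu1 ω lam hh hzK, box]
  simp only [coeffA, coeffB, ← hE]
  field_simp
  ring

end Conjugation

/-! ### Carleman estimate for the d'Alembertian. -/

/-- The lower bound for the energy density at the final time. -/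
theorem energyDensity_lower_bound {lam h T : ℝ} (hT : 0 < T) (hlam : 0 < lam) (hh : 0 < h)
    (hlamh : h * lam * (6 * T + 1) ≤ 1) {p g G v : ℝ} (hG : G ^ 2 ≤ g) :
    h / 8 * p ^ 2 - 2 * h * g - (4 * lam * T + 1) * v ^ 2
      ≤ h * (coeffA lam h T / 2 * ((p - coeffA lam h T / h * v) ^ 2
            + (g - 2 / h * G * v + 1 / h ^ 2 * v ^ 2))
          - (p - coeffA lam h T / h * v) * (G - 1 / h * v))
        + coeffB lam h T * coeffA lam h T * v ^ 2 / 2 := by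
  set y := h * lam * T with hy
  have hy0 : 0 < y := by positivity
  have hhl : 0 < h * lam := by positivity
  have hy6 : y ≤ 1 / 6 := by
    have : h * lam * (6 * T + 1) = 6 * y + h * lam := by rw [hy]; ring
    linarith
  have hhl1 : h * lam ≤ 1 := by
    have : h * lam * (6 * T + 1) = 6 * y + h * lam := by rw [hy]; ring
    linarith
  have hlT : 0 < lam * T := by positivity
  have ha : coeffA lam h T = 1 - y := by rw [coeffA, hy]; ring
  have hB : coeffB lam h T = -2 * (lam * T) + y * (lam * T) - h * lam := by
    rw [coeffB, hy]; ring
  -- All negative powers of `h` cancel: the `G v` terms drop out, and the `p v` and `v²` terms carry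
  -- the factor `1 - a² = y (2 - y)` with `y = hλT`.
  have e1 : h * (coeffA lam h T / 2 * ((p - coeffA lam h T / h * v) ^ 2
            + (g - 2 / h * G * v + 1 / h ^ 2 * v ^ 2))
          - (p - coeffA lam h T / h * v) * (G - 1 / h * v))
        + coeffB lam h T * coeffA lam h T * v ^ 2 / 2
      = h * ((1 - y) / 2 * p ^ 2 + (1 - y) / 2 * g - p * G) + h * (lam * T) * (2 - y) * (p * v)
        - (1 - y) * (lam * T) * (2 - y) * v ^ 2 / 2
        + (-2 * (lam * T) + y * (lam * T) - h * lam) * (1 - y) * v ^ 2 / 2 := by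
    rw [ha, hB, hy]
    field_simp
    ring
  rw [e1]
  set L := lam * T with hL
  have hyL : y = h * L := by rw [hy, hL]; ring
  have hg : 0 ≤ g := (sq_nonneg G).trans hG
  have b1 : p * G ≤ p ^ 2 / 8 + 2 * g := by nlinarith [sq_nonneg (p - 4 * G)]
  have hLv : 0 ≤ L * v ^ 2 := by positivity
  have b2 : -(p ^ 2 / 8 + 8 * (L ^ 2 * v ^ 2)) ≤ L * (2 - y) * (p * v) := by
    have h1 : 0 ≤ (p / 2 + 2 * (L * (2 - y)) * v) ^ 2 := sq_nonneg _
    have h2 : (2 - y) ^ 2 ≤ 2 ^ 2 := pow_le_pow_left₀ (by linarith) (by linarith) 2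
    have h3 : (2 - y) ^ 2 * (L ^ 2 * v ^ 2) ≤ 2 ^ 2 * (L ^ 2 * v ^ 2) := by gcongr
    have h4 : (p / 2 + 2 * (L * (2 - y)) * v) ^ 2
        = p ^ 2 / 4 + 2 * (L * (2 - y) * (p * v)) + 4 * ((2 - y) ^ 2 * (L ^ 2 * v ^ 2)) := by ring
    linarith
  have b3 : h * (8 * (L ^ 2 * v ^ 2)) ≤ 2 * L * v ^ 2 := by
    have h1 : h * (8 * (L ^ 2 * v ^ 2)) = 8 * y * (L * v ^ 2) := by rw [hyL]; ring
    have h2 := mul_le_mul_of_nonneg_right (show 8 * y ≤ 2 by linarith) hLv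
    linarith
  have b4 : (1 - y) * L * (2 - y) * v ^ 2 / 2 ≤ L * v ^ 2 := by
    have h1 : (1 - y) * (2 - y) ≤ 1 * 2 :=
      mul_le_mul (by linarith) (by linarith) (by linarith) (by norm_num)
    have h2 := mul_le_mul_of_nonneg_right h1 hLv
    have h3 : (1 - y) * L * (2 - y) * v ^ 2 / 2 = (1 - y) * (2 - y) * (L * v ^ 2) / 2 := by ring
    linarith
  have b5 : -(L * v ^ 2 + v ^ 2) ≤ (-2 * L + y * L - h * lam) * (1 - y) * v ^ 2 / 2 := by
    have h0 : 0 ≤ y * L := by positivity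
    have h1 : y * L ≤ 1 * L := by gcongr; linarith
    have h2 : (2 * L - y * L + h * lam) * (1 - y) ≤ (2 * L - y * L + h * lam) * 1 :=
      mul_le_mul_of_nonneg_left (by linarith) (by linarith)
    have h3 : -(2 * L + 2) ≤ (-2 * L + y * L - h * lam) * (1 - y) := by
      have : (-2 * L + y * L - h * lam) * (1 - y) = -((2 * L - y * L + h * lam) * (1 - y)) := by
        ring
      linarith
    have h4 := mul_le_mul_of_nonneg_right h3 (sq_nonneg v)
    linarith
  have b6 : h * (p * G) ≤ h * (p ^ 2 / 8 + 2 * g) := by gcongr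
  have b7 : h * -(p ^ 2 / 8 + 8 * (L ^ 2 * v ^ 2)) ≤ h * (L * (2 - y) * (p * v)) := by gcongr
  have b8 : h * ((1 - 1 / 6) / 2 * p ^ 2) ≤ h * ((1 - y) / 2 * p ^ 2) := by gcongr
  have b9 : 0 ≤ h * ((1 - y) / 2 * g) := by
    have : 0 ≤ 1 - y := by linarith
    positivity
  have b10 : 0 ≤ h * p ^ 2 := by positivity
  have hv2 := sq_nonneg v
  -- Balance with `L = λT`: the coefficient of `h p²` is at least `5/12 - 1/8 - 1/8 ≥ 1/8`, and the
  -- losses in `v²` are `2L` (`b3`), `L` (`b4`) and `L + 1` (`b5`).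
  linarith

theorem integrableOn_slice (hT : 0 < T) (hb : Bornology.IsBounded Ω) {f : SpaceTime n → ℝ}
    (hf : ContinuousOn f (closure (stCylinder T Ω))) :
    IntegrableOn (fun x => f (T, x)) Ω := by
  have h1 : ContinuousOn (fun x => f (T, x)) (closure Ω) := by
    refine hf.comp (by fun_prop) fun x hx => ?_
    rw [closure_stCylinder hT]
    exact ⟨right_mem_Icc.2 hT.le, hx⟩
  exact (h1.integrableOn_compact hb.isCompact_closure).mono_set subset_closure

theorem continuousOn_convexWeight (ω : Space n) (lam h : ℝ) (s : Set (SpaceTime n)) :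
    ContinuousOn (convexWeight ω lam h) s :=
  (contDiff_convexWeight ω lam h (k := 0)).continuous.continuousOn

theorem continuousOn_box {F : Type*} [NormedAddCommGroup F] [NormedSpace ℝ F]
    {K : Set (SpaceTime n)} (hK : UniqueDiffOn ℝ K) {f : SpaceTime n → F}
    (hf : ContDiffOn ℝ 2 f K) : ContinuousOn (box K f) K :=
  ContinuousOn.sub (continuousOn_fderivWithin_apply hK (contDiffOn_dt hK hf) _)
    (continuousOn_finsetSum _ fun j _ =>
      continuousOn_fderivWithin_apply hK (contDiffOn_dx hK hf j) _)

theorem sum_sq_eq_one {ω : Space n} (hω : ‖ω‖ = 1) : ∑ j, ω j ^ 2 = 1 := by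
  have : ∑ j, ω j * ω j = 1 := by
    rw [← inner_eq_sum, real_inner_self_eq_norm_sq, hω, one_pow]
  simpa [sq] using this

/-- The Carleman estimate for the d'Alembertian and real-valued functions, with the convexified
weight. -/
theorem carleman_box_real (hΩ : HasC2Boundary Ω) (ho : IsOpen Ω)
    (hb : Bornology.IsBounded Ω) (hT : 0 < T) {σ : Measure (Space n)} [IsFiniteMeasure σ]
    (hσ : ∀ᵐ x ∂σ, x ∈ frontier Ω)
    (hdiv : ∀ k : Space n → ℝ, ContDiffOn ℝ 1 k (closure Ω) → ∀ a : Space n,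
        ∫ x in Ω, fderiv ℝ k x a = ∫ x, k x * ⟪outwardNormal Ω x, a⟫ ∂σ)
    {ω : Space n} (hω : ‖ω‖ = 1) {lam h : ℝ} (hlam : 0 < lam) (hh : 0 < h) (hh1 : h ≤ 1)
    (hlamh : h * lam * (6 * T + 1) ≤ 1) {K : Set (SpaceTime n)} (hKdef : K = closure (stCylinder T Ω))
    {u : SpaceTime n → ℝ} (hu : ContDiffOn ℝ 2 u K) (h0 : ∀ z ∈ lateral T Ω, u z = 0)
    (hi : ∀ x ∈ Ω, u (0, x) = 0) (hit : ∀ x ∈ Ω, dt K u (0, x) = 0) :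
    h / 8 * (∫ x in Ω, convexWeight ω lam h (T, x) ^ 2 * dt K u (T, x) ^ 2)
      + h / 2 * (∫ z, ⟪outwardNormal Ω z.2, ω⟫ * (convexWeight ω lam h z ^ 2 * dnu K Ω u z ^ 2)
          ∂((volume.restrict (Ioo 0 T)).prod σ))
      + lam / 10 * (∫ z in stCylinder T Ω, convexWeight ω lam h z ^ 2
          * (h ^ 2 * dt K u z ^ 2 + h ^ 2 * ∑ k, dx K k u z ^ 2 + u z ^ 2))
      ≤ 1 / 8 * (∫ z in stCylinder T Ω, h ^ 2 * convexWeight ω lam h z ^ 2 * box K u z ^ 2)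
        + 2 * h * (∫ x in Ω, convexWeight ω lam h (T, x) ^ 2 * ∑ k, dx K k u (T, x) ^ 2)
        + (4 * lam * T + 1) * (∫ x in Ω, convexWeight ω lam h (T, x) ^ 2 * u (T, x) ^ 2) := by
  subst hKdef
  set K := closure (stCylinder T Ω) with hKdef
  have hK : UniqueDiffOn ℝ K := hΩ.uniqueDiffOn_closure_stCylinder ho hT
  have hu1 : ContDiffOn ℝ 1 u K := hu.of_le (by norm_num)
  set E := convexWeight ω lam h with hE
  set v : SpaceTime n → ℝ := fun y => E y * u y with hv
  have hv2 : ContDiffOn ℝ 2 v K :=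
    (contDiff_convexWeight ω lam h (k := 2)).contDiffOn.mul hu
  have hvt : ∀ z ∈ K, dt K v z = E z * (dt K u z - coeffA lam h z.1 / h * u z) := fun z hz =>
    dt_convexWeight_mul hK hu1 ω lam hh.ne' hz
  have hvx : ∀ z ∈ K, ∀ j, dx K j v z = E z * (dx K j u z - ω j / h * u z) := fun z hz j =>
    dx_convexWeight_mul hK hu1 ω lam h hz j
  have hωsq := sum_sq_eq_one hω
  have hQK : ∀ z ∈ stCylinder T Ω, z ∈ K := fun z hz => subset_closure hz
  have h0K : ∀ x ∈ Ω, ((0, x) : SpaceTime n) ∈ K := fun x hx => by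
    rw [hKdef, closure_stCylinder hT]; exact ⟨left_mem_Icc.2 hT.le, subset_closure hx⟩
  have hTK : ∀ x ∈ Ω, ((T, x) : SpaceTime n) ∈ K := fun x hx => by
    rw [hKdef, closure_stCylinder hT]; exact ⟨right_mem_Icc.2 hT.le, subset_closure hx⟩
  have hlK : ∀ z ∈ lateral T Ω, z ∈ K := fun z hz => by
    rw [hKdef, closure_stCylinder hT]
    exact ⟨Ioo_subset_Icc_self hz.1, frontier_subset_closure hz.2⟩
  have hmain := energy_inequality hΩ ho hb hT hσ hdiv ω hlam hh hh1 hlamh hv2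
    (fun z hz => by simp only [hv, h0 z hz, mul_zero])
    (fun x hx => by simp only [hv, hi x hx, mul_zero])
    (fun x hx => by rw [hvt _ (h0K x hx), hit x hx, hi x hx]; ring)
  have hEc : ContinuousOn E K := continuousOn_convexWeight ω lam h K
  have hutc := (contDiffOn_dt hK hu).continuousOn
  have huxc := fun j => (contDiffOn_dx hK hu j).continuousOn
  have hsc : ContinuousOn (fun z => ∑ k, dx K k u z ^ 2) K :=
    continuousOn_finsetSum _ fun k _ => (huxc k).pow 2
  have hvtc := (contDiffOn_dt hK hv2).continuousOn
  have hvxc := fun j => (contDiffOn_dx hK hv2 j).continuousOn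
  -- the lateral term
  have hlat : ∫ z, ⟪outwardNormal Ω z.2, ω⟫ * dnu K Ω v z ^ 2
        ∂((volume.restrict (Ioo 0 T)).prod σ)
      = ∫ z, ⟪outwardNormal Ω z.2, ω⟫ * (E z ^ 2 * dnu K Ω u z ^ 2)
        ∂((volume.restrict (Ioo 0 T)).prod σ) := by
    refine integral_congr_ae ?_
    filter_upwards [ae_mem_lateral (T := T) hσ] with z hz
    -- The term in which `E` is differentiated carries the factor `u = 0`.
    have : dnu K Ω v z = E z * dnu K Ω u z := by
      simp only [dnu, hvx z (hlK z hz), h0 z hz, mul_zero, sub_zero, smul_eq_mul]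
      rw [Finset.mul_sum]
      exact Finset.sum_congr rfl fun k _ => by ring
    rw [this]
    ring
  -- the final time
  have i1 : IntegrableOn (fun x => E (T, x) ^ 2 * dt K u (T, x) ^ 2) Ω :=
    integrableOn_slice (f := fun z => E z ^ 2 * dt K u z ^ 2) hT hb ((hEc.pow 2).mul (hutc.pow 2))
  have i2 : IntegrableOn (fun x => E (T, x) ^ 2 * ∑ k, dx K k u (T, x) ^ 2) Ω :=
    integrableOn_slice (f := fun z => E z ^ 2 * ∑ k, dx K k u z ^ 2) hT hb ((hEc.pow 2).mul hsc)
  have i3 : IntegrableOn (fun x => E (T, x) ^ 2 * u (T, x) ^ 2) Ω :=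
    integrableOn_slice (f := fun z => E z ^ 2 * u z ^ 2) hT hb
      ((hEc.pow 2).mul (hu.continuousOn.pow 2))
  have i12 : IntegrableOn (fun x => h / 8 * (E (T, x) ^ 2 * dt K u (T, x) ^ 2)
      - 2 * h * (E (T, x) ^ 2 * ∑ k, dx K k u (T, x) ^ 2)) Ω :=
    (i1.const_mul _).sub (i2.const_mul _)
  have hfin : h / 8 * (∫ x in Ω, E (T, x) ^ 2 * dt K u (T, x) ^ 2)
        - 2 * h * (∫ x in Ω, E (T, x) ^ 2 * ∑ k, dx K k u (T, x) ^ 2)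
        - (4 * lam * T + 1) * (∫ x in Ω, E (T, x) ^ 2 * u (T, x) ^ 2)
      ≤ ∫ x in Ω, energyDensity K ω lam h v (T, x) := by
    rw [← integral_const_mul, ← integral_const_mul, ← integral_const_mul,
      ← integral_sub (i1.const_mul _) (i2.const_mul _), ← integral_sub i12 (i3.const_mul _)]
    refine setIntegral_mono_on (i12.sub (i3.const_mul _))
      (integrableOn_slice hT hb (contDiffOn_energyDensity hK hv2 ω lam h).continuousOn)
      ho.measurableSet fun x hx => ?_
    have hz := hTK x hx
    set z : SpaceTime n := (T, x) with hzdef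
    set G := ∑ k, ω k * (E z * dx K k u z) with hG
    have hGsq : G ^ 2 ≤ E z ^ 2 * ∑ k, dx K k u z ^ 2 := by
      have := Finset.sum_mul_sq_le_sq_mul_sq Finset.univ (fun k => ω k) fun k => E z * dx K k u z
      rw [hωsq, one_mul] at this
      refine this.trans (le_of_eq ?_)
      rw [Finset.mul_sum]
      exact Finset.sum_congr rfl fun k _ => by ring
    have hlow := energyDensity_lower_bound hT hlam hh hlamh (p := E z * dt K u z)
      (g := E z ^ 2 * ∑ k, dx K k u z ^ 2) (v := v z) hGsq
    have e1 : dt K v z = E z * dt K u z - coeffA lam h T / h * v z := by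
      rw [hvt z hz]; simp only [hv, hzdef]; ring
    have e2 : ∑ k, ω k * dx K k v z = G - 1 / h * v z := by
      have : ∀ k, ω k * dx K k v z = ω k * (E z * dx K k u z) - 1 / h * v z * ω k ^ 2 :=
        fun k => by rw [hvx z hz]; simp only [hv]; ring
      rw [Finset.sum_congr rfl fun k _ => this k, Finset.sum_sub_distrib, ← Finset.mul_sum, hωsq,
        mul_one]
    have e3 : ∑ k, dx K k v z ^ 2
        = E z ^ 2 * ∑ k, dx K k u z ^ 2 - 2 / h * G * v z + 1 / h ^ 2 * v z ^ 2 := by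
      have : ∀ k, dx K k v z ^ 2 = E z ^ 2 * dx K k u z ^ 2
          - 2 / h * v z * (ω k * (E z * dx K k u z)) + 1 / h ^ 2 * v z ^ 2 * ω k ^ 2 :=
        fun k => by rw [hvx z hz]; simp only [hv]; ring
      rw [Finset.sum_congr rfl fun k _ => this k, Finset.sum_add_distrib, Finset.sum_sub_distrib,
        ← Finset.mul_sum, ← Finset.mul_sum, ← Finset.mul_sum, hωsq]
      ring
    rw [energyDensity, e1, e2, e3]
    have e4 : z.1 = T := rfl
    rw [e4]
    refine le_trans (le_of_eq ?_) hlow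
    simp only [hv]
    ring
  -- the interior
  have i4 : IntegrableOn (fun z => E z ^ 2
      * (h ^ 2 * dt K u z ^ 2 + h ^ 2 * ∑ k, dx K k u z ^ 2 + u z ^ 2)) (stCylinder T Ω) :=
    integrableOn_stCylinder hT hb ((hEc.pow 2).mul
      (((continuousOn_const.mul (hutc.pow 2)).add (continuousOn_const.mul hsc)).add
        (hu.continuousOn.pow 2)))
  have i5 : IntegrableOn (fun z => h ^ 2 * (dt K v z ^ 2 + ∑ k, dx K k v z ^ 2) + v z ^ 2)
      (stCylinder T Ω) :=
    integrableOn_stCylinder hT hb ((continuousOn_const.mul ((hvtc.pow 2).add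
      (continuousOn_finsetSum _ fun k _ => (hvxc k).pow 2))).add (hv2.continuousOn.pow 2))
  have hint : lam / 10 * (∫ z in stCylinder T Ω, E z ^ 2
          * (h ^ 2 * dt K u z ^ 2 + h ^ 2 * ∑ k, dx K k u z ^ 2 + u z ^ 2))
      ≤ lam / 2 * (∫ z in stCylinder T Ω,
          (h ^ 2 * (dt K v z ^ 2 + ∑ k, dx K k v z ^ 2) + v z ^ 2)) := by
    rw [← integral_const_mul, ← integral_const_mul]
    refine setIntegral_mono_on (i4.const_mul _) (i5.const_mul _)
      (isOpen_stCylinder ho).measurableSet fun z hz => ?_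
    have hzK := hQK z hz
    have ha : coeffA lam h z.1 ^ 2 ≤ 1 := by
      obtain ⟨ht0, htT⟩ := hz.1
      have h1 : lam * h * z.1 ≤ lam * h * T := by gcongr
      have h2 : h * lam * (6 * T + 1) = 6 * (lam * h * T) + lam * h := by ring
      have h3 : 0 < lam * h := by positivity
      have h4 : 0 < lam * h * z.1 := by positivity
      have h5 : 0 ≤ coeffA lam h z.1 := by rw [coeffA]; linarith
      have h6 : coeffA lam h z.1 ≤ 1 := by rw [coeffA]; linarith
      exact pow_le_one₀ h5 h6
    have e1 : h * (E z * dt K u z) = h * dt K v z + coeffA lam h z.1 * v z := by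
      rw [hvt z hzK]; simp only [hv]; field_simp; ring
    have e2 : ∀ k, h * (E z * dx K k u z) = h * dx K k v z + ω k * v z := fun k => by
      rw [hvx z hzK]; simp only [hv]; field_simp; ring
    have b1 : h ^ 2 * (E z ^ 2 * dt K u z ^ 2) ≤ 2 * (h ^ 2 * dt K v z ^ 2) + 2 * v z ^ 2 := by
      have : h ^ 2 * (E z ^ 2 * dt K u z ^ 2) = (h * dt K v z + coeffA lam h z.1 * v z) ^ 2 := by
        rw [← e1]; ring
      rw [this]
      have h1 := mul_le_mul_of_nonneg_right ha (sq_nonneg (v z))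
      have h2 := sq_nonneg (h * dt K v z - coeffA lam h z.1 * v z)
      linarith [sq_nonneg (h * dt K v z - coeffA lam h z.1 * v z)]
    have b2 : h ^ 2 * (E z ^ 2 * ∑ k, dx K k u z ^ 2)
        ≤ 2 * (h ^ 2 * ∑ k, dx K k v z ^ 2) + 2 * v z ^ 2 := by
      have h1 : ∀ k, h ^ 2 * (E z ^ 2 * dx K k u z ^ 2)
          ≤ 2 * h ^ 2 * dx K k v z ^ 2 + 2 * v z ^ 2 * ω k ^ 2 := fun k => by
        have : h ^ 2 * (E z ^ 2 * dx K k u z ^ 2) = (h * dx K k v z + ω k * v z) ^ 2 := by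
          rw [← e2]; ring
        rw [this]
        linarith [sq_nonneg (h * dx K k v z - ω k * v z)]
      have h2 := Finset.sum_le_sum fun k (_ : k ∈ Finset.univ) => h1 k
      rw [Finset.sum_add_distrib, ← Finset.mul_sum, ← Finset.mul_sum, ← Finset.mul_sum,
        ← Finset.mul_sum, hωsq] at h2
      linarith
    have b3 : E z ^ 2 * u z ^ 2 = v z ^ 2 := by simp only [hv]; ring
    have b4 : 0 ≤ ∑ k, dx K k v z ^ 2 := Finset.sum_nonneg fun k _ => sq_nonneg _
    -- `5 = 2 + 2 + 1` counts the contributions to `v²`; it turns the factor `λ/2` into `λ/10`.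
    have b5 : E z ^ 2 * (h ^ 2 * dt K u z ^ 2 + h ^ 2 * ∑ k, dx K k u z ^ 2 + u z ^ 2)
        ≤ 5 * (h ^ 2 * (dt K v z ^ 2 + ∑ k, dx K k v z ^ 2) + v z ^ 2) := by
      have b6 : 0 ≤ h ^ 2 * ∑ k, dx K k v z ^ 2 := by positivity
      have b7 : 0 ≤ h ^ 2 * dt K v z ^ 2 := by positivity
      linarith
    have b8 := mul_le_mul_of_nonneg_left b5 (show 0 ≤ lam / 10 by positivity)
    linarith
  have hF : ∫ z in stCylinder T Ω, conjWave K ω lam h v z ^ 2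
      = ∫ z in stCylinder T Ω, h ^ 2 * E z ^ 2 * box K u z ^ 2 := by
    refine setIntegral_congr_fun (isOpen_stCylinder ho).measurableSet fun z hz => ?_
    rw [conjWave_convexWeight_mul hK hu hω lam hh.ne' (closure_stCylinder_mem_nhds ho hz)]
    ring
  rw [hF, hlat] at hmain
  linarith

section RealParts

variable {K : Set (SpaceTime n)} {F G : Type*} [NormedAddCommGroup F] [NormedSpace ℝ F]
  [NormedAddCommGroup G] [NormedSpace ℝ G]

theorem fderivWithin_clm_comp (hK : UniqueDiffOn ℝ K) (l : F →L[ℝ] G) {f : SpaceTime n → F}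
    (hf : ContDiffOn ℝ 1 f K) {z : SpaceTime n} (hz : z ∈ K) (d : SpaceTime n) :
    fderivWithin ℝ (fun y => l (f y)) K z d = l (fderivWithin ℝ f K z d) := by
  have h1 := (hf.differentiableOn (by norm_num) z hz).hasFDerivWithinAt
  have h2 := l.hasFDerivAt.comp_hasFDerivWithinAt z h1
  have h3 : fderivWithin ℝ (fun y => l (f y)) K z = _ := h2.fderivWithin (hK z hz)
  rw [h3]
  rfl

theorem dt_clm_comp (hK : UniqueDiffOn ℝ K) (l : F →L[ℝ] G) {f : SpaceTime n → F}
    (hf : ContDiffOn ℝ 1 f K) {z : SpaceTime n} (hz : z ∈ K) :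
    dt K (fun y => l (f y)) z = l (dt K f z) :=
  fderivWithin_clm_comp hK l hf hz _

theorem dx_clm_comp (hK : UniqueDiffOn ℝ K) (l : F →L[ℝ] G) {f : SpaceTime n → F}
    (hf : ContDiffOn ℝ 1 f K) {z : SpaceTime n} (hz : z ∈ K) (j : Fin n) :
    dx K j (fun y => l (f y)) z = l (dx K j f z) :=
  fderivWithin_clm_comp hK l hf hz _

theorem dnu_clm_comp (hK : UniqueDiffOn ℝ K) (l : F →L[ℝ] G) {f : SpaceTime n → F}
    (hf : ContDiffOn ℝ 1 f K) {z : SpaceTime n} (hz : z ∈ K) :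
    dnu K Ω (fun y => l (f y)) z = l (dnu K Ω f z) := by
  simp only [dnu, map_sum, map_smul, dx_clm_comp hK l hf hz]

/-- Used for real and imaginary parts. The estimate is quadratic in `u` and `□` has real
coefficients, so the two real estimates add up to the complex one. -/
theorem box_clm_comp (hK : UniqueDiffOn ℝ K) (l : F →L[ℝ] G) {f : SpaceTime n → F}
    (hf : ContDiffOn ℝ 2 f K) {z : SpaceTime n} (hz : z ∈ K) :
    box K (fun y => l (f y)) z = l (box K f z) := by
  have hf1 : ContDiffOn ℝ 1 f K := hf.of_le (by norm_num)
  have h1 : dt K (dt K fun y => l (f y)) z = l (dt K (dt K f) z) := by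
    rw [← dt_clm_comp hK l (contDiffOn_dt hK hf) hz, dt, dt,
      fderivWithin_congr (fun y hy => dt_clm_comp hK l hf1 hy) (dt_clm_comp hK l hf1 hz)]
  have h2 : ∀ j, dx K j (dx K j fun y => l (f y)) z = l (dx K j (dx K j f) z) := fun j => by
    rw [← dx_clm_comp hK l (contDiffOn_dx hK hf j) hz, dx, dx,
      fderivWithin_congr (fun y hy => dx_clm_comp hK l hf1 hy j) (dx_clm_comp hK l hf1 hz j)]
  simp only [box, h1, h2, map_sub, map_sum]

end RealParts

theorem sq_norm_eq (c : ℂ) : ‖c‖ ^ 2 = Complex.reCLM c ^ 2 + Complex.imCLM c ^ 2 := by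
  rw [Complex.sq_norm, Complex.normSq_apply, Complex.reCLM_apply, Complex.imCLM_apply]
  ring

theorem continuousOn_dnu (hΩ : HasC2Boundary Ω) (ho : IsOpen Ω) (hT : 0 < T)
    {F : Type*} [NormedAddCommGroup F] [NormedSpace ℝ F] {f : SpaceTime n → F}
    (hf : ContDiffOn ℝ 1 f (closure (stCylinder T Ω))) :
    ContinuousOn (dnu (closure (stCylinder T Ω)) Ω f) (Icc 0 T ×ˢ frontier Ω) := by
  have hK := hΩ.uniqueDiffOn_closure_stCylinder ho hT
  have hsub : Icc 0 T ×ˢ frontier Ω ⊆ closure (stCylinder T Ω) := by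
    rw [closure_stCylinder hT]
    exact prod_mono_right frontier_subset_closure
  have h1 : ContinuousOn (fun z : SpaceTime n => outwardNormal Ω z.2) (Icc 0 T ×ˢ frontier Ω) :=
    (hΩ.continuousOn_outwardNormal ho).comp continuous_snd.continuousOn fun z hz => hz.2
  refine continuousOn_finsetSum _ fun j _ => ContinuousOn.smul ?_ ?_
  · exact (EuclideanSpace.proj (𝕜 := ℝ) j).continuous.comp_continuousOn h1
  · exact (continuousOn_fderivWithin_apply hK hf _).mono hsub

theorem continuousOn_inner_outwardNormal (hΩ : HasC2Boundary Ω) (ho : IsOpen Ω) (ω : Space n) :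
    ContinuousOn (fun z : SpaceTime n => ⟪outwardNormal Ω z.2, ω⟫) (Icc 0 T ×ˢ frontier Ω) :=
  ContinuousOn.inner (𝕜 := ℝ)
    ((hΩ.continuousOn_outwardNormal ho).comp continuous_snd.continuousOn fun _ hz => hz.2)
    continuousOn_const

/-- The Carleman estimate for the d'Alembertian and complex-valued functions, with the convexified
weight. -/
theorem carleman_box (hΩ : HasC2Boundary Ω) (ho : IsOpen Ω)
    (hb : Bornology.IsBounded Ω) (hT : 0 < T) {σ : Measure (Space n)} [IsFiniteMeasure σ]
    (hσ : ∀ᵐ x ∂σ, x ∈ frontier Ω)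
    (hdiv : ∀ k : Space n → ℝ, ContDiffOn ℝ 1 k (closure Ω) → ∀ a : Space n,
        ∫ x in Ω, fderiv ℝ k x a = ∫ x, k x * ⟪outwardNormal Ω x, a⟫ ∂σ)
    {ω : Space n} (hω : ‖ω‖ = 1) {lam h : ℝ} (hlam : 0 < lam) (hh : 0 < h) (hh1 : h ≤ 1)
    (hlamh : h * lam * (6 * T + 1) ≤ 1) {K : Set (SpaceTime n)} (hKdef : K = closure (stCylinder T Ω))
    {u : SpaceTime n → ℂ} (hu : ContDiffOn ℝ 2 u K) (h0 : ∀ z ∈ lateral T Ω, u z = 0)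
    (hi : ∀ x ∈ Ω, u (0, x) = 0) (hit : ∀ x ∈ Ω, dt K u (0, x) = 0) :
    h / 8 * (∫ x in Ω, convexWeight ω lam h (T, x) ^ 2 * ‖dt K u (T, x)‖ ^ 2)
      + h / 2 * (∫ z, ⟪outwardNormal Ω z.2, ω⟫ * (convexWeight ω lam h z ^ 2 * ‖dnu K Ω u z‖ ^ 2)
          ∂((volume.restrict (Ioo 0 T)).prod σ))
      + lam / 10 * (∫ z in stCylinder T Ω, convexWeight ω lam h z ^ 2
          * (h ^ 2 * ‖dt K u z‖ ^ 2 + h ^ 2 * gradSq K u z + ‖u z‖ ^ 2))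
      ≤ 1 / 8 * (∫ z in stCylinder T Ω, h ^ 2 * convexWeight ω lam h z ^ 2 * ‖box K u z‖ ^ 2)
        + 2 * h * (∫ x in Ω, convexWeight ω lam h (T, x) ^ 2 * gradSq K u (T, x))
        + (4 * lam * T + 1) * (∫ x in Ω, convexWeight ω lam h (T, x) ^ 2 * ‖u (T, x)‖ ^ 2) := by
  subst hKdef
  set K := closure (stCylinder T Ω) with hKdef
  have hK : UniqueDiffOn ℝ K := hΩ.uniqueDiffOn_closure_stCylinder ho hT
  have hu1 : ContDiffOn ℝ 1 u K := hu.of_le (by norm_num)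
  set E := convexWeight ω lam h with hE
  have h0K : ∀ x ∈ Ω, ((0, x) : SpaceTime n) ∈ K := fun x hx => by
    rw [hKdef, closure_stCylinder hT]; exact ⟨left_mem_Icc.2 hT.le, subset_closure hx⟩
  have hTK : ∀ x ∈ Ω, ((T, x) : SpaceTime n) ∈ K := fun x hx => by
    rw [hKdef, closure_stCylinder hT]; exact ⟨right_mem_Icc.2 hT.le, subset_closure hx⟩
  have hlK : ∀ z ∈ lateral T Ω, z ∈ K := fun z hz => by
    rw [hKdef, closure_stCylinder hT]
    exact ⟨Ioo_subset_Icc_self hz.1, frontier_subset_closure hz.2⟩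
  have hQm : MeasurableSet (stCylinder T Ω) := (isOpen_stCylinder ho).measurableSet
  -- the estimate for the image of `u` under a real linear map
  set ul : (ℂ →L[ℝ] ℝ) → SpaceTime n → ℝ := fun l y => l (u y) with hul
  have hul2 : ∀ l, ContDiffOn ℝ 2 (ul l) K := fun l => l.contDiff.comp_contDiffOn hu
  have hest := fun l : ℂ →L[ℝ] ℝ => carleman_box_real hΩ ho hb hT hσ hdiv hω hlam hh hh1 hlamh
    hKdef (hul2 l) (fun z hz => by simp [hul, h0 z hz]) (fun x hx => by simp [hul, hi x hx])
    (fun x hx => by rw [hul, dt_clm_comp hK l hu1 (h0K x hx), hit x hx, map_zero])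
  -- continuity of the integrands
  have hEc : ContinuousOn E K := continuousOn_convexWeight ω lam h K
  have hEc2 := hEc.pow 2
  have c1 := fun l => (contDiffOn_dt hK (hul2 l)).continuousOn
  have c2 := fun l j => (contDiffOn_dx hK (hul2 l) j).continuousOn
  have c3 := fun l => (hul2 l).continuousOn
  have c4 := fun l => continuousOn_box hK (hul2 l)
  have c5 : ∀ l, ContinuousOn (fun z => ∑ k, dx K k (ul l) z ^ 2) K := fun l =>
    continuousOn_finsetSum _ fun k _ => (c2 l k).pow 2
  have i1 : ∀ l, IntegrableOn (fun x => E (T, x) ^ 2 * dt K (ul l) (T, x) ^ 2) Ω := fun l =>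
    integrableOn_slice (f := fun z => E z ^ 2 * dt K (ul l) z ^ 2) hT hb (hEc2.mul ((c1 l).pow 2))
  have i2 : ∀ l, IntegrableOn (fun x => E (T, x) ^ 2 * ∑ k, dx K k (ul l) (T, x) ^ 2) Ω :=
    fun l => integrableOn_slice (f := fun z => E z ^ 2 * ∑ k, dx K k (ul l) z ^ 2) hT hb
      (hEc2.mul (c5 l))
  have i3 : ∀ l, IntegrableOn (fun x => E (T, x) ^ 2 * ul l (T, x) ^ 2) Ω := fun l =>
    integrableOn_slice (f := fun z => E z ^ 2 * ul l z ^ 2) hT hb (hEc2.mul ((c3 l).pow 2))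
  have i4 : ∀ l, IntegrableOn (fun z => E z ^ 2 * (h ^ 2 * dt K (ul l) z ^ 2
      + h ^ 2 * ∑ k, dx K k (ul l) z ^ 2 + ul l z ^ 2)) (stCylinder T Ω) := fun l =>
    integrableOn_stCylinder hT hb (hEc2.mul (((continuousOn_const.mul ((c1 l).pow 2)).add
      (continuousOn_const.mul (c5 l))).add ((c3 l).pow 2)))
  have i5 : ∀ l, IntegrableOn (fun z => h ^ 2 * E z ^ 2 * box K (ul l) z ^ 2)
      (stCylinder T Ω) := fun l =>
    integrableOn_stCylinder hT hb ((continuousOn_const.mul hEc2).mul ((c4 l).pow 2))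
  have i6 : ∀ l, Integrable (fun z => ⟪outwardNormal Ω z.2, ω⟫ * (E z ^ 2 * dnu K Ω (ul l) z ^ 2))
      ((volume.restrict (Ioo 0 T)).prod σ) := fun l => by
    refine integrable_lateral hb hσ ((continuousOn_inner_outwardNormal hΩ ho ω).mul
      (((continuousOn_convexWeight ω lam h _).pow 2).mul
        ((continuousOn_dnu hΩ ho hT ((hul2 l).of_le (by norm_num))).pow 2)))
  have hre := hest Complex.reCLM
  have him := hest Complex.imCLM
  have s1 : ∫ x in Ω, E (T, x) ^ 2 * ‖dt K u (T, x)‖ ^ 2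
      = (∫ x in Ω, E (T, x) ^ 2 * dt K (ul Complex.reCLM) (T, x) ^ 2)
        + ∫ x in Ω, E (T, x) ^ 2 * dt K (ul Complex.imCLM) (T, x) ^ 2 := by
    rw [← integral_add (i1 _) (i1 _)]
    refine setIntegral_congr_fun ho.measurableSet fun x hx => ?_
    simp only [hul, dt_clm_comp hK _ hu1 (hTK x hx), sq_norm_eq]
    ring
  have hgrad : ∀ z ∈ K, gradSq K u z = ∑ k, dx K k (ul Complex.reCLM) z ^ 2
      + ∑ k, dx K k (ul Complex.imCLM) z ^ 2 := fun z hz => by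
    simp only [gradSq, hul, dx_clm_comp hK _ hu1 hz, sq_norm_eq, Finset.sum_add_distrib]
  have s2 : ∫ x in Ω, E (T, x) ^ 2 * gradSq K u (T, x)
      = (∫ x in Ω, E (T, x) ^ 2 * ∑ k, dx K k (ul Complex.reCLM) (T, x) ^ 2)
        + ∫ x in Ω, E (T, x) ^ 2 * ∑ k, dx K k (ul Complex.imCLM) (T, x) ^ 2 := by
    rw [← integral_add (i2 _) (i2 _)]
    refine setIntegral_congr_fun ho.measurableSet fun x hx => ?_
    simp only [hgrad _ (hTK x hx)]
    ring
  have s3 : ∫ x in Ω, E (T, x) ^ 2 * ‖u (T, x)‖ ^ 2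
      = (∫ x in Ω, E (T, x) ^ 2 * ul Complex.reCLM (T, x) ^ 2)
        + ∫ x in Ω, E (T, x) ^ 2 * ul Complex.imCLM (T, x) ^ 2 := by
    rw [← integral_add (i3 _) (i3 _)]
    refine setIntegral_congr_fun ho.measurableSet fun x hx => ?_
    simp only [hul, sq_norm_eq]
    ring
  have s4 : ∫ z in stCylinder T Ω, E z ^ 2
          * (h ^ 2 * ‖dt K u z‖ ^ 2 + h ^ 2 * gradSq K u z + ‖u z‖ ^ 2)
      = (∫ z in stCylinder T Ω, E z ^ 2 * (h ^ 2 * dt K (ul Complex.reCLM) z ^ 2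
          + h ^ 2 * ∑ k, dx K k (ul Complex.reCLM) z ^ 2 + ul Complex.reCLM z ^ 2))
        + ∫ z in stCylinder T Ω, E z ^ 2 * (h ^ 2 * dt K (ul Complex.imCLM) z ^ 2
          + h ^ 2 * ∑ k, dx K k (ul Complex.imCLM) z ^ 2 + ul Complex.imCLM z ^ 2) := by
    rw [← integral_add (i4 _) (i4 _)]
    refine setIntegral_congr_fun hQm fun z hz => ?_
    have hzK : z ∈ K := subset_closure hz
    simp only [hgrad z hzK]
    simp only [hul, dt_clm_comp hK _ hu1 hzK, sq_norm_eq]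
    ring
  have s5 : ∫ z in stCylinder T Ω, h ^ 2 * E z ^ 2 * ‖box K u z‖ ^ 2
      = (∫ z in stCylinder T Ω, h ^ 2 * E z ^ 2 * box K (ul Complex.reCLM) z ^ 2)
        + ∫ z in stCylinder T Ω, h ^ 2 * E z ^ 2 * box K (ul Complex.imCLM) z ^ 2 := by
    rw [← integral_add (i5 _) (i5 _)]
    refine setIntegral_congr_fun hQm fun z hz => ?_
    simp only [hul, box_clm_comp hK _ hu (subset_closure hz), sq_norm_eq]
    ring
  have s6 : ∫ z, ⟪outwardNormal Ω z.2, ω⟫ * (E z ^ 2 * ‖dnu K Ω u z‖ ^ 2)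
          ∂((volume.restrict (Ioo 0 T)).prod σ)
      = (∫ z, ⟪outwardNormal Ω z.2, ω⟫ * (E z ^ 2 * dnu K Ω (ul Complex.reCLM) z ^ 2)
          ∂((volume.restrict (Ioo 0 T)).prod σ))
        + ∫ z, ⟪outwardNormal Ω z.2, ω⟫ * (E z ^ 2 * dnu K Ω (ul Complex.imCLM) z ^ 2)
          ∂((volume.restrict (Ioo 0 T)).prod σ) := by
    rw [← integral_add (i6 _) (i6 _)]
    refine integral_congr_ae ?_
    filter_upwards [ae_mem_lateral (T := T) hσ] with z hz
    simp only [hul, dnu_clm_comp hK _ hu1 (hlK z hz), sq_norm_eq]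
    ring
  rw [s1, s2, s3, s4, s5, s6]
  linarith

/-! ### The magnetic and electric terms as a lower order perturbation. -/

/-- The lower order terms of `𝓛_{𝒜,q} - q` relative to the d'Alembertian. -/
noncomputable def lowerOrder (K : Set (SpaceTime n)) (A₀ : SpaceTime n → ℝ)
    (A : Fin n → SpaceTime n → ℝ) (u : SpaceTime n → ℂ) (z : SpaceTime n) : ℂ :=
  (2 * A₀ z * dt K u z + (dt K A₀ z + A₀ z ^ 2 : ℝ) * u z)
    - ∑ j, (2 * A j z * dx K j u z + (dx K j (A j) z + A j z ^ 2 : ℝ) * u z)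

theorem fderivWithin_covariant {K : Set (SpaceTime n)} {a : SpaceTime n → ℝ}
    (ha : ContDiffOn ℝ 1 a K) {u f : SpaceTime n → ℂ} (hu : ContDiffOn ℝ 1 u K)
    (hf : ContDiffOn ℝ 1 f K) {z : SpaceTime n} (hz : K ∈ 𝓝 z) (d : SpaceTime n) :
    fderivWithin ℝ (fun y => f y + (a y : ℂ) * u y) K z d
      = fderivWithin ℝ f K z d + ((fderivWithin ℝ a K z d : ℝ) * u z
        + a z * fderivWithin ℝ u K z d) := by
  have hac : ContDiffOn ℝ 1 (fun y => (a y : ℂ)) K :=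
    Complex.ofRealCLM.contDiff.comp_contDiffOn ha
  refine (hasDerivAt_line (hf.add (hac.mul hu)) hz d).unique ?_
  have h1 := (hasDerivAt_line hf hz d).add
    ((hasDerivAt_line ha hz d).ofReal_comp.mul (hasDerivAt_line hu hz d))
  refine HasDerivAt.congr_deriv h1 ?_
  simp only [zero_smul, add_zero]

/-- Each square expands as `(∂ + a)² = ∂² + 2a∂ + (∂a + a²)`. -/
theorem waveOp_eq {K : Set (SpaceTime n)} (hK : UniqueDiffOn ℝ K) {A₀ : SpaceTime n → ℝ}
    {A : Fin n → SpaceTime n → ℝ} (hA₀ : ContDiffOn ℝ 1 A₀ K) (hA : ∀ j, ContDiffOn ℝ 1 (A j) K)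
    (q : SpaceTime n → ℂ) {u : SpaceTime n → ℂ} (hu : ContDiffOn ℝ 2 u K) {z : SpaceTime n}
    (hz : K ∈ 𝓝 z) :
    waveOp K A₀ A q u z = box K u z + lowerOrder K A₀ A u z + q z * u z := by
  have hu1 : ContDiffOn ℝ 1 u K := hu.of_le (by norm_num)
  have h1 : covDt K A₀ (covDt K A₀ u) z = dt K (dt K u) z
      + (2 * A₀ z * dt K u z + (dt K A₀ z + A₀ z ^ 2 : ℝ) * u z) := by
    have := fderivWithin_covariant hA₀ hu1 (contDiffOn_dt hK hu) hz (1, 0)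
    have e : dt K (covDt K A₀ u) z = _ := this
    rw [covDt, e]
    simp only [covDt, dt]
    push_cast
    ring
  have h2 : ∀ j, covDx K j (A j) (covDx K j (A j) u) z = dx K j (dx K j u) z
      + (2 * A j z * dx K j u z + (dx K j (A j) z + A j z ^ 2 : ℝ) * u z) := fun j => by
    have := fderivWithin_covariant (hA j) hu1 (contDiffOn_dx hK hu j) hz
      (0, EuclideanSpace.single j 1)
    have e : dx K j (covDx K j (A j) u) z = _ := this
    rw [covDx, e]
    simp only [covDx, dx]
    push_cast
    ring
  rw [waveOp, h1, Finset.sum_congr rfl fun j _ => h2 j, Finset.sum_add_distrib, box, lowerOrder]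
  ring

theorem continuousOn_lowerOrder {K : Set (SpaceTime n)} (hK : UniqueDiffOn ℝ K)
    {A₀ : SpaceTime n → ℝ} {A : Fin n → SpaceTime n → ℝ} (hA₀ : ContDiffOn ℝ 1 A₀ K)
    (hA : ∀ j, ContDiffOn ℝ 1 (A j) K) {u : SpaceTime n → ℂ} (hu : ContDiffOn ℝ 2 u K) :
    ContinuousOn (lowerOrder K A₀ A u) K := by
  have hcast : ∀ {f : SpaceTime n → ℝ}, ContinuousOn f K → ContinuousOn (fun z => (f z : ℂ)) K :=
    fun hf => Complex.continuous_ofReal.comp_continuousOn hf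
  have h1 := (contDiffOn_dt hK hu).continuousOn
  have h2 := fun j => (contDiffOn_dx hK hu j).continuousOn
  have h3 := hu.continuousOn
  have h4 : ContinuousOn (dt K A₀) K := continuousOn_fderivWithin_apply hK hA₀ _
  have h5 : ∀ j, ContinuousOn (dx K j (A j)) K := fun j =>
    continuousOn_fderivWithin_apply hK (hA j) _
  refine ContinuousOn.sub (ContinuousOn.add ?_ ?_) (continuousOn_finsetSum _ fun j _ =>
    ContinuousOn.add ?_ ?_)
  · exact (continuousOn_const.mul (hcast hA₀.continuousOn)).mul h1
  · exact (hcast (h4.add (hA₀.continuousOn.pow 2))).mul h3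
  · exact (continuousOn_const.mul (hcast (hA j).continuousOn)).mul (h2 j)
  · exact (hcast ((h5 j).add ((hA j).continuousOn.pow 2))).mul h3

/-- The lower order terms are controlled by the first order norm of `u`. -/
theorem exists_lowerOrder_bound {K : Set (SpaceTime n)} (hK : UniqueDiffOn ℝ K)
    (hKc : IsCompact K) {A₀ : SpaceTime n → ℝ} {A : Fin n → SpaceTime n → ℝ}
    (hA₀ : ContDiffOn ℝ 1 A₀ K) (hA : ∀ j, ContDiffOn ℝ 1 (A j) K) :
    ∃ M : ℝ, 0 ≤ M ∧ ∀ (u : SpaceTime n → ℂ), ∀ z ∈ K,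
      ‖lowerOrder K A₀ A u z‖ ≤ M * (‖dt K u z‖ + ∑ j, ‖dx K j u z‖ + ‖u z‖) := by
  have h4 : ContinuousOn (dt K A₀) K := continuousOn_fderivWithin_apply hK hA₀ _
  have h5 : ∀ j, ContinuousOn (dx K j (A j)) K := fun j =>
    continuousOn_fderivWithin_apply hK (hA j) _
  obtain ⟨B₁, hB₁⟩ := hKc.exists_bound_of_continuousOn hA₀.continuousOn
  obtain ⟨B₂, hB₂⟩ := hKc.exists_bound_of_continuousOn (h4.add (hA₀.continuousOn.pow 2))
  choose B₃ hB₃ using fun j => hKc.exists_bound_of_continuousOn (hA j).continuousOn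
  choose B₄ hB₄ using fun j =>
    hKc.exists_bound_of_continuousOn ((h5 j).add ((hA j).continuousOn.pow 2))
  refine ⟨2 * |B₁| + |B₂| + ∑ j, (2 * |B₃ j| + |B₄ j|), by positivity, fun u z hz => ?_⟩
  set p := ‖dt K u z‖
  set g := ∑ j, ‖dx K j u z‖
  have hg : ∀ j, ‖dx K j u z‖ ≤ g := fun j =>
    Finset.single_le_sum (f := fun j => ‖dx K j u z‖) (fun _ _ => norm_nonneg _)
      (Finset.mem_univ j)
  have hg0 : 0 ≤ g := Finset.sum_nonneg fun _ _ => norm_nonneg _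
  have key : ∀ (α β b c : ℝ) (x : ℂ), |α| ≤ b → |β| ≤ c → ‖x‖ ≤ p + g + ‖u z‖ →
      ‖2 * (α : ℂ) * x + (β : ℂ) * u z‖ ≤ (2 * |b| + |c|) * (p + g + ‖u z‖) := by
    intro α β b c x hα hβ hx
    have h1 : ‖u z‖ ≤ p + g + ‖u z‖ := by linarith [norm_nonneg (dt K u z)]
    have h2 : ‖2 * (α : ℂ) * x‖ = 2 * |α| * ‖x‖ := by
      rw [norm_mul, norm_mul, Complex.norm_real, Real.norm_eq_abs, Complex.norm_ofNat]
    have h3 : ‖(β : ℂ) * u z‖ = |β| * ‖u z‖ := by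
      rw [norm_mul, Complex.norm_real, Real.norm_eq_abs]
    refine (norm_add_le _ _).trans ?_
    rw [h2, h3, add_mul]
    have h4 := hα.trans (le_abs_self b)
    have h5 := hβ.trans (le_abs_self c)
    gcongr
  have k1 := key (A₀ z) (dt K A₀ z + A₀ z ^ 2) B₁ B₂ (dt K u z) (hB₁ z hz) (hB₂ z hz)
    (by linarith [norm_nonneg (u z)])
  have k2 := fun j => key (A j z) (dx K j (A j) z + A j z ^ 2) (B₃ j) (B₄ j) (dx K j u z)
    (hB₃ j z hz) (hB₄ j z hz) (by linarith [norm_nonneg (u z), hg j, norm_nonneg (dt K u z)])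
  rw [lowerOrder]
  refine (norm_sub_le _ _).trans ?_
  rw [add_mul, Finset.sum_mul]
  exact add_le_add k1 ((norm_sum_le _ _).trans (Finset.sum_le_sum fun j _ => k2 j))

/-- Cauchy–Schwarz twice: over the three groups, then over the `n` coordinates. -/
theorem sq_add_sum_add_le (p : ℝ) (x : Fin n → ℝ) (u : ℝ) :
    (p + ∑ j, x j + u) ^ 2 ≤ 3 * (n + 1) * (p ^ 2 + ∑ j, x j ^ 2 + u ^ 2) := by
  have h1 : (∑ j, x j) ^ 2 ≤ n * ∑ j, x j ^ 2 := by
    simpa using sq_sum_le_card_mul_sum_sq (s := Finset.univ) (f := x)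
  have h2 : 0 ≤ ∑ j, x j ^ 2 := Finset.sum_nonneg fun _ _ => sq_nonneg _
  set s := ∑ j, x j
  set r := ∑ j, x j ^ 2
  have h3 : (p + s + u) ^ 2 ≤ 3 * (p ^ 2 + s ^ 2 + u ^ 2) := by
    linarith [sq_nonneg (p - s), sq_nonneg (p - u), sq_nonneg (s - u)]
  have h4 : 0 ≤ (n : ℝ) * (p ^ 2 + u ^ 2) := by positivity
  linarith

/-- The d'Alembertian is controlled by `𝓛_{𝒜,q}` and the first order norm. -/
theorem exists_box_bound (hΩ : HasC2Boundary Ω) (ho : IsOpen Ω) (hb : Bornology.IsBounded Ω)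
    (hT : 0 < T) {A₀ : SpaceTime n → ℝ} {A : Fin n → SpaceTime n → ℝ}
    (hA₀ : ContDiff ℝ 1 A₀) (hA : ∀ j, ContDiff ℝ 1 (A j)) {q : SpaceTime n → ℂ}
    (hq : MemLp q ⊤ (volume.restrict (stCylinder T Ω))) {K : Set (SpaceTime n)}
    (hKdef : K = closure (stCylinder T Ω)) :
    ∃ N : ℝ, 0 ≤ N ∧ ∀ u : SpaceTime n → ℂ, ContDiffOn ℝ 2 u K →
      (∀ᵐ z ∂(volume.restrict (stCylinder T Ω)), ‖box K u z‖ ^ 2 ≤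
        2 * ‖waveOp K A₀ A q u z‖ ^ 2 + N * (‖dt K u z‖ ^ 2 + gradSq K u z + ‖u z‖ ^ 2)) ∧
      ∀ w : SpaceTime n → ℝ, ContinuousOn w K →
        IntegrableOn (fun z => w z * ‖waveOp K A₀ A q u z‖ ^ 2) (stCylinder T Ω) := by
  subst hKdef
  set K := closure (stCylinder T Ω) with hKdef
  have hK : UniqueDiffOn ℝ K := hΩ.uniqueDiffOn_closure_stCylinder ho hT
  have hKc : IsCompact K := isCompact_closure_stCylinder hT hb
  obtain ⟨M, hM0, hM⟩ := exists_lowerOrder_bound hK hKc hA₀.contDiffOn fun j => (hA j).contDiffOn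
  have hQm : MeasurableSet (stCylinder T Ω) := (isOpen_stCylinder ho).measurableSet
  set Bq : ℝ := (eLpNormEssSup q (volume.restrict (stCylinder T Ω))).toReal with hBq
  have hBq0 : 0 ≤ Bq := ENNReal.toReal_nonneg
  have hqb : ∀ᵐ z ∂(volume.restrict (stCylinder T Ω)), ‖q z‖ ≤ Bq := by
    have hfin : eLpNormEssSup q (volume.restrict (stCylinder T Ω)) ≠ ⊤ := by
      have := hq.2.ne
      rwa [eLpNorm_exponent_top] at this
    filter_upwards [ae_le_eLpNormEssSup (f := q) (μ := volume.restrict (stCylinder T Ω))] with z hz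
    have := ENNReal.toReal_mono hfin hz
    simpa using this
  -- The `2` comes from `(x + y)² ≤ 2x² + 2y²`, the `3(n + 1)` from `sq_add_sum_add_le`.
  refine ⟨2 * ((M + Bq) ^ 2 * (3 * (n + 1))), by positivity, fun u hu => ⟨?_, fun w hw => ?_⟩⟩
  · filter_upwards [hqb, ae_restrict_mem hQm] with z hqz hz
    have hzK : z ∈ K := subset_closure hz
    have e := waveOp_eq hK hA₀.contDiffOn (fun j => (hA j).contDiffOn) q hu
      (closure_stCylinder_mem_nhds ho hz)
    have hbox : box K u z = waveOp K A₀ A q u z - (lowerOrder K A₀ A u z + q z * u z) := by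
      rw [e]; ring
    set R := ‖dt K u z‖ + ∑ j, ‖dx K j u z‖ + ‖u z‖ with hR
    have hR0 : 0 ≤ R := by positivity
    have hlow : ‖lowerOrder K A₀ A u z + q z * u z‖ ≤ (M + Bq) * R := by
      refine (norm_add_le _ _).trans ?_
      rw [add_mul, norm_mul]
      refine add_le_add (hM u z hzK) (mul_le_mul hqz ?_ (norm_nonneg _) hBq0)
      rw [hR]
      have : 0 ≤ ‖dt K u z‖ + ∑ j, ‖dx K j u z‖ := by positivity
      linarith
    have hRsq := sq_add_sum_add_le ‖dt K u z‖ (fun j => ‖dx K j u z‖) ‖u z‖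
    have h1 : ‖box K u z‖ ≤ ‖waveOp K A₀ A q u z‖ + (M + Bq) * R := by
      rw [hbox]
      exact (norm_sub_le _ _).trans (by gcongr)
    have h2 : ‖box K u z‖ ^ 2 ≤ (‖waveOp K A₀ A q u z‖ + (M + Bq) * R) ^ 2 := by gcongr
    have h3 : (M + Bq) ^ 2 * R ^ 2
        ≤ (M + Bq) ^ 2 * (3 * (n + 1) * (‖dt K u z‖ ^ 2 + gradSq K u z + ‖u z‖ ^ 2)) := by
      gcongr
      exact hRsq
    linarith [sq_nonneg (‖waveOp K A₀ A q u z‖ - (M + Bq) * R)]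
  · have hcont : ContinuousOn (fun z => box K u z + lowerOrder K A₀ A u z) K :=
      (continuousOn_box hK hu).add (continuousOn_lowerOrder hK hA₀.contDiffOn
        (fun j => (hA j).contDiffOn) hu)
    have hmeas : ∀ {F : Type} [NormedAddCommGroup F] [SecondCountableTopology F]
        {f : SpaceTime n → F}, ContinuousOn f K →
        AEStronglyMeasurable f (volume.restrict (stCylinder T Ω)) := fun hf =>
      (hf.mono subset_closure).aestronglyMeasurable hQm
    obtain ⟨b₁, hb₁⟩ := hKc.exists_bound_of_continuousOn hcont
    obtain ⟨b₂, hb₂⟩ := hKc.exists_bound_of_continuousOn hu.continuousOn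
    obtain ⟨b₃, hb₃⟩ := hKc.exists_bound_of_continuousOn hw
    have heq : ∀ z ∈ stCylinder T Ω, waveOp K A₀ A q u z
        = (box K u z + lowerOrder K A₀ A u z) + q z * u z := fun z hz =>
      waveOp_eq hK hA₀.contDiffOn (fun j => (hA j).contDiffOn) q hu
        (closure_stCylinder_mem_nhds ho hz)
    -- `q` is only essentially bounded, so integrability comes from measurability and an almost
    -- everywhere bound instead of continuity.
    have hWm : AEStronglyMeasurable (waveOp K A₀ A q u) (volume.restrict (stCylinder T Ω)) := by
      refine ((hmeas hcont).add (hq.1.mul (hmeas hu.continuousOn))).congr ?_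
      filter_upwards [ae_restrict_mem hQm] with z hz
      exact (heq z hz).symm
    have hfin : (volume : Measure (SpaceTime n)) (stCylinder T Ω) < ⊤ :=
      lt_of_le_of_lt (measure_mono subset_closure) hKc.measure_lt_top
    have : IsFiniteMeasure ((volume : Measure (SpaceTime n)).restrict (stCylinder T Ω)) :=
      ⟨by rwa [Measure.restrict_apply_univ]⟩
    refine Integrable.of_bound ((hmeas hw).mul (hWm.norm.pow 2))
      (|b₃| * (|b₁| + Bq * |b₂|) ^ 2) ?_
    filter_upwards [hqb, ae_restrict_mem hQm] with z hqz hz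
    have hzK : z ∈ K := subset_closure hz
    rw [norm_mul, norm_pow, norm_norm, heq z hz]
    have h1 : ‖box K u z + lowerOrder K A₀ A u z + q z * u z‖ ≤ |b₁| + Bq * |b₂| := by
      refine (norm_add_le _ _).trans ?_
      rw [norm_mul]
      have := (hb₁ z hzK).trans (le_abs_self _)
      have := (hb₂ z hzK).trans (le_abs_self _)
      gcongr
    have h2 := (hb₃ z hzK).trans (le_abs_self _)
    gcongr

/-! ### Comparison of lateral integrals and of the two weights. -/

theorem dnu_phase (hΩ : HasC2Boundary Ω) (ho : IsOpen Ω) (hT : 0 < T) (ω : Space n)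
    {z : SpaceTime n} (hz : z ∈ lateral T Ω) :
    dnu (closure (stCylinder T Ω)) Ω (phase ω) z = ⟪outwardNormal Ω z.2, ω⟫ := by
  have hzK : z ∈ closure (stCylinder T Ω) := by
    rw [closure_stCylinder hT]
    exact ⟨Ioo_subset_Icc_self hz.1, frontier_subset_closure hz.2⟩
  have h1 : HasFDerivAt (phase ω) (ContinuousLinearMap.fst ℝ ℝ (Space n)
      + (innerSL ℝ ω).comp (ContinuousLinearMap.snd ℝ ℝ (Space n))) z := by
    have e : phase ω = fun z => (ContinuousLinearMap.fst ℝ ℝ (Space n)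
      + (innerSL ℝ ω).comp (ContinuousLinearMap.snd ℝ ℝ (Space n))) z := by
      ext z; simp [phase, real_inner_comm]
    rw [e]
    exact ContinuousLinearMap.hasFDerivAt _
  have h2 := h1.hasFDerivWithinAt.fderivWithin
    (hΩ.uniqueDiffOn_closure_stCylinder ho hT z hzK)
  simp only [dnu, dx, h2]
  rw [inner_eq_sum]
  refine Finset.sum_congr rfl fun j _ => ?_
  simp [EuclideanSpace.inner_single_right, mul_comm]

/-- Gives measurability of the two parts of `∂Ω`, with `s = [0, ∞)` and `s = (-∞, 0]`. -/
theorem isClosed_frontier_inter (hΩ : HasC2Boundary Ω) (ho : IsOpen Ω) (ω : Space n)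
    {s : Set ℝ} (hs : IsClosed s) :
    IsClosed {x ∈ frontier Ω | ⟪outwardNormal Ω x, ω⟫ ∈ s} := by
  have h : ContinuousOn (fun x => ⟪outwardNormal Ω x, ω⟫) (frontier Ω) :=
    ContinuousOn.inner (𝕜 := ℝ) (hΩ.continuousOn_outwardNormal ho) continuousOn_const
  exact h.preimage_isClosed_of_isClosed isClosed_frontier hs

/-- An integral over a part of the lateral boundary as an integral over the whole of it. -/
theorem setIntegral_lateral_eq [SFinite (surfaceMeasure Ω)] {P : Set (Space n)}
    (hP : MeasurableSet P) {f g : SpaceTime n → ℝ}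
    (hfg : ∀ z ∈ lateral T Ω, (z.2 ∈ P → f z = g z) ∧ (z.2 ∉ P → g z = 0)) :
    ∫ z in Ioo 0 T ×ˢ P, f z ∂(lateralMeasure Ω)
      = ∫ z, g z ∂((volume.restrict (Ioo 0 T)).prod (surfaceMeasure Ω)) := by
  have hσ : ∀ᵐ x ∂(surfaceMeasure Ω), x ∈ frontier Ω :=
    ae_restrict_mem isClosed_frontier.measurableSet
  have h1 : (lateralMeasure Ω).restrict (Ioo 0 T ×ˢ P)
      = ((volume.restrict (Ioo 0 T)).prod (surfaceMeasure Ω)).restrict (univ ×ˢ P) := by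
    rw [← Measure.prod_restrict, Measure.restrict_univ, Measure.prod_restrict]
    rfl
  rw [h1, ← integral_indicator (MeasurableSet.univ.prod hP)]
  refine integral_congr_ae ?_
  filter_upwards [ae_mem_lateral (T := T) hσ] with z hz
  by_cases hzP : z.2 ∈ P
  · rw [indicator_of_mem (show z ∈ univ ×ˢ P from ⟨mem_univ _, hzP⟩), (hfg z hz).1 hzP]
  · rw [indicator_of_notMem (fun h : z ∈ univ ×ˢ P => hzP h.2), (hfg z hz).2 hzP]

/-- Comparable boundary measures give comparable integrals over the lateral boundary. -/
theorem integral_lateral_le (hb : Bornology.IsBounded Ω) {σ σ' : Measure (Space n)}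
    [IsFiniteMeasure σ] [IsFiniteMeasure σ'] {C : NNReal} (hle : σ ≤ C • σ')
    (hσ' : ∀ᵐ x ∂σ', x ∈ frontier Ω) {f : SpaceTime n → ℝ}
    (hf : ContinuousOn f (Icc 0 T ×ˢ frontier Ω)) (hf0 : ∀ z ∈ lateral T Ω, 0 ≤ f z) :
    ∫ z, f z ∂((volume.restrict (Ioo 0 T)).prod σ)
      ≤ C * ∫ z, f z ∂((volume.restrict (Ioo 0 T)).prod σ') := by
  have h1 : (volume.restrict (Ioo (0 : ℝ) T)).prod σ
      ≤ C • (volume.restrict (Ioo 0 T)).prod σ' := by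
    have := Measure.prod_mono (le_refl (volume.restrict (Ioo (0 : ℝ) T))) hle
    rwa [Measure.prod_smul_right] at this
  have h2 := integrable_lateral (T := T) hb hσ' hf
  have h3 : Integrable f (C • (volume.restrict (Ioo 0 T)).prod σ') := h2.smul_measure_nnreal
  have h4 : ∀ᵐ z ∂(C • (volume.restrict (Ioo 0 T)).prod σ'), 0 ≤ f z := by
    refine Measure.ae_smul_measure ?_ _
    filter_upwards [ae_mem_lateral (T := T) hσ'] with z hz using hf0 z hz
  have h5 := integral_mono_measure h1 h4 h3
  rwa [integral_smul_nnreal_measure, NNReal.smul_def, smul_eq_mul] at h5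

/-- The extra factor does not involve `h`, which is why the convexification costs only a constant.
-/
theorem convexWeight_sq (ω : Space n) (lam h : ℝ) (z : SpaceTime n) :
    convexWeight ω lam h z ^ 2 = Real.exp (lam * z.1 ^ 2) * weight ω h z ^ 2 := by
  rw [convexWeight, weight, ← Real.exp_nat_mul, ← Real.exp_nat_mul, ← Real.exp_add]
  congr 1
  push_cast
  ring

theorem weight_sq_le (ω : Space n) {lam : ℝ} (hlam : 0 ≤ lam) (h : ℝ) (z : SpaceTime n) :
    weight ω h z ^ 2 ≤ convexWeight ω lam h z ^ 2 := by
  rw [convexWeight_sq]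
  exact le_mul_of_one_le_left (sq_nonneg _) (Real.one_le_exp (by positivity))

theorem convexWeight_sq_le (ω : Space n) {lam : ℝ} (hlam : 0 ≤ lam) (h : ℝ) {z : SpaceTime n}
    (hz : z.1 ∈ Icc 0 T) :
    convexWeight ω lam h z ^ 2 ≤ Real.exp (lam * T ^ 2) * weight ω h z ^ 2 := by
  rw [convexWeight_sq]
  have := hz.1
  have := hz.2
  gcongr

theorem continuous_weight (ω : Space n) (h : ℝ) : Continuous (weight ω h) := by
  unfold weight phase
  fun_prop

/-! ### Absorption and conclusion. -/

/-- Absorption of the lower order terms: the Carleman estimate for `𝓛_{𝒜,q}` with the convexified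
weight and a boundary measure satisfying the divergence theorem. -/
theorem exists_carleman_waveOp (hΩ : HasC2Boundary Ω) (ho : IsOpen Ω)
    (hb : Bornology.IsBounded Ω) (hT : 0 < T) {σ : Measure (Space n)} [IsFiniteMeasure σ]
    (hσ : ∀ᵐ x ∂σ, x ∈ frontier Ω)
    (hdiv : ∀ k : Space n → ℝ, ContDiffOn ℝ 1 k (closure Ω) → ∀ a : Space n,
        ∫ x in Ω, fderiv ℝ k x a = ∫ x, k x * ⟪outwardNormal Ω x, a⟫ ∂σ)
    {A₀ : SpaceTime n → ℝ} {A : Fin n → SpaceTime n → ℝ}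
    (hA₀ : ContDiff ℝ 1 A₀) (hA : ∀ j, ContDiff ℝ 1 (A j)) {q : SpaceTime n → ℂ}
    (hq : MemLp q ⊤ (volume.restrict (stCylinder T Ω))) {K : Set (SpaceTime n)}
    (hKdef : K = closure (stCylinder T Ω)) :
    ∃ lam : ℝ, 1 ≤ lam ∧ ∀ ω : Space n, ‖ω‖ = 1 → ∀ h : ℝ, 0 < h → h ≤ 1 →
      h * lam * (6 * T + 1) ≤ 1 → ∀ u : SpaceTime n → ℂ, ContDiffOn ℝ 2 u K →
      (∀ z ∈ lateral T Ω, u z = 0) → (∀ x ∈ Ω, u (0, x) = 0) → (∀ x ∈ Ω, dt K u (0, x) = 0) →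
      IntegrableOn (fun z => (h * weight ω h z * ‖waveOp K A₀ A q u z‖) ^ 2) (stCylinder T Ω) ∧
      h / 8 * (∫ x in Ω, convexWeight ω lam h (T, x) ^ 2 * ‖dt K u (T, x)‖ ^ 2)
      + h / 2 * (∫ z, ⟪outwardNormal Ω z.2, ω⟫ * (convexWeight ω lam h z ^ 2 * ‖dnu K Ω u z‖ ^ 2)
          ∂((volume.restrict (Ioo 0 T)).prod σ))
      + (∫ z in stCylinder T Ω, convexWeight ω lam h z ^ 2
          * (h ^ 2 * ‖dt K u z‖ ^ 2 + h ^ 2 * gradSq K u z + ‖u z‖ ^ 2))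
      ≤ 1 / 4 * (∫ z in stCylinder T Ω,
            h ^ 2 * convexWeight ω lam h z ^ 2 * ‖waveOp K A₀ A q u z‖ ^ 2)
        + 2 * h * (∫ x in Ω, convexWeight ω lam h (T, x) ^ 2 * gradSq K u (T, x))
        + (4 * lam * T + 1) * (∫ x in Ω, convexWeight ω lam h (T, x) ^ 2 * ‖u (T, x)‖ ^ 2) := by
  obtain ⟨N, hN0, hN⟩ := exists_box_bound hΩ ho hb hT hA₀ hA hq hKdef
  have hK : UniqueDiffOn ℝ K := hKdef ▸ hΩ.uniqueDiffOn_closure_stCylinder ho hT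
  -- Chosen so that `λ/10 - N/8 = 1`: after absorption the bulk norm remains with coefficient one.
  refine ⟨10 * (N / 8 + 1), by linarith, fun ω hω h hh hh1 hlamh u hu h0 hi hit => ?_⟩
  set lam := 10 * (N / 8 + 1) with hlamdef
  have hlam : 0 < lam := by positivity
  obtain ⟨hbound, hWint⟩ := hN u hu
  have hest := carleman_box hΩ ho hb hT hσ hdiv hω hlam hh hh1 hlamh hKdef hu h0 hi hit
  have hEc := continuousOn_convexWeight ω lam h K
  have hutc := (contDiffOn_dt hK hu).continuousOn
  have huxc := fun j => (contDiffOn_dx hK hu j).continuousOn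
  have hgc : ContinuousOn (gradSq K u) K :=
    continuousOn_finsetSum _ fun k _ => (huxc k).norm.pow 2
  set E := convexWeight ω lam h with hE
  have i1 : IntegrableOn (fun z => h ^ 2 * E z ^ 2 * ‖box K u z‖ ^ 2) (stCylinder T Ω) :=
    integrableOn_stCylinder hT hb (hKdef ▸
      (continuousOn_const.mul (hEc.pow 2)).mul ((continuousOn_box hK hu).norm.pow 2))
  have i2 : IntegrableOn (fun z => h ^ 2 * E z ^ 2 * ‖waveOp K A₀ A q u z‖ ^ 2)
      (stCylinder T Ω) := hWint (fun z => h ^ 2 * E z ^ 2) (continuousOn_const.mul (hEc.pow 2))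
  have i3 : IntegrableOn (fun z => E z ^ 2
      * (h ^ 2 * ‖dt K u z‖ ^ 2 + h ^ 2 * gradSq K u z + ‖u z‖ ^ 2)) (stCylinder T Ω) :=
    integrableOn_stCylinder hT hb (hKdef ▸ (hEc.pow 2).mul
      (((continuousOn_const.mul (hutc.norm.pow 2)).add (continuousOn_const.mul hgc)).add
        (hu.continuousOn.norm.pow 2)))
  have hle : ∫ z in stCylinder T Ω, h ^ 2 * E z ^ 2 * ‖box K u z‖ ^ 2
      ≤ 2 * (∫ z in stCylinder T Ω, h ^ 2 * E z ^ 2 * ‖waveOp K A₀ A q u z‖ ^ 2)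
        + N * (∫ z in stCylinder T Ω, E z ^ 2
          * (h ^ 2 * ‖dt K u z‖ ^ 2 + h ^ 2 * gradSq K u z + ‖u z‖ ^ 2)) := by
    rw [← integral_const_mul, ← integral_const_mul,
      ← integral_add (i2.const_mul 2) (i3.const_mul N)]
    refine integral_mono_ae i1 ((i2.const_mul 2).add (i3.const_mul N)) ?_
    filter_upwards [hbound] with z hz
    -- The perturbation contributes `h²|u|²`, whereas the bulk norm contains `|u|²` without a power
    -- of `h`.
    have e1 : h ^ 2 * ‖u z‖ ^ 2 ≤ 1 * ‖u z‖ ^ 2 := by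
      gcongr
      exact pow_le_one₀ hh.le hh1
    have e2 := mul_le_mul_of_nonneg_left hz (show 0 ≤ h ^ 2 * E z ^ 2 by positivity)
    have e3 := mul_le_mul_of_nonneg_left e1 (show 0 ≤ N * E z ^ 2 by positivity)
    linarith
  refine ⟨(hWint (fun z => (h * weight ω h z) ^ 2)
    ((continuous_const.mul (continuous_weight ω h)).pow 2).continuousOn).congr_fun
    (fun z _ => by simp only; ring) (isOpen_stCylinder ho).measurableSet, ?_⟩
  have hlam10 : lam / 10 = N / 8 + 1 := by rw [hlamdef]; ring
  rw [hlam10] at hest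
  linarith

/-- Bookkeeping of constants. `a₁`, `a₂`, `a₃` are the final-time, positive lateral and bulk terms
with weight `E`, and `a₀`, `l₁`, `s` their versions with `e^{-φ/h}`; `fm` is the negative lateral
term; `L`, `G`, `U` are the data with weight `E`, and the `rᵢ` the terms of the right-hand side. The
factor `8 + 2c` undoes the coefficients `1/8` and `1/2`, the latter together with the comparison
constant `c` of the boundary measures. -/
theorem carleman_constant_arith {h M B c a₀ a₁ a₂ a₃ l₁ s fm L G U r₁ r₂ r₃ r₄ : ℝ} (hh : 0 ≤ h)
    (hM : 0 ≤ M) (hB : 0 ≤ B) (hc : 0 ≤ c)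
    (hmain : h / 8 * a₁ + h / 2 * (a₂ - fm) + a₃ ≤ 1 / 4 * L + 2 * h * G + (B + 1) * U)
    (t₁ : a₀ ≤ a₁) (t₂ : U ≤ M * r₂) (t₃ : G ≤ M * r₃) (t₄ : L ≤ M * r₁) (t₅ : s ≤ a₃)
    (t₆ : l₁ ≤ c * a₂) (t₇ : fm ≤ M * (c * r₄)) (hr₁ : 0 ≤ r₁) (hr₂ : 0 ≤ r₂) (hr₃ : 0 ≤ r₃)
    (hr₄ : 0 ≤ r₄) (ha₁ : 0 ≤ a₁) (ha₂ : 0 ≤ a₂) (ha₃ : 0 ≤ a₃) :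
    h * l₁ + h * a₀ + s
      ≤ (8 + 2 * c) * (M * (B + 3 + c)) * (r₁ + r₂ + h * r₃ + h * r₄) := by
  have hS : h / 8 * a₁ + h / 2 * a₂ + a₃
      ≤ M * (B + 3 + c) * (r₁ + r₂ + h * r₃ + h * r₄) := by
    have e₁ := mul_le_mul_of_nonneg_left t₂ (show 0 ≤ B + 1 by positivity)
    have e₂ := mul_le_mul_of_nonneg_left t₃ (show 0 ≤ 2 * h by positivity)
    have e₃ := mul_le_mul_of_nonneg_left t₇ (show 0 ≤ h / 2 by positivity)
    have e₄ : 0 ≤ M * ((B + c + 11 / 4) * r₁ + (2 + c) * r₂ + (B + 1 + c) * (h * r₃)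
      + (B + 3 + c / 2) * (h * r₄)) := by positivity
    linarith
  have hL : h * l₁ + h * a₀ + s ≤ (8 + 2 * c) * (h / 8 * a₁ + h / 2 * a₂ + a₃) := by
    have e₁ := mul_le_mul_of_nonneg_left t₁ hh
    have e₂ := mul_le_mul_of_nonneg_left t₆ hh
    have e₃ : 0 ≤ c / 4 * (h * a₁) + 4 * (h * a₂) + (7 + 2 * c) * a₃ := by positivity
    linarith
  calc _ ≤ _ := hL
    _ ≤ _ := mul_le_mul_of_nonneg_left hS (by positivity)
    _ = _ := by ring

end WaveCarleman

theorem theorem3p1 {n : ℕ} (hn : 3 ≤ n) (Ω : Set (Space n)) (hΩ_open : IsOpen Ω)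
    (hΩ_bdd : Bornology.IsBounded Ω) (hΩ_sc : IsSimplyConnected Ω) (hΩ_C2 : HasC2Boundary Ω)
    (T : ℝ) (hT : Metric.diam Ω < T)
    (A₀ : SpaceTime n → ℝ) (hA₀ : IsTestFunction (stCylinder T Ω) A₀)
    (A : Fin n → SpaceTime n → ℝ) (hA : ∀ j, IsTestFunction (stCylinder T Ω) (A j))
    (q : SpaceTime n → ℂ) (hq : MemLp q ⊤ (volume.restrict (stCylinder T Ω))) :
    ∃ C : ℝ, 0 < C ∧ ∃ h₀ : ℝ, 0 < h₀ ∧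
      ∀ ω : Space n, ‖ω‖ = 1 → ∀ h : ℝ, 0 < h → h < h₀ →
        ∀ u : SpaceTime n → ℂ, ContDiffOn ℝ 2 u (closure (stCylinder T Ω)) →
          (∀ z ∈ lateral T Ω, u z = 0) →
          (∀ x ∈ Ω, u (0, x) = 0) →
          (∀ x ∈ Ω, dt (closure (stCylinder T Ω)) u (0, x) = 0) →
            carlemanLHS Ω T ω h u ≤ C * carlemanRHS Ω T A₀ A q ω h u := by
  have hT0 : 0 < T := lt_of_le_of_lt Metric.diam_nonneg hT
  obtain ⟨σ, Cσ, hσfin, hσle, hleσ, hdiv⟩ := hΩ_C2.exists_boundaryMeasure hΩ_open hΩ_bdd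
  have hSmem : ∀ᵐ x ∂(surfaceMeasure Ω), x ∈ frontier Ω :=
    ae_restrict_mem isClosed_frontier.measurableSet
  have hσmem : ∀ᵐ x ∂σ, x ∈ frontier Ω := ae_mono hσle (Measure.ae_smul_measure hSmem _)
  -- Comparability with `σ` also shows that `∂Ω` has finite area, which the product measures on the
  -- lateral boundary require.
  have hSfin : IsFiniteMeasure (surfaceMeasure Ω) := isFiniteMeasure_of_le (Cσ • σ) hleσ
  have hsm : ∀ {f : SpaceTime n → ℝ}, ContDiff ℝ (⊤ : ℕ∞) f → ContDiff ℝ 1 f := fun hf =>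
    hf.of_le (by exact_mod_cast le_top)
  obtain ⟨lam, hlam1, hest⟩ := exists_carleman_waveOp hΩ_C2 hΩ_open hΩ_bdd hT0 hσmem hdiv
    (hsm hA₀.1) (fun j => hsm (hA j).1) hq rfl
  have hlam0 : 0 ≤ lam := by linarith
  set M := Real.exp (lam * T ^ 2) with hM
  have hM0 : 0 < M := Real.exp_pos _
  -- The constant is that of `carleman_constant_arith` with `B = 4λT`. The threshold for `h` gives
  -- `hλ(6T+1) ≤ 1`, and also `h ≤ 1` because `λ ≥ 1`.
  refine ⟨(8 + 2 * Cσ) * (M * (4 * lam * T + 3 + Cσ)), by positivity,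
    1 / (lam * (6 * T + 1)), by positivity, fun ω hω h hh hh0 u hu h0 hi hit => ?_⟩
  have hpos : 0 < lam * (6 * T + 1) := by positivity
  have hlamh : h * lam * (6 * T + 1) ≤ 1 := by
    rw [lt_div_iff₀ hpos] at hh0
    linarith
  have hh1 : h ≤ 1 := by
    have : 1 ≤ lam * (6 * T + 1) := by nlinarith
    nlinarith
  obtain ⟨hWint, hmain⟩ := hest ω hω h hh hh1 hlamh u hu h0 hi hit
  set K := closure (stCylinder T Ω) with hK
  have hKu : UniqueDiffOn ℝ K := hΩ_C2.uniqueDiffOn_closure_stCylinder hΩ_open hT0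
  have hu1 : ContDiffOn ℝ 1 u K := hu.of_le (by norm_num)
  have hQm : MeasurableSet (stCylinder T Ω) := (isOpen_stCylinder hΩ_open).measurableSet
  set E := convexWeight ω lam h with hE
  set w := weight ω h with hw
  have hwc : ContinuousOn w K := (continuous_weight ω h).continuousOn
  have hEc : ContinuousOn E K := continuousOn_convexWeight ω lam h K
  have hutc := (contDiffOn_dt hKu hu).continuousOn
  have hgc : ContinuousOn (gradSq K u) K :=
    continuousOn_finsetSum _ fun k _ => (contDiffOn_dx hKu hu k).continuousOn.norm.pow 2
  have huc := hu.continuousOn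
  have hwE : ∀ z, w z ^ 2 ≤ E z ^ 2 := weight_sq_le ω hlam0 h
  have hEw : ∀ z : SpaceTime n, z.1 ∈ Icc 0 T → E z ^ 2 ≤ M * w z ^ 2 := fun z hz =>
    convexWeight_sq_le ω hlam0 h hz
  have hTmem : T ∈ Icc 0 T := right_mem_Icc.2 hT0.le
  have hgrad0 : ∀ z, 0 ≤ gradSq K u z := fun z => Finset.sum_nonneg fun _ _ => sq_nonneg _
  -- comparison of the two weights at the final time and in the cylinder
  have slice_int : ∀ {f : SpaceTime n → ℝ}, ContinuousOn f K →
      IntegrableOn (fun x => f (T, x)) Ω := fun hf => integrableOn_slice hT0 hΩ_bdd hf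
  have t1 : ∫ x in Ω, (w (T, x) * ‖dt K u (T, x)‖) ^ 2
      ≤ ∫ x in Ω, E (T, x) ^ 2 * ‖dt K u (T, x)‖ ^ 2 := by
    refine setIntegral_mono_on (slice_int (f := fun z => (w z * ‖dt K u z‖) ^ 2)
      ((hwc.mul hutc.norm).pow 2)) (slice_int (f := fun z => E z ^ 2 * ‖dt K u z‖ ^ 2)
      ((hEc.pow 2).mul (hutc.norm.pow 2))) hΩ_open.measurableSet fun x _ => ?_
    rw [mul_pow]
    exact mul_le_mul_of_nonneg_right (hwE _) (sq_nonneg _)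
  have t2 : ∫ x in Ω, E (T, x) ^ 2 * ‖u (T, x)‖ ^ 2
      ≤ M * ∫ x in Ω, (w (T, x) * ‖u (T, x)‖) ^ 2 := by
    rw [← integral_const_mul]
    refine setIntegral_mono_on (slice_int (f := fun z => E z ^ 2 * ‖u z‖ ^ 2)
      ((hEc.pow 2).mul (huc.norm.pow 2))) (slice_int (f := fun z => M * (w z * ‖u z‖) ^ 2)
      (continuousOn_const.mul ((hwc.mul huc.norm).pow 2))) hΩ_open.measurableSet fun x _ => ?_
    rw [mul_pow, ← mul_assoc]
    gcongr
    exact hEw _ hTmem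
  have t3 : ∫ x in Ω, E (T, x) ^ 2 * gradSq K u (T, x)
      ≤ M * ∫ x in Ω, w (T, x) ^ 2 * gradSq K u (T, x) := by
    rw [← integral_const_mul]
    refine setIntegral_mono_on (slice_int (f := fun z => E z ^ 2 * gradSq K u z)
      ((hEc.pow 2).mul hgc)) (slice_int (f := fun z => M * (w z ^ 2 * gradSq K u z))
      (continuousOn_const.mul ((hwc.pow 2).mul hgc))) hΩ_open.measurableSet fun x _ => ?_
    rw [← mul_assoc]
    exact mul_le_mul_of_nonneg_right (hEw _ hTmem) (hgrad0 _)
  have t4 : ∫ z in stCylinder T Ω, h ^ 2 * E z ^ 2 * ‖waveOp K A₀ A q u z‖ ^ 2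
      ≤ M * ∫ z in stCylinder T Ω, (h * w z * ‖waveOp K A₀ A q u z‖) ^ 2 := by
    rw [← integral_const_mul]
    refine integral_mono_of_nonneg (ae_of_all _ fun z => by positivity) (hWint.const_mul M) ?_
    filter_upwards [ae_restrict_mem hQm] with z hz
    have h1 := hEw z (Ioo_subset_Icc_self hz.1)
    have h2 := mul_le_mul_of_nonneg_left h1
      (show 0 ≤ h ^ 2 * ‖waveOp K A₀ A q u z‖ ^ 2 by positivity)
    linarith
  have j1 : IntegrableOn (fun z => (w z * ‖u z‖) ^ 2) (stCylinder T Ω) :=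
    integrableOn_stCylinder hT0 hΩ_bdd ((hwc.mul huc.norm).pow 2)
  have j2 : IntegrableOn (fun z => (h * w z * ‖dt K u z‖) ^ 2) (stCylinder T Ω) :=
    integrableOn_stCylinder hT0 hΩ_bdd (((continuousOn_const.mul hwc).mul hutc.norm).pow 2)
  have j3 : IntegrableOn (fun z => (h * w z) ^ 2 * gradSq K u z) (stCylinder T Ω) :=
    integrableOn_stCylinder hT0 hΩ_bdd (((continuousOn_const.mul hwc).pow 2).mul hgc)
  have j12 : IntegrableOn (fun z => (w z * ‖u z‖) ^ 2 + (h * w z * ‖dt K u z‖) ^ 2)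
      (stCylinder T Ω) := j1.add j2
  have t5 : (∫ z in stCylinder T Ω, (w z * ‖u z‖) ^ 2)
        + (∫ z in stCylinder T Ω, (h * w z * ‖dt K u z‖) ^ 2)
        + (∫ z in stCylinder T Ω, (h * w z) ^ 2 * gradSq K u z)
      ≤ ∫ z in stCylinder T Ω, E z ^ 2
          * (h ^ 2 * ‖dt K u z‖ ^ 2 + h ^ 2 * gradSq K u z + ‖u z‖ ^ 2) := by
    rw [← integral_add j1 j2, ← integral_add j12 j3]
    refine setIntegral_mono_on (j12.add j3) (integrableOn_stCylinder hT0 hΩ_bdd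
      ((hEc.pow 2).mul (((continuousOn_const.mul (hutc.norm.pow 2)).add
        (continuousOn_const.mul hgc)).add (huc.norm.pow 2)))) hQm fun z _ => ?_
    have h1 := mul_le_mul_of_nonneg_right (hwE z)
      (show 0 ≤ h ^ 2 * ‖dt K u z‖ ^ 2 + h ^ 2 * gradSq K u z + ‖u z‖ ^ 2 by
        have := hgrad0 z; positivity)
    refine le_trans (le_of_eq ?_) h1
    ring
  -- the lateral boundary
  set f : SpaceTime n → ℝ := fun z =>
    ⟪outwardNormal Ω z.2, ω⟫ * (E z ^ 2 * ‖dnu K Ω u z‖ ^ 2) with hf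
  set g : SpaceTime n → ℝ := fun z =>
    ⟪outwardNormal Ω z.2, ω⟫ * (w z * ‖dnu K Ω u z‖) ^ 2 with hg
  have hνc := continuousOn_inner_outwardNormal (T := T) hΩ_C2 hΩ_open ω
  have hdnuc := (continuousOn_dnu hΩ_C2 hΩ_open hT0 hu1).norm
  have hfc : ContinuousOn f (Icc 0 T ×ˢ frontier Ω) :=
    hνc.mul (((continuousOn_convexWeight ω lam h _).pow 2).mul (hdnuc.pow 2))
  have hgcont : ContinuousOn g (Icc 0 T ×ˢ frontier Ω) :=
    hνc.mul (((continuous_weight ω h).continuousOn.mul hdnuc).pow 2)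
  set μσ := (volume.restrict (Ioo 0 T)).prod σ with hμσ
  have hmax : ∀ {k : SpaceTime n → ℝ}, ContinuousOn k (Icc 0 T ×ˢ frontier Ω) →
      ContinuousOn (fun z => max (k z) 0) (Icc 0 T ×ˢ frontier Ω) := fun hk =>
    hk.sup continuousOn_const
  -- Comparability of measures says nothing about a signed integral, so the two signs are separated:
  -- one part has to be bounded below, the other above.
  have hfsplit : ∫ z, f z ∂μσ = (∫ z, max (f z) 0 ∂μσ) - ∫ z, max (-f z) 0 ∂μσ := by
    have if1 : Integrable (fun z => max (f z) 0) μσ :=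
      integrable_lateral hΩ_bdd hσmem (hmax hfc)
    have if2 : Integrable (fun z => max (-f z) 0) μσ :=
      integrable_lateral hΩ_bdd hσmem (hmax hfc.neg)
    rw [← integral_sub if1 if2]
    refine integral_congr_ae (ae_of_all _ fun z => ?_)
    simp only
    rcases le_total (f z) 0 with h1 | h1
    · rw [max_eq_right h1, max_eq_left (by linarith)]; ring
    · rw [max_eq_left h1, max_eq_right (by linarith)]; ring
  -- The points with `ν·ω = 0` belong to both parts of the boundary, but the integrand vanishes
  -- there.
  have hplus : ∫ z in lateralPlus T Ω ω,
        dnu K Ω (phase ω) z * (w z * ‖dnu K Ω u z‖) ^ 2 ∂(lateralMeasure Ω)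
      = ∫ z, max (g z) 0 ∂((volume.restrict (Ioo 0 T)).prod (surfaceMeasure Ω)) := by
    refine setIntegral_lateral_eq
      (isClosed_frontier_inter hΩ_C2 hΩ_open ω isClosed_Ici).measurableSet fun z hz => ⟨?_, ?_⟩
    · intro hzP
      rw [dnu_phase hΩ_C2 hΩ_open hT0 ω hz, max_eq_left (mul_nonneg hzP.2 (sq_nonneg _))]
    · intro hzP
      have h1 : ⟪outwardNormal Ω z.2, ω⟫ < 0 := not_le.1 fun h => hzP ⟨hz.2, h⟩
      exact max_eq_right (mul_nonpos_of_nonpos_of_nonneg h1.le (sq_nonneg _))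
  have hminus : ∫ z in lateralMinus T Ω ω,
        (-dnu K Ω (phase ω) z) * (w z * ‖dnu K Ω u z‖) ^ 2 ∂(lateralMeasure Ω)
      = ∫ z, max (-g z) 0 ∂((volume.restrict (Ioo 0 T)).prod (surfaceMeasure Ω)) := by
    refine setIntegral_lateral_eq
      (isClosed_frontier_inter hΩ_C2 hΩ_open ω isClosed_Iic).measurableSet fun z hz => ⟨?_, ?_⟩
    · intro hzP
      have h1 : ⟪outwardNormal Ω z.2, ω⟫ ≤ 0 := hzP.2
      rw [dnu_phase hΩ_C2 hΩ_open hT0 ω hz, max_eq_left, neg_mul]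
      exact neg_nonneg.2 (mul_nonpos_of_nonpos_of_nonneg h1 (sq_nonneg _))
    · intro hzP
      have h1 : 0 < ⟪outwardNormal Ω z.2, ω⟫ := not_le.1 fun h => hzP ⟨hz.2, h⟩
      exact max_eq_right (neg_nonpos.2 (mul_nonneg h1.le (sq_nonneg _)))
  -- `f` and `g` have the same sign, so their positive and negative parts are comparable with
  -- constants `1` and `M`.
  have hgf : ∀ z : SpaceTime n, f z = Real.exp (lam * z.1 ^ 2) * g z := fun z => by
    simp only [hf, hg, hE, convexWeight_sq]
    ring
  have t6 : ∫ z in lateralPlus T Ω ω,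
        dnu K Ω (phase ω) z * (w z * ‖dnu K Ω u z‖) ^ 2 ∂(lateralMeasure Ω)
      ≤ Cσ * ∫ z, max (f z) 0 ∂μσ := by
    rw [hplus]
    refine (integral_lateral_le hΩ_bdd hleσ hσmem (hmax hgcont)
      fun z _ => le_max_right _ _).trans ?_
    gcongr
    · exact integrable_lateral hΩ_bdd hσmem (hmax hgcont)
    · exact integrable_lateral hΩ_bdd hσmem (hmax hfc)
    · intro z
      simp only
      refine max_le ?_ (le_max_right _ _)
      rcases le_total (g z) 0 with h1 | h1
      · exact h1.trans (le_max_right _ _)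
      · refine le_trans ?_ (le_max_left _ _)
        rw [hgf z]
        exact le_mul_of_one_le_left h1 (Real.one_le_exp (by positivity))
  have t7 : ∫ z, max (-f z) 0 ∂μσ ≤ M * (Cσ * ∫ z in lateralMinus T Ω ω,
        (-dnu K Ω (phase ω) z) * (w z * ‖dnu K Ω u z‖) ^ 2 ∂(lateralMeasure Ω)) := by
    rw [hminus]
    have h1 := integral_lateral_le hΩ_bdd hσle hSmem (T := T) (hmax hgcont.neg)
      fun z _ => le_max_right _ _
    refine le_trans ?_ (mul_le_mul_of_nonneg_left h1 hM0.le)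
    rw [← integral_const_mul]
    refine integral_mono_ae (integrable_lateral hΩ_bdd hσmem (hmax hfc.neg))
      ((integrable_lateral hΩ_bdd hσmem (hmax hgcont.neg)).const_mul M) ?_
    filter_upwards [ae_mem_lateral (T := T) hσmem] with z hz
    have hexp : Real.exp (lam * z.1 ^ 2) ≤ M := by
      have := hz.1.1
      have := hz.1.2
      rw [hM]
      gcongr
    simp only [Pi.neg_apply]
    refine max_le ?_ (mul_nonneg hM0.le (le_max_right _ _))
    rw [hgf z, ← mul_neg]
    calc Real.exp (lam * z.1 ^ 2) * -g z ≤ Real.exp (lam * z.1 ^ 2) * max (-g z) 0 := by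
          gcongr; exact le_max_left _ _
      _ ≤ M * max (-g z) 0 := by
          gcongr
  -- conclusion
  simp only [carlemanLHS, carlemanRHS]
  rw [← hK, ← hw]
  rw [hfsplit] at hmain
  have p1 : 0 ≤ ∫ z in stCylinder T Ω, (h * w z * ‖waveOp K A₀ A q u z‖) ^ 2 :=
    integral_nonneg fun z => sq_nonneg _
  have p2 : 0 ≤ ∫ x in Ω, (w (T, x) * ‖u (T, x)‖) ^ 2 := integral_nonneg fun z => sq_nonneg _
  have p3 : 0 ≤ ∫ x in Ω, w (T, x) ^ 2 * gradSq K u (T, x) :=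
    integral_nonneg fun z => mul_nonneg (sq_nonneg _) (hgrad0 _)
  have p4 : 0 ≤ ∫ z in lateralMinus T Ω ω,
      (-dnu K Ω (phase ω) z) * (w z * ‖dnu K Ω u z‖) ^ 2 ∂(lateralMeasure Ω) := by
    rw [hminus]; exact integral_nonneg fun z => le_max_right _ _
  have p5 : 0 ≤ ∫ x in Ω, E (T, x) ^ 2 * ‖dt K u (T, x)‖ ^ 2 :=
    integral_nonneg fun z => by positivity
  have p6 : 0 ≤ ∫ z, max (f z) 0 ∂μσ := integral_nonneg fun z => le_max_right _ _
  have p7 : 0 ≤ ∫ z in stCylinder T Ω, E z ^ 2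
      * (h ^ 2 * ‖dt K u z‖ ^ 2 + h ^ 2 * gradSq K u z + ‖u z‖ ^ 2) :=
    integral_nonneg fun z => mul_nonneg (sq_nonneg _) (by have := hgrad0 z; positivity)
  have hfin := carleman_constant_arith hh.le hM0.le (B := 4 * lam * T) (by positivity)
    Cσ.coe_nonneg hmain t1 t2 t3 t4 t5 t6 t7 p1 p2 p3 p4 p5 p6 p7
  refine le_trans (le_of_eq ?_) hfin
  ring
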